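/- **Conventions.** A Markov process $(X^x_t)_{t\ge 0}$, $x\in\mathbb{R}^k$, is time-homogeneous, starts from $X_0^x=x$, has right-continuous paths and a measurable transition function. Its semigroup is $P^t\varphi(x)=\mathbb{E}[\varphi(X^x_t)]$. Its generator is $\mathcal{L}\varphi(x)=\lim_{h\downarrow0}h^{-1}(P^h\varphi-\varphi)(x)$. The domain $\mathcal{D}(\mathcal{L})$ is the set of bounded measurable $\varphi$ for which the quotients $h^{-1}(P^h\varphi-\varphi)$, $h>0$, are uniformly bounded and converge pointwise to a function $\mathcal{L}\varphi$ with $P^h\mathcal{L}\varphi\to\mathcal{L}\varphi$ pointwise as $h\downarrow 0$. It contains the strong domain, where the quotients converge uniformly. $B_0$ is the set of bounded measurable $\varphi$ with $\|P^h\varphi-\varphi\|_\infty\to0$ as $h\downarrow0$. For a function $c$, a function $\varphi$ is in the domain of $(\mathcal{L}-c)^k$ if $\varphi,(\mathcal{L}-c)\varphi,\dots,(\mathcal{L}-c)^{k-1}\varphi$ all belong to $\mathcal{D}(\mathcal{L})$. **Position process.** Let $X_+$ and $X_-$ be Markov processes with values in $\mathbb{R}^d$ and $\mathbb{R}^n$,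 with generators $\mathcal{L}_+$ and $\mathcal{L}_-$, defined on one probability space. For $t\in\mathbb{R}$ put $$X^{(x_1,x_2)}_t=\begin{cases}(X_+^{x_1}(t),x_2)& t\ge0,\\ (x_1,X_-^{x_2}(-t))& t<0.\end{cases}$$ Assume that for every $t>0$ the set $\{s\in[0,t]: X_-^0(s)=0\}$ is almost surely Lebesgue-null. **Time process.** Let $(Y_t)_{t\ge0}$ be a real-valued continuous process with $Y_0=0$, independent of $X_+$ and $X_-$. For $t>0$ let $Y_t$ have a density $p(t,\cdot)\ge 0$ with $$\partial_t p(t,u)=P(\partial_t,\partial_u)\,p(t,u),\qquad t>0,\ u\in\mathbb{R},$$ where $P(a,b)=\sum_{i,j}\alpha_{ij}a^ib^j$ is a polynomial with constant real coefficients. Regularity of $p$: whenever $(i,j)$ is componentwise at most $(1,0)$ or at most the exponent of some monomial of $P$, the function $p(t,\cdot)$ is $C^j$ for each $t>0$, the map $t\mapsto\partial_u^jp(t,u)$ is $C^i$ on $(0,\infty)$ for each $u$, and $\partial_t^i\partial_u^jp(t,\cdot)$ has an integrable majorant locally uniformly in $t\in(0,\infty)$. **Killing rates and initial value.** Let $c_+:\mathbb{R}^d\to\mathbb{R}_+$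 and $c_-:\mathbb{R}^n\to\mathbb{R}_+$ be continuous and bounded. Let $f:\mathbb{R}^d\to\mathbb{R}$ have an extension $\tilde f:\mathbb{R}^{d+n}\to\mathbb{R}$, bounded and measurable, such that $\tilde f(x_1,0)=f(x_1)$ for all $x_1$; $\tilde f(\cdot,x_2)\in\mathcal{D}(\mathcal{L}_+)$ for all $x_2$; $\tilde f(x_1,\cdot)\in\mathcal{D}(\mathcal{L}_-)$ for all $x_1$; $\mathcal{L}_+\tilde f$ is bounded on $\mathbb{R}^{d+n}$; and $$(\mathcal{L}_+-c_+(x_1)+\mathcal{L}_--c_-(x_2))\tilde f(x_1,x_2)=0\quad\text{for all }(x_1,x_2),$$ where $\mathcal{L}_+$ acts on $x_1$ and $\mathcal{L}_-$ on $x_2$. Put $c(x_1,x_2)=c_+(x_1)\mathbf 1_{x_2=0}-c_-(x_2)\mathbf 1_{x_2\ne0}$ and $$\nu(t,x)=\mathbb{E}\Big[\exp\Big\{-\int_0^{Y_t}c(X_s^{(x,0)})\,ds\Big\}\,\tilde f\big(X^{(x,0)}_{Y_t}\big)\Big],\qquad t\ge0,\ x\in\mathbb{R}^d .$$ **Claim.**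 The random variable in this expectation is integrable for all $t\ge0$ and $x\in\mathbb{R}^d$. For every $t>0$ and every monomial $a^ib^j$ of $P$, $\nu(t,\cdot)$ is in the domain of $(\mathcal{L}_+-c_+)^j$, and $t\mapsto(\mathcal{L}_+-c_+)^j\nu(t,x)$ is $C^i$ on $(0,\infty)$ for every $x$. If multiplication by $c_+$ maps the space $B_0$ of $X_+$ into itself, then $\nu(t,\cdot),\dots,(\mathcal{L}_+-c_+)^{j-1}\nu(t,\cdot)$ are even in the strong domain of $\mathcal{L}_+$. The function $\nu$ solves $$\partial_t\nu(t,x)=P\big(\partial_t,-(\mathcal{L}_+-c_+(x))\big)\nu(t,x)=\sum_{i,j}\alpha_{ij}(-1)^j\,\partial_t^i\big[(\mathcal{L}_+-c_+)^j\nu\big](t,x),\qquad t>0,\ x\in\mathbb{R}^d,$$ with initial condition $\nu(0,x)=f(x)$, and $\nu(t,x)\to f(x)$ as $t\downarrow0$, for every $x$. -/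

import Mathlib

open MeasureTheory ProbabilityTheory Filter Topology Set
open scoped NNReal

namespace IteratedTime

noncomputable section

/-! ### Markov processes, transition semigroups and generators -/

section Markov

variable {Ω E : Type*} [MeasurableSpace Ω] [MeasurableSpace E]

/-- The sigma-algebra generated by the process started at `x` up to time `s`. -/
def past (X : E → ℝ≥0 → Ω → E) (x : E) (s : ℝ≥0) : MeasurableSpace Ω :=
  ⨆ r ∈ Set.Iic s, MeasurableSpace.comap (X x r) inferInstance

/-- `X x t` is the position at time `t` of a time-homogeneous Markov process started at `x`,
with right-continuous paths. The transition function is `x, A ↦ P (X x t ∈ A)`. -/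
structure IsMarkovFamily [TopologicalSpace E] (P : Measure Ω) (X : E → ℝ≥0 → Ω → E) :
    Prop where
  measurable : ∀ x t, Measurable (X x t)
  start : ∀ x, ∀ᵐ ω ∂P, X x 0 ω = x
  rightContinuous : ∀ x, ∀ᵐ ω ∂P, ∀ t : ℝ≥0,
    ContinuousWithinAt (fun s => X x s ω) (Set.Ici t) t
  measurable_transition : ∀ (t : ℝ≥0) (A : Set E), MeasurableSet A →
    Measurable fun x => P (X x t ⁻¹' A)
  markov : ∀ (x : E) (s t : ℝ≥0) (A : Set E), MeasurableSet A →
    P[(X x (s + t) ⁻¹' A).indicator (fun _ => (1 : ℝ)) | past X x s]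
      =ᵐ[P] fun ω => P.real (X (X x s ω) t ⁻¹' A)

/-- The transition semigroup `(P^t φ)(x) = E[φ(X^x_t)]`. -/
def semigroup (P : Measure Ω) (X : E → ℝ≥0 → Ω → E) (t : ℝ≥0) (φ : E → ℝ) (x : E) : ℝ :=
  ∫ ω, φ (X x t ω) ∂P

/-- The difference quotient `(P^h φ - φ)(x) / h`. -/
def quotient (P : Measure Ω) (X : E → ℝ≥0 → Ω → E) (φ : E → ℝ) (h : ℝ≥0) (x : E) : ℝ :=
  (semigroup P X h φ x - φ x) / h

/-- The infinitesimal generator: `(L φ)(x) = lim_{h ↓ 0} (P^h φ - φ)(x) / h`. -/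
def generator (P : Measure Ω) (X : E → ℝ≥0 → Ω → E) (φ : E → ℝ) (x : E) : ℝ :=
  limUnder (𝓝[>] (0 : ℝ≥0)) fun h => quotient P X φ h x

/-- Bounded measurable functions. -/
def IsBddMeas (φ : E → ℝ) : Prop :=
  Measurable φ ∧ ∃ C : ℝ, ∀ x, |φ x| ≤ C

/-- The domain of the (weak) infinitesimal generator: the difference quotients converge
boundedly and pointwise to a function `L φ` such that `P^h (L φ) → L φ` pointwise. -/
structure InDomain (P : Measure Ω) (X : E → ℝ≥0 → Ω → E) (φ : E → ℝ) : Prop where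
  isBddMeas : IsBddMeas φ
  bounded : ∃ C : ℝ, ∀ (h : ℝ≥0) (x : E), 0 < h → |quotient P X φ h x| ≤ C
  tendsto : ∀ x, Tendsto (fun h => quotient P X φ h x) (𝓝[>] 0) (𝓝 (generator P X φ x))
  tendsto_semigroup : ∀ x, Tendsto (fun h => semigroup P X h (generator P X φ) x) (𝓝[>] 0)
    (𝓝 (generator P X φ x))

/-- The domain of the strong infinitesimal generator: the difference quotients converge
uniformly. -/
structure InStrongDomain (P : Measure Ω) (X : E → ℝ≥0 → Ω → E) (φ : E → ℝ) : Prop where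
  isBddMeas : IsBddMeas φ
  tendsto : TendstoUniformly (fun h => quotient P X φ h) (generator P X φ) (𝓝[>] 0)

/-- The space `B₀` of bounded measurable functions `φ` with `‖P^h φ - φ‖_∞ → 0` as `h ↓ 0`. -/
def InB0 (P : Measure Ω) (X : E → ℝ≥0 → Ω → E) (φ : E → ℝ) : Prop :=
  IsBddMeas φ ∧ TendstoUniformly (fun h => semigroup P X h φ) φ (𝓝[>] 0)

/-- The operator `L - c`. -/
def killedGenerator (P : Measure Ω) (X : E → ℝ≥0 → Ω → E) (c : E → ℝ) (φ : E → ℝ) : E → ℝ :=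
  fun x => generator P X φ x - c x * φ x

/-- `φ` is in the domain of `(L - c)^k`: all of `φ, (L - c) φ, …, (L - c)^(k-1) φ` are in the
domain of `L`. -/
def InKilledDomainPow (P : Measure Ω) (X : E → ℝ≥0 → Ω → E) (c : E → ℝ) (k : ℕ)
    (φ : E → ℝ) : Prop :=
  ∀ i < k, InDomain P X ((killedGenerator P X c)^[i] φ)

/-- The same with the strong domain of `L`. -/
def InStrongKilledDomainPow (P : Measure Ω) (X : E → ℝ≥0 → Ω → E) (c : E → ℝ) (k : ℕ)
    (φ : E → ℝ) : Prop :=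
  ∀ i < k, InStrongDomain P X ((killedGenerator P X c)^[i] φ)

end Markov

/-! ### The position process indexed by the real line and the killed functional -/

section Position

variable {Ω E F : Type*} [MeasurableSpace Ω]

/-- The process indexed by the real line: `(X₊^{x₁}(t), x₂)` for `t ≥ 0` and
`(x₁, X₋^{x₂}(-t))` for `t < 0`. -/
def twoSided (Xp : E → ℝ≥0 → Ω → E) (Xm : F → ℝ≥0 → Ω → F) (z : E × F) (t : ℝ) (ω : Ω) :
    E × F :=
  if 0 ≤ t then (Xp z.1 t.toNNReal ω, z.2) else (z.1, Xm z.2 (-t).toNNReal ω)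

open Classical in
/-- `c(x₁, x₂) = c₊(x₁) 1_{x₂ = 0} - c₋(x₂) 1_{x₂ ≠ 0}`. -/
def killingRate [Zero F] (cp : E → ℝ) (cm : F → ℝ) (z : E × F) : ℝ :=
  if z.2 = 0 then cp z.1 else -cm z.2

/-- The random variable `exp(-∫_0^{Y_t} c(X_s^{(x,0)}) ds) f̃(X^{(x,0)}_{Y_t})`, where `t ≥ 0`. -/
def killedFunctional [Zero F] (Xp : E → ℝ≥0 → Ω → E) (Xm : F → ℝ≥0 → Ω → F)
    (Y : ℝ≥0 → Ω → ℝ) (cp : E → ℝ) (cm : F → ℝ) (ftilde : E × F → ℝ) (t : ℝ) (x : E)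
    (ω : Ω) : ℝ :=
  Real.exp (-∫ s in (0 : ℝ)..(Y t.toNNReal ω),
      killingRate cp cm (twoSided Xp Xm (x, 0) s ω)) *
    ftilde (twoSided Xp Xm (x, 0) (Y t.toNNReal ω) ω)

/-- Its expectation `ν(t, x)`. -/
def killedValue [Zero F] (P : Measure Ω) (Xp : E → ℝ≥0 → Ω → E) (Xm : F → ℝ≥0 → Ω → F)
    (Y : ℝ≥0 → Ω → ℝ) (cp : E → ℝ) (cm : F → ℝ) (ftilde : E × F → ℝ) (t : ℝ) (x : E) : ℝ :=
  ∫ ω, killedFunctional Xp Xm Y cp cm ftilde t x ω ∂P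

end Position

/-! ### The density of the time process -/

/-- `∂_t^i ∂_u^j p (t, u)`. -/
def mixedDeriv (p : ℝ → ℝ → ℝ) (i j : ℕ) (t u : ℝ) : ℝ :=
  iteratedDeriv i (fun τ => iteratedDeriv j (p τ) u) t

/-- The orders `(i, j)` of differentiation in `(t, u)` that are needed to write down
`∂_t p = Q(∂_t, ∂_u) p`: those below `(1, 0)` or below the exponents of a monomial of `Q`. -/
def IsOrder (Q : MvPolynomial (Fin 2) ℝ) (i j : ℕ) : Prop :=
  (i ≤ 1 ∧ j = 0) ∨ ∃ m ∈ Q.support, i ≤ m 0 ∧ j ≤ m 1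

/-- Regularity of the density `p` on `(0, ∞) × ℝ` with respect to the operator
`∂_t - Q(∂_t, ∂_u)`: the derivatives that occur exist, are continuous in each variable of
differentiation and are integrable in `u`, locally uniformly in `t` (that is, with an
integrable majorant). -/
structure IsRegularDensity (Q : MvPolynomial (Fin 2) ℝ) (p : ℝ → ℝ → ℝ) : Prop where
  space : ∀ i j, IsOrder Q i j → ∀ t > 0, ContDiff ℝ j (p t)
  time : ∀ i j, IsOrder Q i j → ∀ u,
    ContDiffOn ℝ i (fun τ => iteratedDeriv j (p τ) u) (Set.Ioi 0)
  dominated : ∀ i j, IsOrder Q i j → ∀ t > 0, ∃ g : ℝ → ℝ, Integrable g ∧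
    ∀ᶠ τ in 𝓝 t, ∀ u, |mixedDeriv p i j τ u| ≤ g u

end

end IteratedTime

/-! Let `T_h` be the Feynman–Kac semigroup of `X₊` with rate `c₊` and `S_s` that of `X₋` with rate
`c₋`. Conditioning on the time process turns the killed functional into `g_u(x)` at `u = Y_t`, where
`g_u = T_u f` for `u ≥ 0` and `g_u(x) = S_{-u} f̃(x, ·)(0)` for `u < 0`
(`integrable_killedFunctional`). Hence `ν(t, x) = ∫ p(t, u) g_u(x) du` for `t > 0`.

The extension `f̃` is what makes `g` a complete orbit: `T_h g_u = g_{u+h}` for every real `u`, as if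
`T` could be run backwards from `f`. Indeed `T_h S_s f̃` has derivative `T_h S_s (L₊ - c₊) f̃` in
`h` and, by the equation for `f̃`, the opposite derivative in `s`. It is therefore constant along
the diagonals `(h + r, s + r)`, and sliding down a diagonal to an axis gives the claim (`fk₂_diag`,
`fk_orbit`). Both derivatives exist only in integrated form with a bounded measurable density, so
`diag_const` replaces the chain rule by an averaging argument.

Once `g` is an orbit, `T_h` acts on averages by translating the weight: `T_h ∫ q(u) g_u du = ∫ q(u -
h) g_u du` (`fk_avg`). Continuity of translation in `L¹` then gives, uniformly in `x`, that `L₊ -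
c₊` turns the weight `q` into `-q'`. Iterating, `(L₊ - c₊)^j ν` is the average of `(-1)^j ∂_u^j p`
(`killedGenerator_iterate`), time derivatives pass under the integral, and the equation for `p`
becomes the equation for `ν` (`hasDerivAt_of_density`).

Passing from `T` back to the unkilled semigroup costs the term `c₊ φ`. In general this is controlled
only pointwise, which gives the weak domain (`inDomain_avg`); if multiplication by `c₊` preserves
`B₀` the control is uniform, which gives the strong domain (`inStrongDomain_avg`). The semigroup
property and Dynkin's formula for `T` and `S` (`fk_add`, `fk_sub_eq_integral`) are derived from the
one-time Markov property by discretising the exponential weight. -/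

namespace IteratedTime

noncomputable section

set_option linter.unusedSectionVars false

/-! ### Measurable versions of right-continuous paths and their weights. -/

section Paths

variable {E : Type*} [TopologicalSpace E]

/-- The value at time `t` of a right-continuous path, computed from its values at rational times,
so that it is jointly measurable in the path and in `t`. -/
def regPath [Nonempty E] (w : ℝ≥0 → E) (t : ℝ) : E :=
  limUnder atTop fun n : ℕ => w (((⌊((n : ℝ) + 1) * t⌋₊ + 1 : ℕ) : ℝ≥0) / ((n : ℝ≥0) + 1))

/-- Right-continuity of a path. -/
def IsRightCts (w : ℝ≥0 → E) : Prop := ∀ t : ℝ≥0, ContinuousWithinAt w (Set.Ici t) t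

/-- The sampling times approach from the right, so right-continuity alone identifies the limit of
the sampled positions. -/
lemma tendsto_approx_time (t : ℝ) :
    Tendsto (fun n : ℕ => ((⌊((n : ℝ) + 1) * t⌋₊ + 1 : ℕ) : ℝ≥0) / ((n : ℝ≥0) + 1)) atTop
      (𝓝[Set.Ici t.toNNReal] t.toNNReal) := by
  have hlow : ∀ n : ℕ, t.toNNReal ≤ ((⌊((n : ℝ) + 1) * t⌋₊ + 1 : ℕ) : ℝ≥0) / ((n : ℝ≥0) + 1) := by
    intro n
    rw [le_div_iff₀ (by positivity)]
    rcases le_total t 0 with ht | ht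
    · simp [Real.toNNReal_of_nonpos ht]
    · rw [← NNReal.coe_le_coe]
      push_cast
      rw [Real.coe_toNNReal _ ht, mul_comm]
      exact (Nat.lt_floor_add_one _).le
  have hup : ∀ n : ℕ, ((⌊((n : ℝ) + 1) * t⌋₊ + 1 : ℕ) : ℝ≥0) / ((n : ℝ≥0) + 1)
      ≤ t.toNNReal + 1 / ((n : ℝ≥0) + 1) := by
    intro n
    rw [div_le_iff₀ (by positivity), add_mul t.toNNReal, one_div_mul_cancel (by positivity)]
    push_cast
    gcongr
    rcases le_total t 0 with ht | ht
    · rw [Nat.floor_of_nonpos (mul_nonpos_of_nonneg_of_nonpos (by positivity) ht)]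
      simp
    · rw [← NNReal.coe_le_coe]
      push_cast
      rw [Real.coe_toNNReal _ ht, mul_comm t]
      exact Nat.floor_le (by positivity)
  refine tendsto_nhdsWithin_iff.2 ⟨?_, .of_forall hlow⟩
  refine tendsto_of_tendsto_of_tendsto_of_le_of_le tendsto_const_nhds ?_ hlow hup
  have h := (tendsto_one_div_add_atTop_nhds_zero_nat (𝕜 := ℝ≥0)).const_add t.toNNReal
  simpa using h

lemma regPath_eq [T2Space E] [Nonempty E] {w : ℝ≥0 → E} (hw : IsRightCts w) (t : ℝ) :
    regPath w t = w t.toNNReal :=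
  Tendsto.limUnder_eq ((hw t.toNNReal).tendsto.comp (tendsto_approx_time t))

variable [PolishSpace E] [MeasurableSpace E] [BorelSpace E] [Nonempty E]

/-- The floor takes countably many values, and for each of them the sampled position is a coordinate
of the path. -/
lemma measurable_regPath : Measurable fun z : (ℝ≥0 → E) × ℝ => regPath z.1 z.2 := by
  refine StronglyMeasurable.measurable (StronglyMeasurable.limUnder fun n => ?_)
  refine Measurable.stronglyMeasurable ?_
  have h1 : Measurable fun z : (ℝ≥0 → E) × ℕ => z.1 (((z.2 + 1 : ℕ) : ℝ≥0) / ((n : ℝ≥0) + 1)) :=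
    measurable_from_prod_countable_left fun k =>
      measurable_pi_apply (((k + 1 : ℕ) : ℝ≥0) / ((n : ℝ≥0) + 1))
  have h2 : Measurable fun z : (ℝ≥0 → E) × ℝ => (z.1, ⌊((n : ℝ) + 1) * z.2⌋₊) := by
    refine measurable_fst.prodMk ?_
    exact Nat.measurable_floor.comp (measurable_snd.const_mul _)
  exact h1.comp h2

attribute [irreducible] regPath

/-- The exponential weight `exp(-∫_0^u c(w_s) ds)` of a path. -/
def regWeight (c : E → ℝ) (w : ℝ≥0 → E) (u : ℝ) : ℝ :=
  Real.exp (-∫ s in (0 : ℝ)..u, c (regPath w s))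

lemma measurable_regWeight {c : E → ℝ} (hc : Measurable c) :
    Measurable fun z : (ℝ≥0 → E) × ℝ => regWeight c z.1 z.2 := by
  -- Rescaling to `[0, 1]` makes the domain of integration independent of the parameter, so
  -- measurability of parametrised integrals applies; the identity holds for negative times too.
  have h : ∀ z : (ℝ≥0 → E) × ℝ, regWeight c z.1 z.2 =
      Real.exp (-(z.2 * ∫ s in (0 : ℝ)..1, c (regPath z.1 (z.2 * s)))) := by
    intro z
    rw [intervalIntegral.mul_integral_comp_mul_left (f := fun s => c (regPath z.1 s))]
    simp [regWeight]
  simp_rw [h, intervalIntegral.integral_of_le zero_le_one]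
  have h3 : Measurable fun q : ((ℝ≥0 → E) × ℝ) × ℝ => c (regPath q.1.1 (q.1.2 * q.2)) := by
    have h5 : Measurable fun q : ((ℝ≥0 → E) × ℝ) × ℝ => (q.1.1, q.1.2 * q.2) :=
      (measurable_fst.comp measurable_fst).prodMk
        ((measurable_snd.comp measurable_fst).mul measurable_snd)
    have h6 := (measurable_regPath (E := E)).comp h5
    exact hc.comp h6
  have h4 : Measurable fun z : (ℝ≥0 → E) × ℝ =>
      ∫ s in Set.Ioc (0 : ℝ) 1, c (regPath z.1 (z.2 * s)) :=
    (StronglyMeasurable.integral_prod_right' (ν := volume.restrict (Set.Ioc (0 : ℝ) 1))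
      h3.stronglyMeasurable).measurable
  exact (measurable_snd.mul h4).neg.exp

end Paths

/-! ### The Markov property for bounded functions. -/

section MarkovProperty

variable {Ω E : Type*} [MeasurableSpace Ω] [TopologicalSpace E] [MeasurableSpace E]
  {P : Measure Ω} {X : E → ℝ≥0 → Ω → E}

lemma past_le (hX : IsMarkovFamily P X) (x : E) (s : ℝ≥0) :
    past X x s ≤ ‹MeasurableSpace Ω› :=
  iSup₂_le fun r _ => (hX.measurable x r).comap_le

lemma past_mono (x : E) {r s : ℝ≥0} (h : r ≤ s) : past X x r ≤ past X x s :=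
  biSup_mono fun _ hq => le_trans (Set.mem_Iic.1 hq) h

lemma measurable_past (x : E) {r s : ℝ≥0} (h : r ≤ s) : Measurable[past X x s] (X x r) :=
  Measurable.mono (comap_measurable (X x r))
    (le_iSup₂_of_le (f := fun r (_ : r ∈ Set.Iic s) =>
      MeasurableSpace.comap (X x r) inferInstance) r h le_rfl) le_rfl

/-- The transition kernel of a Markov process. -/
def transKernel (hX : IsMarkovFamily P X) (t : ℝ≥0) : Kernel E E where
  toFun x := P.map (X x t)
  measurable' := Measure.measurable_of_measurable_coe _ fun A hA => by
    simp_rw [Measure.map_apply (hX.measurable _ t) hA]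
    exact hX.measurable_transition t A hA

variable [IsProbabilityMeasure P]

instance (hX : IsMarkovFamily P X) (t : ℝ≥0) : IsMarkovKernel (transKernel hX t) :=
  ⟨fun x => Measure.isProbabilityMeasure_map (hX.measurable x t).aemeasurable⟩

lemma semigroup_eq_integral_transKernel (hX : IsMarkovFamily P X) (t : ℝ≥0) {φ : E → ℝ}
    (hφ : Measurable φ) (x : E) : semigroup P X t φ x = ∫ y, φ y ∂(transKernel hX t x) :=
  (integral_map (hX.measurable x t).aemeasurable hφ.aestronglyMeasurable).symm

lemma measurable_semigroup (hX : IsMarkovFamily P X) (t : ℝ≥0) {φ : E → ℝ}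
    (hφ : Measurable φ) : Measurable (semigroup P X t φ) := by
  simp_rw [funext (semigroup_eq_integral_transKernel hX t hφ)]
  exact (StronglyMeasurable.integral_kernel hφ.stronglyMeasurable).measurable

lemma abs_integral_le_of_forall_abs_le {g : Ω → ℝ} {C : ℝ} (hg : ∀ ω, |g ω| ≤ C) :
    |∫ ω, g ω ∂P| ≤ C := by
  simpa using norm_integral_le_of_norm_le_const (μ := P) (f := g) (.of_forall hg)

lemma abs_semigroup_le (t : ℝ≥0) {φ : E → ℝ} {C : ℝ} (hφ : ∀ x, |φ x| ≤ C) (x : E) :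
    |semigroup P X t φ x| ≤ C :=
  abs_integral_le_of_forall_abs_le fun _ => hφ _

lemma integrable_of_bdd {g : Ω → ℝ} (hg : Measurable g) {C : ℝ} (hC : ∀ ω, |g ω| ≤ C) :
    Integrable g P :=
  Integrable.of_bound hg.aestronglyMeasurable C (.of_forall hC)

/-- The Markov property for events, read as an identity of measures. Integrating against both sides
extends it to bounded functions with no approximation by simple functions. -/
lemma map_restrict_eq (hX : IsMarkovFamily P X) (x : E) (s t : ℝ≥0) {B : Set Ω}
    (hB : MeasurableSet[past X x s] B) :
    (P.restrict B).map (X x (s + t)) = (transKernel hX t) ∘ₘ ((P.restrict B).map (X x s)) := by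
  have hB' : MeasurableSet B := past_le hX x s _ hB
  ext A hA
  have hAm : MeasurableSet (X x (s + t) ⁻¹' A) := hX.measurable x (s + t) hA
  rw [Measure.map_apply (hX.measurable _ _) hA, Measure.restrict_apply hAm,
    Measure.bind_apply hA (Kernel.aemeasurable _),
    lintegral_map (Kernel.measurable_coe _ hA) (hX.measurable _ _)]
  have h1 := setIntegral_condExp (past_le hX x s) (μ := P)
    ((integrable_const (1 : ℝ)).indicator hAm) hB
  rw [setIntegral_congr_ae hB' ((hX.markov x s t A hA).mono fun ω h _ => h),
    setIntegral_indicator hAm] at h1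
  have h2 : ∀ ω, transKernel hX t (X x s ω) A = P (X (X x s ω) t ⁻¹' A) := fun ω =>
    Measure.map_apply (hX.measurable _ _) hA
  have h3 : Measurable fun ω => transKernel hX t (X x s ω) A :=
    (Kernel.measurable_coe _ hA).comp (hX.measurable _ _)
  rw [setIntegral_const, smul_eq_mul, mul_one] at h1
  have h4 := integral_toReal (μ := P.restrict B) h3.aemeasurable
    (.of_forall fun ω => measure_lt_top _ _)
  simp only [h2] at h4 ⊢
  simp only [Measure.real] at h1
  rw [h4, inter_comm] at h1
  refine ((ENNReal.toReal_eq_toReal_iff' ?_ (measure_ne_top _ _)).1 h1).symm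
  refine ne_top_of_le_ne_top (measure_ne_top P B) ?_
  calc ∫⁻ ω in B, P (X (X x s ω) t ⁻¹' A) ∂P ≤ ∫⁻ ω in B, 1 ∂P :=
        lintegral_mono fun ω => prob_le_one
    _ = P B := by simp

/-- The Markov property for bounded functions of one later position. -/
lemma condExp_comp (hX : IsMarkovFamily P X) (x : E) (s t : ℝ≥0) {φ : E → ℝ}
    (hφ : IsBddMeas φ) :
    (fun ω => semigroup P X t φ (X x s ω)) =ᵐ[P]
      P[fun ω => φ (X x (s + t) ω) | past X x s] := by
  obtain ⟨hm, C, hC⟩ := hφ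
  have hsm := measurable_semigroup hX t hm
  refine ae_eq_condExp_of_forall_setIntegral_eq (past_le hX x s)
    (integrable_of_bdd (hm.comp (hX.measurable _ _)) fun _ => hC _) (fun B _ _ =>
    (integrable_of_bdd (hsm.comp (hX.measurable _ _)) fun _ =>
      abs_semigroup_le t hC _).integrableOn) (fun B hB _ => ?_)
    (hsm.comp (measurable_past x le_rfl)).aestronglyMeasurable
  have hint : Integrable φ ((P.restrict B).map (X x (s + t))) :=
    Integrable.of_bound hm.aestronglyMeasurable C (.of_forall hC)
  have h1 : ∫ ω in B, φ (X x (s + t) ω) ∂P =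
      ∫ y, φ y ∂((transKernel hX t) ∘ₘ ((P.restrict B).map (X x s))) := by
    rw [← map_restrict_eq hX x s t hB,
      integral_map (hX.measurable x (s + t)).aemeasurable hm.aestronglyMeasurable]
  rw [map_restrict_eq hX x s t hB, Measure.comp_eq_comp_const_apply] at hint
  rw [h1, Measure.comp_eq_comp_const_apply, Kernel.integral_comp hint, Kernel.const_apply,
    integral_map (hX.measurable x s).aemeasurable]
  · simp_rw [semigroup_eq_integral_transKernel hX t hm]
  · exact (StronglyMeasurable.integral_kernel hm.stronglyMeasurable).aestronglyMeasurable

lemma integral_mul_comp (hX : IsMarkovFamily P X) (x : E) (s t : ℝ≥0) {φ : E → ℝ}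
    (hφ : IsBddMeas φ) {W : Ω → ℝ} (hW : Measurable[past X x s] W) {D : ℝ}
    (hWD : ∀ ω, |W ω| ≤ D) :
    ∫ ω, W ω * φ (X x (s + t) ω) ∂P = ∫ ω, W ω * semigroup P X t φ (X x s ω) ∂P := by
  have hint : Integrable (fun ω => φ (X x (s + t) ω)) P :=
    integrable_of_bdd (hφ.1.comp (hX.measurable _ _)) fun _ => hφ.2.choose_spec _
  have h1 := condExp_stronglyMeasurable_mul_of_bound (past_le hX x s) (hW.stronglyMeasurable)
    hint D (.of_forall hWD)
  have h2 := integral_condExp (past_le hX x s) (μ := P) (f := W * fun ω => φ (X x (s + t) ω))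
  rw [integral_congr_ae h1] at h2
  rw [show (∫ ω, W ω * φ (X x (s + t) ω) ∂P) = ∫ ω, (W * fun ω => φ (X x (s + t) ω)) ω ∂P
    from rfl, ← h2]
  refine integral_congr_ae ?_
  filter_upwards [condExp_comp hX x s t hφ] with ω hω
  simp [← hω]

end MarkovProperty

/-! ### Weights of paths and Riemann sums. -/

section Riemann

/-- Bounded continuous killing rates. -/
structure IsRate {E : Type*} [TopologicalSpace E] (c : E → ℝ) : Prop where
  continuous : Continuous c
  nonneg : ∀ x, 0 ≤ c x
  bdd : ∃ C, ∀ x, c x ≤ C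

/-- The exponential weight `exp(-∫_0^u c(w_s) ds)` of a path. -/
def weight {E : Type*} (c : E → ℝ) (w : ℝ≥0 → E) (u : ℝ) : ℝ :=
  Real.exp (-∫ s in (0 : ℝ)..u, c (w s.toNNReal))

/-- Writing the right-endpoint sum as the integral of a step function reduces convergence of Riemann
sums to dominated convergence. -/
lemma sum_eq_integral_ceil (H : ℕ → ℝ) (n : ℕ) :
    ∑ k ∈ Finset.range (n + 1), (1 / ((n : ℝ) + 1)) * H (k + 1) =
      ∫ s in (0 : ℝ)..1, H ⌈((n : ℝ) + 1) * s⌉₊ := by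
  have hn : (0 : ℝ) < (n : ℝ) + 1 := by positivity
  set a : ℕ → ℝ := fun k => k / ((n : ℝ) + 1) with ha
  have hle : ∀ k, a k ≤ a (k + 1) := fun k => by simp only [ha]; gcongr; simp
  have hceil : ∀ k, ∀ s ∈ Set.Ioc (a k) (a (k + 1)), H ⌈((n : ℝ) + 1) * s⌉₊ = H (k + 1) := by
    intro k s hs
    congr 1
    rw [Nat.ceil_eq_iff (by simp)]
    simp only [ha, Set.mem_Ioc, div_lt_iff₀ hn, le_div_iff₀ hn] at hs
    constructor
    · simpa [mul_comm] using hs.1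
    · simpa [mul_comm] using hs.2
  have h1 : ∀ k, ∫ s in a k..a (k + 1), H ⌈((n : ℝ) + 1) * s⌉₊ = (1 / ((n : ℝ) + 1)) * H (k + 1) := by
    intro k
    rw [intervalIntegral.integral_of_le (hle k),
      setIntegral_congr_fun measurableSet_Ioc (hceil k), setIntegral_const]
    simp only [Measure.real, Real.volume_Ioc, smul_eq_mul]
    rw [ENNReal.toReal_ofReal (sub_nonneg.2 (hle k))]
    simp only [ha]
    push_cast
    ring
  have h2 := intervalIntegral.sum_integral_adjacent_intervals (a := a) (n := n + 1)
    (f := fun s => H ⌈((n : ℝ) + 1) * s⌉₊) (μ := volume) fun k _ => by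
      rw [intervalIntegrable_iff_integrableOn_Ioc_of_le (hle k)]
      exact (integrableOn_congr_fun (hceil k) measurableSet_Ioc).2 (integrableOn_const (by simp))
  simp_rw [h1] at h2
  rw [h2]
  simp [ha, hn.ne']

variable {E : Type*} [TopologicalSpace E] [PolishSpace E] [MeasurableSpace E] [BorelSpace E]
  [Nonempty E]

lemma measurable_of_isRightCts {w : ℝ≥0 → E} (hw : IsRightCts w) :
    Measurable fun s : ℝ => w s.toNNReal := by
  simp_rw [← regPath_eq hw]
  exact (measurable_regPath (E := E)).comp (measurable_const.prodMk measurable_id)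

lemma regWeight_eq {c : E → ℝ} {w : ℝ≥0 → E} (hw : IsRightCts w) (u : ℝ) :
    regWeight c w u = weight c w u := by
  simp_rw [regWeight, weight, regPath_eq hw]

lemma IsRate.abs_le {c : E → ℝ} (hc : IsRate c) : ∃ C, 0 ≤ C ∧ ∀ x, |c x| ≤ C := by
  obtain ⟨C, hC⟩ := hc.bdd
  have h0 := hc.nonneg (Classical.arbitrary E)
  exact ⟨C, h0.trans (hC _), fun x => by rw [abs_of_nonneg (hc.nonneg x)]; exact hC x⟩

lemma intervalIntegrable_rate {c : E → ℝ} (hc : IsRate c) {w : ℝ≥0 → E} (hw : IsRightCts w)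
    (a b : ℝ) : IntervalIntegrable (fun s : ℝ => c (w s.toNNReal)) volume a b := by
  obtain ⟨C, -, hC⟩ := hc.abs_le
  have hm : Measurable fun s : ℝ => c (w s.toNNReal) :=
    hc.continuous.measurable.comp (measurable_of_isRightCts hw)
  exact (intervalIntegrable_const (c := C)).mono_fun hm.aestronglyMeasurable
    (.of_forall fun s => (hC _).trans (le_abs_self C))

lemma weight_pos (c : E → ℝ) (w : ℝ≥0 → E) (u : ℝ) : 0 < weight c w u := Real.exp_pos _

lemma integral_rate_nonneg {c : E → ℝ} (hc : IsRate c) (w : ℝ≥0 → E) {a b : ℝ} (hab : a ≤ b) :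
    0 ≤ ∫ s in a..b, c (w s.toNNReal) :=
  intervalIntegral.integral_nonneg_of_forall hab fun _ => hc.nonneg _

lemma weight_le_one {c : E → ℝ} (hc : IsRate c) (w : ℝ≥0 → E) {u : ℝ} (hu : 0 ≤ u) :
    weight c w u ≤ 1 :=
  Real.exp_le_one_iff.2 (neg_nonpos.2 (integral_rate_nonneg hc w hu))

lemma abs_weight_le_one {c : E → ℝ} (hc : IsRate c) (w : ℝ≥0 → E) {u : ℝ} (hu : 0 ≤ u) :
    |weight c w u| ≤ 1 := by
  rw [abs_of_pos (weight_pos c w u)]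
  exact weight_le_one hc w hu

/-- Convergence of Riemann sums along a right-continuous path. -/
lemma tendsto_riemann {c : E → ℝ} (hc : IsRate c) {w : ℝ≥0 → E} (hw : IsRightCts w)
    (a u : ℝ≥0) :
    Tendsto (fun n : ℕ => ∑ k ∈ Finset.range (n + 1), ((u / (n + 1) : ℝ≥0) : ℝ) *
      c (w (a + ((k + 1 : ℕ) : ℝ≥0) * (u / (n + 1))))) atTop
      (𝓝 (∫ s in (a : ℝ)..(a + u), c (w s.toNNReal))) := by
  obtain ⟨C, hC0, hC⟩ := hc.abs_le
  have hsum : ∀ n : ℕ, ∑ k ∈ Finset.range (n + 1), ((u / (n + 1) : ℝ≥0) : ℝ) *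
      c (w (a + ((k + 1 : ℕ) : ℝ≥0) * (u / (n + 1)))) =
      u * ∫ s in (0 : ℝ)..1, c (w (a + (⌈((n : ℝ) + 1) * s⌉₊ : ℝ≥0) * (u / (n + 1)))) := by
    intro n
    rw [← sum_eq_integral_ceil (fun m => c (w (a + (m : ℝ≥0) * (u / (n + 1))))), Finset.mul_sum]
    refine Finset.sum_congr rfl fun k _ => ?_
    push_cast
    ring
  simp_rw [hsum]
  have hlim : (∫ s in (a : ℝ)..(a + u), c (w s.toNNReal)) =
      u * ∫ s in (0 : ℝ)..1, c (w ((a : ℝ) + u * s).toNNReal) := by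
    rw [intervalIntegral.mul_integral_comp_add_mul (f := fun s => c (w s.toNNReal))]
    simp
  rw [hlim]
  refine Tendsto.const_mul _ ?_
  refine intervalIntegral.tendsto_integral_filter_of_dominated_convergence (fun _ => C)
    (.of_forall fun n => ?_) (.of_forall fun n => .of_forall fun s _ => hC _)
    intervalIntegrable_const (.of_forall fun s hs => ?_)
  · have h1 : Measurable fun s : ℝ => ⌈((n : ℝ) + 1) * s⌉₊ :=
      Nat.measurable_ceil.comp (measurable_id.const_mul _)
    have h2 : Measurable fun m : ℕ => c (w (a + (m : ℝ≥0) * (u / (n + 1)))) :=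
      measurable_from_top
    exact (h2.comp h1).aestronglyMeasurable
  · rw [uIoc_of_le zero_le_one] at hs
    have hs0 : 0 ≤ s := hs.1.le
    refine (hc.continuous.tendsto _).comp ((hw _).tendsto.comp ?_)
    have key : Tendsto (fun n : ℕ => (⌈((n : ℝ) + 1) * s⌉₊ : ℝ) / ((n : ℝ) + 1)) atTop (𝓝 s) := by
      have := (tendsto_nat_ceil_mul_div_atTop hs0).comp
        (tendsto_atTop_add_const_right _ (1 : ℝ) tendsto_natCast_atTop_atTop)
      refine this.congr fun n => ?_
      simp [mul_comm]
    -- Right endpoints never lie to the left of the point they approximate, which is the side on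
    -- which the path is continuous.
    refine tendsto_nhdsWithin_iff.2 ⟨?_, .of_forall fun n => ?_⟩
    · rw [← NNReal.tendsto_coe, Real.coe_toNNReal _ (by positivity)]
      refine ((key.const_mul (u : ℝ)).const_add (a : ℝ)).congr fun n => ?_
      push_cast
      ring
    · rw [Set.mem_Ici, ← NNReal.coe_le_coe, Real.coe_toNNReal _ (by positivity)]
      push_cast
      have : s ≤ (⌈((n : ℝ) + 1) * s⌉₊ : ℝ) / ((n : ℝ) + 1) := by
        rw [le_div_iff₀ (by positivity), mul_comm]
        exact Nat.le_ceil _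
      calc (a : ℝ) + u * s ≤ a + u * ((⌈((n : ℝ) + 1) * s⌉₊ : ℝ) / ((n : ℝ) + 1)) := by gcongr
        _ = _ := by ring

end Riemann

/-! ### The Feynman–Kac semigroup as a limit of discretisations. -/

section FeynmanKac

variable {Ω E : Type*} [MeasurableSpace Ω] [TopologicalSpace E] [PolishSpace E]
  [MeasurableSpace E] [BorelSpace E] [Nonempty E]
  {P : Measure Ω} [IsProbabilityMeasure P] {X : E → ℝ≥0 → Ω → E} {c : E → ℝ} {φ : E → ℝ}

/-- The Feynman–Kac semigroup `E[exp(-∫_0^u c(X_s) ds) φ(X_u)]`. -/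
def fk (P : Measure Ω) (X : E → ℝ≥0 → Ω → E) (c : E → ℝ) (u : ℝ≥0) (φ : E → ℝ) (x : E) : ℝ :=
  ∫ ω, weight c (fun s => X x s ω) u * φ (X x u ω) ∂P

/-- One step of the discretised Feynman–Kac semigroup. -/
def fkStep (P : Measure Ω) (X : E → ℝ≥0 → Ω → E) (c : E → ℝ) (δ : ℝ≥0) (φ : E → ℝ) : E → ℝ :=
  semigroup P X δ fun y => Real.exp (-(δ * c y)) * φ y

/-- The weight of the discretised Feynman–Kac semigroup over `m` steps after time `h`. -/
def stepWeight (X : E → ℝ≥0 → Ω → E) (c : E → ℝ) (x : E) (h δ : ℝ≥0) (m : ℕ) (ω : Ω) : ℝ :=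
  ∏ k ∈ Finset.range m, Real.exp (-(δ * c (X x (h + ((k + 1 : ℕ) : ℝ≥0) * δ) ω)))

lemma abs_exp_neg_rate_le (hc : IsRate c) (δ : ℝ≥0) (y : E) : |Real.exp (-(δ * c y))| ≤ 1 := by
  rw [Real.abs_exp, Real.exp_le_one_iff, neg_nonpos]
  exact mul_nonneg δ.2 (hc.nonneg y)

lemma abs_mul_le_of_abs_le_one {a b C : ℝ} (ha : |a| ≤ 1) (hb : |b| ≤ C) : |a * b| ≤ C := by
  rw [abs_mul]
  exact (mul_le_of_le_one_left (abs_nonneg b) ha).trans hb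

lemma isBddMeas_exp_mul (hc : IsRate c) (hφ : IsBddMeas φ) (δ : ℝ≥0) :
    IsBddMeas fun y => Real.exp (-(δ * c y)) * φ y := by
  obtain ⟨hm, C, hC⟩ := hφ
  refine ⟨?_, C, fun y => abs_mul_le_of_abs_le_one (abs_exp_neg_rate_le hc δ y) (hC y)⟩
  exact (hc.continuous.measurable.const_mul _).neg.exp.mul hm

lemma isBddMeas_semigroup (hX : IsMarkovFamily P X) (hφ : IsBddMeas φ) (t : ℝ≥0) :
    IsBddMeas (semigroup P X t φ) :=
  ⟨measurable_semigroup hX t hφ.1, hφ.2.choose, abs_semigroup_le t hφ.2.choose_spec⟩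

lemma isBddMeas_fkStep (hX : IsMarkovFamily P X) (hc : IsRate c) (hφ : IsBddMeas φ) (δ : ℝ≥0) :
    IsBddMeas (fkStep P X c δ φ) :=
  isBddMeas_semigroup hX (isBddMeas_exp_mul hc hφ δ) δ

lemma measurable_fkStep_iterate (hX : IsMarkovFamily P X) (hc : IsRate c) (hφ : IsBddMeas φ)
    (δ : ℝ≥0) (m : ℕ) : Measurable ((fkStep P X c δ)^[m] φ) := by
  suffices h : IsBddMeas ((fkStep P X c δ)^[m] φ) from h.1
  induction m with
  | zero => exact hφ
  | succ m ih =>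
    rw [Function.iterate_succ_apply']
    exact isBddMeas_fkStep hX hc ih δ

lemma abs_fkStep_iterate_le (hc : IsRate c) {C : ℝ} (hC : ∀ x, |φ x| ≤ C) (δ : ℝ≥0) (m : ℕ)
    (x : E) : |(fkStep P X c δ)^[m] φ x| ≤ C := by
  induction m generalizing x with
  | zero => exact hC x
  | succ m ih =>
    rw [Function.iterate_succ_apply']
    exact abs_semigroup_le δ
      (fun y => abs_mul_le_of_abs_le_one (abs_exp_neg_rate_le hc δ y) (ih y)) x

lemma abs_stepWeight_le (hc : IsRate c) (x : E) (h δ : ℝ≥0) (m : ℕ) (ω : Ω) :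
    |stepWeight X c x h δ m ω| ≤ 1 := by
  rw [stepWeight, Finset.abs_prod]
  exact Finset.prod_le_one (fun _ _ => abs_nonneg _) fun _ _ => abs_exp_neg_rate_le hc _ _

lemma measurable_stepWeight_past (hc : IsRate c) (x : E) (h δ : ℝ≥0) (m : ℕ) :
    Measurable[past X x (h + m * δ)] (stepWeight X c x h δ m) := by
  refine Finset.measurable_fun_prod _ fun k hk => ?_
  have hle : h + ((k + 1 : ℕ) : ℝ≥0) * δ ≤ h + m * δ := by
    gcongr
    exact Finset.mem_range.1 hk
  exact (((hc.continuous.measurable.comp (measurable_past x hle)).const_mul (δ : ℝ)).neg).exp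

/-- Induction peels off the last step: all earlier factors are measurable for the past at `h + m *
δ`, so the Markov property there replaces the last factor by one application of `fkStep`. -/
lemma integral_mul_stepWeight (hX : IsMarkovFamily P X) (hc : IsRate c) (hφ : IsBddMeas φ)
    (x : E) (h δ : ℝ≥0) {W : Ω → ℝ} (hW : Measurable[past X x h] W) {D : ℝ}
    (hWD : ∀ ω, |W ω| ≤ D) (m : ℕ) :
    ∫ ω, W ω * (stepWeight X c x h δ m ω * φ (X x (h + m * δ) ω)) ∂P =
      ∫ ω, W ω * (fkStep P X c δ)^[m] φ (X x h ω) ∂P := by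
  induction m generalizing φ with
  | zero => simp [stepWeight]
  | succ m ih =>
    rw [Function.iterate_succ_apply, ← ih (isBddMeas_fkStep hX hc hφ δ)]
    have hWm : Measurable[past X x (h + m * δ)] fun ω => W ω * stepWeight X c x h δ m ω :=
      Measurable.mul (hW.mono (past_mono x le_self_add) le_rfl)
        (measurable_stepWeight_past hc x h δ m)
    have h1 := integral_mul_comp hX x (h + m * δ) δ (isBddMeas_exp_mul hc hφ δ) hWm (D := D)
      (fun ω => by
        rw [mul_comm]; exact abs_mul_le_of_abs_le_one (abs_stepWeight_le hc x h δ m ω) (hWD ω))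
    have ht : h + ((m + 1 : ℕ) : ℝ≥0) * δ = h + m * δ + δ := by push_cast; ring
    simp only [mul_assoc] at h1
    rw [fkStep, ← h1]
    refine integral_congr_ae (.of_forall fun ω => ?_)
    simp only [stepWeight, Finset.prod_range_succ, ht, mul_assoc]

lemma isRightCts_ae (hX : IsMarkovFamily P X) (x : E) :
    ∀ᵐ ω ∂P, IsRightCts fun s => X x s ω := hX.rightContinuous x

lemma tendsto_stepWeight (hc : IsRate c) (x : E) (h u : ℝ≥0) {ω : Ω}
    (hω : IsRightCts fun s => X x s ω) :
    Tendsto (fun n : ℕ => stepWeight X c x h (u / (n + 1)) (n + 1) ω) atTop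
      (𝓝 (Real.exp (-∫ s in (h : ℝ)..(h + u), c (X x s.toNNReal ω)))) := by
  have h1 := (Real.continuous_exp.tendsto _).comp (tendsto_riemann hc hω h u).neg
  refine h1.congr fun n => ?_
  simp only [Function.comp_apply, stepWeight, ← Real.exp_sum, Finset.sum_neg_distrib]

lemma aestronglyMeasurable_stepWeight (hX : IsMarkovFamily P X) (hc : IsRate c) (x : E)
    (h δ : ℝ≥0) (m : ℕ) : AEStronglyMeasurable (stepWeight X c x h δ m) P :=
  ((measurable_stepWeight_past hc x h δ m).mono (past_le hX x _) le_rfl).aestronglyMeasurable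

lemma aestronglyMeasurable_comp (hX : IsMarkovFamily P X) (hφ : Measurable φ) (x : E) (t : ℝ≥0) :
    AEStronglyMeasurable (fun ω => φ (X x t ω)) P :=
  (hφ.comp (hX.measurable x t)).aestronglyMeasurable

lemma add_mul_div_succ (h u : ℝ≥0) (n : ℕ) : h + ((n + 1 : ℕ) : ℝ≥0) * (u / (n + 1)) = h + u := by
  push_cast
  rw [mul_div_cancel₀]
  positivity

lemma tendsto_integral_fkStep (hX : IsMarkovFamily P X) (hc : IsRate c) (hφ : IsBddMeas φ)
    (x : E) (h u : ℝ≥0) {W : Ω → ℝ} (hW : Measurable[past X x h] W) {D : ℝ}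
    (hWD : ∀ ω, |W ω| ≤ D) :
    Tendsto (fun n : ℕ => ∫ ω, W ω * (fkStep P X c (u / (n + 1)))^[n + 1] φ (X x h ω) ∂P) atTop
      (𝓝 (∫ ω, W ω * (Real.exp (-∫ s in (h : ℝ)..(h + u), c (X x s.toNNReal ω)) *
        φ (X x (h + u) ω)) ∂P)) := by
  simp_rw [← integral_mul_stepWeight hX hc hφ x h _ hW hWD, add_mul_div_succ]
  obtain ⟨hm, C, hC⟩ := hφ
  refine tendsto_integral_of_dominated_convergence (fun _ => D * C) (fun n => ?_)
    (integrable_const _) (fun n => .of_forall fun ω => ?_) ?_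
  · exact (hW.mono (past_le hX x h) le_rfl).aestronglyMeasurable.mul
      ((aestronglyMeasurable_stepWeight hX hc x h _ _).mul (aestronglyMeasurable_comp hX hm x _))
  · rw [norm_mul]
    exact mul_le_mul (hWD ω) (abs_mul_le_of_abs_le_one (abs_stepWeight_le hc _ _ _ _ _) (hC _))
      (norm_nonneg _) ((abs_nonneg _).trans (hWD ω))
  · filter_upwards [isRightCts_ae hX x] with ω hω
    exact ((tendsto_stepWeight hc x h u hω).mul_const _).const_mul _

lemma tendsto_fkStep (hX : IsMarkovFamily P X) (hc : IsRate c) (hφ : IsBddMeas φ)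
    (x : E) (u : ℝ≥0) :
    Tendsto (fun n : ℕ => (fkStep P X c (u / (n + 1)))^[n + 1] φ x) atTop
      (𝓝 (fk P X c u φ x)) := by
  have h1 := tendsto_integral_fkStep hX hc hφ x 0 u (W := fun _ => 1) measurable_const
    (D := 1) (by simp)
  simp only [one_mul, NNReal.coe_zero, zero_add] at h1
  refine h1.congr fun n => ?_
  rw [integral_congr_ae (g := fun _ => (fkStep P X c (u / (n + 1)))^[n + 1] φ x)
    ((hX.start x).mono fun ω hω => by simp only [hω])]
  simp

lemma abs_fk_le (hc : IsRate c) {C : ℝ} (hC : ∀ x, |φ x| ≤ C) (u : ℝ≥0) (x : E) :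
    |fk P X c u φ x| ≤ C :=
  abs_integral_le_of_forall_abs_le fun _ =>
    abs_mul_le_of_abs_le_one (abs_weight_le_one hc _ u.2) (hC _)

/-- Only the transition function is assumed measurable in the starting point, not the paths.
Measurability therefore comes from the discretisation, whose iterates involve transition kernels
alone. -/
lemma isBddMeas_fk (hX : IsMarkovFamily P X) (hc : IsRate c) (hφ : IsBddMeas φ) (u : ℝ≥0) :
    IsBddMeas (fk P X c u φ) :=
  ⟨measurable_of_tendsto_metrizable (fun _ => measurable_fkStep_iterate hX hc hφ _ _)
    (tendsto_pi_nhds.2 fun x => tendsto_fkStep hX hc hφ x u),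
    hφ.2.choose, abs_fk_le hc hφ.2.choose_spec u⟩

/-- Both sides are limits of the same discretised integrals: on the left the weights converge along
the path, on the right the iterates converge at the position at time `h`. -/
lemma integral_mul_fk (hX : IsMarkovFamily P X) (hc : IsRate c) (hφ : IsBddMeas φ)
    (x : E) (h u : ℝ≥0) {W : Ω → ℝ} (hW : Measurable[past X x h] W) {D : ℝ}
    (hWD : ∀ ω, |W ω| ≤ D) :
    ∫ ω, W ω * (Real.exp (-∫ s in (h : ℝ)..(h + u), c (X x s.toNNReal ω)) *
        φ (X x (h + u) ω)) ∂P = ∫ ω, W ω * fk P X c u φ (X x h ω) ∂P := by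
  refine tendsto_nhds_unique (tendsto_integral_fkStep hX hc hφ x h u hW hWD) ?_
  obtain ⟨C, hC⟩ := hφ.2
  refine tendsto_integral_of_dominated_convergence (fun _ => D * C) (fun n => ?_)
    (integrable_const _) (fun n => .of_forall fun ω => ?_) (.of_forall fun ω => ?_)
  · exact (hW.mono (past_le hX x h) le_rfl).aestronglyMeasurable.mul
      (aestronglyMeasurable_comp hX (measurable_fkStep_iterate hX hc hφ _ _) x _)
  · rw [norm_mul]
    exact mul_le_mul (hWD ω) (abs_fkStep_iterate_le hc hC _ _ _)
      (norm_nonneg _) ((abs_nonneg _).trans (hWD ω))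
  · exact (tendsto_fkStep hX hc hφ _ u).const_mul _

lemma aestronglyMeasurable_weight (hX : IsMarkovFamily P X) (hc : IsRate c) (x : E) (u : ℝ) :
    AEStronglyMeasurable (fun ω => weight c (fun s => X x s ω) u) P := by
  have h0 : Measurable fun ω => ((fun s => X x s ω), u) :=
    (measurable_pi_lambda (fun ω s => X x s ω) fun s => hX.measurable x s).prodMk measurable_const
  have h1 := (measurable_regWeight (E := E) hc.continuous.measurable).comp h0
  exact ⟨_, h1.stronglyMeasurable, (isRightCts_ae hX x).mono fun ω hω => (regWeight_eq hω u).symm⟩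

/-- The semigroup property. -/
lemma fk_add (hX : IsMarkovFamily P X) (hc : IsRate c) (hφ : IsBddMeas φ) (h u : ℝ≥0) :
    fk P X c (h + u) φ = fk P X c h (fk P X c u φ) := by
  ext x
  -- The exact weight up to `h` is known only as an almost sure limit of functions measurable for
  -- the past. The Markov property is therefore applied to its discretisations, and the limit is
  -- taken afterwards.
  have hmeas : ∀ n : ℕ, Measurable[past X x h] (stepWeight X c x 0 (h / (n + 1)) (n + 1)) := by
    intro n
    have h1 := measurable_stepWeight_past (X := X) hc x 0 (h / (n + 1)) (n + 1)
    rwa [add_mul_div_succ, zero_add] at h1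
  have h1 : ∀ n : ℕ, _ := fun n => integral_mul_fk hX hc hφ x h u
    (W := stepWeight X c x 0 (h / (n + 1)) (n + 1))
    (hmeas n)
    (abs_stepWeight_le hc _ _ _ _)
  obtain ⟨C, hC⟩ := hφ.2
  have hlim : ∀ {G : Ω → ℝ}, AEStronglyMeasurable G P → (∀ ω, |G ω| ≤ C) →
      Tendsto (fun n : ℕ => ∫ ω, stepWeight X c x 0 (h / (n + 1)) (n + 1) ω * G ω ∂P) atTop
        (𝓝 (∫ ω, weight c (fun s => X x s ω) h * G ω ∂P)) := by
    intro G hG hGC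
    refine tendsto_integral_of_dominated_convergence (fun _ => C) (fun n => ?_)
      (integrable_const _) (fun n => .of_forall fun ω => ?_) ?_
    · exact (aestronglyMeasurable_stepWeight hX hc x _ _ _).mul hG
    · exact abs_mul_le_of_abs_le_one (abs_stepWeight_le hc _ _ _ _ _) (hGC _)
    · filter_upwards [isRightCts_ae hX x] with ω hω
      have := tendsto_stepWeight hc x 0 h hω
      simp only [NNReal.coe_zero, zero_add] at this
      exact this.mul_const _
  have hexp : ∀ᵐ ω ∂P, weight c (fun s => X x s ω) (h + u : ℝ≥0) = weight c (fun s => X x s ω) h *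
      Real.exp (-∫ s in (h : ℝ)..(h + u), c (X x s.toNNReal ω)) := by
    filter_upwards [isRightCts_ae hX x] with ω hω
    rw [weight, weight, ← Real.exp_add, ← neg_add, NNReal.coe_add,
      intervalIntegral.integral_add_adjacent_intervals (intervalIntegrable_rate hc hω _ _)
        (intervalIntegrable_rate hc hω _ _)]
  have hexpm : AEStronglyMeasurable
      (fun ω => Real.exp (-∫ s in (h : ℝ)..(h + u), c (X x s.toNNReal ω))) P :=
    aestronglyMeasurable_of_tendsto_ae atTop
      (fun n : ℕ => aestronglyMeasurable_stepWeight hX hc x h (u / (n + 1)) (n + 1))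
      ((isRightCts_ae hX x).mono fun ω hω => tendsto_stepWeight hc x h u hω)
  have h2 := hlim (hexpm.mul (aestronglyMeasurable_comp hX hφ.1 x (h + u))) fun ω =>
    abs_mul_le_of_abs_le_one (by
      rw [Real.abs_exp, Real.exp_le_one_iff, neg_nonpos]
      exact integral_rate_nonneg hc (fun s => X x s ω) (by simp)) (hC _)
  have h3 := hlim (aestronglyMeasurable_comp hX (isBddMeas_fk hX hc hφ u).1 x h)
    fun ω => abs_fk_le hc hC _ _
  have h4 := tendsto_nhds_unique (h2.congr h1) h3
  rw [fk, fk, ← h4]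
  refine integral_congr_ae (hexp.mono fun ω hω => ?_)
  simp only [hω, mul_assoc, Pi.mul_apply]

lemma fk_zero (hX : IsMarkovFamily P X) (φ : E → ℝ) (x : E) : fk P X c 0 φ x = φ x := by
  rw [fk, integral_congr_ae (g := fun _ => φ x)
    ((hX.start x).mono fun ω hω => by simp [hω, weight])]
  simp

end FeynmanKac

/-! ### Constancy along diagonals. -/

section Diagonal

/-- Cutting `[0, r]` into `n + 1` pieces bounds the total increment by `K * r ^ 2 / (n + 1)`. -/
lemma eq_of_abs_sub_le_sq {B : ℝ → ℝ} {K : ℝ}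
    (hB : ∀ r δ, 0 ≤ r → 0 ≤ δ → |B (r + δ) - B r| ≤ K * δ ^ 2) {r : ℝ} (hr : 0 ≤ r) :
    B r = B 0 := by
  have h1 : ∀ n : ℕ, ∀ k : ℕ, |B (k * (r / (n + 1))) - B 0| ≤ k * (K * (r / (n + 1)) ^ 2) := by
    intro n k
    induction k with
    | zero => simp
    | succ k ih =>
      have h2 := hB (k * (r / (n + 1))) (r / (n + 1)) (by positivity) (by positivity)
      calc |B (((k + 1 : ℕ) : ℝ) * (r / (n + 1))) - B 0|
          = |(B (k * (r / (n + 1)) + r / (n + 1)) - B (k * (r / (n + 1)))) +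
              (B (k * (r / (n + 1))) - B 0)| := by push_cast; ring_nf
        _ ≤ _ := abs_add_le _ _
        _ ≤ K * (r / (n + 1)) ^ 2 + k * (K * (r / (n + 1)) ^ 2) := add_le_add h2 ih
        _ = _ := by push_cast; ring
  have h3 : ∀ n : ℕ, |B r - B 0| ≤ K * r ^ 2 * (1 / ((n : ℝ) + 1)) := by
    intro n
    have h4 := h1 n (n + 1)
    have hn : (n : ℝ) + 1 ≠ 0 := by positivity
    have e1 : ((n + 1 : ℕ) : ℝ) * (r / (n + 1)) = r := by push_cast; field_simp
    have e2 : ((n + 1 : ℕ) : ℝ) * (K * (r / (n + 1)) ^ 2) = K * r ^ 2 * (1 / ((n : ℝ) + 1)) := by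
      push_cast; field_simp
    rwa [e1, e2] at h4
  have h5 : |B r - B 0| ≤ 0 := by
    have h6 := (tendsto_one_div_add_atTop_nhds_zero_nat (𝕜 := ℝ)).const_mul (K * r ^ 2)
    rw [mul_zero] at h6
    exact ge_of_tendsto h6 (.of_forall h3)
  exact sub_eq_zero.1 (abs_nonpos_iff.1 h5)

/-- A function `F` on the quadrant with `∂₁ F = Γ = -∂₂ F` in integrated form is constant along
diagonals. -/
lemma diag_const {F Γ : ℝ → ℝ → ℝ} {C : ℝ} (hΓ : Measurable (Function.uncurry Γ))
    (hΓC : ∀ a b, |Γ a b| ≤ C)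
    (h1 : ∀ s a b, 0 ≤ s → 0 ≤ a → a ≤ b → F b s - F a s = ∫ r in a..b, Γ r s)
    (h2 : ∀ h a b, 0 ≤ h → 0 ≤ a → a ≤ b → F h b - F h a = -∫ r in a..b, Γ h r)
    {h s r : ℝ} (hh : 0 ≤ h) (hs : 0 ≤ s) (hr : 0 ≤ r) : F (h + r) (s + r) = F h s := by
  have hC : 0 ≤ C := (abs_nonneg _).trans (hΓC 0 0)
  have l1 : ∀ s a b, 0 ≤ s → 0 ≤ a → a ≤ b → |F b s - F a s| ≤ C * (b - a) := by
    intro s a b hs ha hab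
    rw [h1 s a b hs ha hab, ← abs_of_nonneg (sub_nonneg.2 hab)]
    exact intervalIntegral.norm_integral_le_of_norm_le_const (f := fun x => Γ x s)
      fun x _ => hΓC x s
  have l2 : ∀ h a b, 0 ≤ h → 0 ≤ a → a ≤ b → |F h b - F h a| ≤ C * (b - a) := by
    intro h a b hs ha hab
    rw [h2 h a b hs ha hab, ← abs_of_nonneg (sub_nonneg.2 hab), abs_neg]
    exact intervalIntegral.norm_integral_le_of_norm_le_const (f := fun x => Γ h x)
      fun x _ => hΓC h x
  have cont1 : ∀ s, 0 ≤ s → ContinuousOn (fun a => F a s) (Set.Ici 0) := by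
    intro s hs
    refine (LipschitzOnWith.of_dist_le_mul (K := C.toNNReal) fun a ha b hb => ?_).continuousOn
    rw [Real.coe_toNNReal _ hC, Real.dist_eq, Real.dist_eq]
    rcases le_total a b with hab | hab
    · rw [abs_sub_comm, abs_sub_comm a b, abs_of_nonneg (sub_nonneg.2 hab)]
      exact l1 s a b hs ha hab
    · rw [abs_of_nonneg (sub_nonneg.2 hab)]
      exact l1 s b a hs hb hab
  have cont2 : ∀ h, 0 ≤ h → ContinuousOn (fun a => F h a) (Set.Ici 0) := by
    intro s hs
    refine (LipschitzOnWith.of_dist_le_mul (K := C.toNNReal) fun a ha b hb => ?_).continuousOn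
    rw [Real.coe_toNNReal _ hC, Real.dist_eq, Real.dist_eq]
    rcases le_total a b with hab | hab
    · rw [abs_sub_comm, abs_sub_comm a b, abs_of_nonneg (sub_nonneg.2 hab)]
      exact l2 s a b hs ha hab
    · rw [abs_of_nonneg (sub_nonneg.2 hab)]
      exact l2 s b a hs hb hab
  have int1 : ∀ s a b, 0 ≤ s → 0 ≤ a → 0 ≤ b → IntervalIntegrable (fun x => F x s) volume a b :=
    fun s a b hs ha hb => ((cont1 s hs).mono fun x hx =>
      (le_min ha hb).trans hx.1).intervalIntegrable
  have int2 : ∀ s a b, 0 ≤ s → 0 ≤ a → 0 ≤ b → IntervalIntegrable (fun x => F s x) volume a b :=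
    fun s a b hs ha hb => ((cont2 s hs).mono fun x hx =>
      (le_min ha hb).trans hx.1).intervalIntegrable
  -- As `F` is only Lipschitz, it is averaged over a window of length `ε` in the first variable.
  -- Moving the window by `δ` along the diagonal changes the average by `O(δ ^ 2)`, because the
  -- first-order effects of the two variables cancel.
  have main : ∀ ε, 0 ≤ ε → (∫ a in h + r..h + r + ε, F a (s + r)) = ∫ a in h..h + ε, F a s := by
    intro ε hε
    have := eq_of_abs_sub_le_sq (B := fun r => ∫ a in h + r..h + r + ε, F a (s + r))
      (K := 2 * C) ?_ hr
    · simpa using this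
    clear hr r
    intro r δ hr hδ
    -- Shifting the window in the first variable leaves only strips of width `δ` at its two ends.
    have e0 : (∫ a in h + (r + δ)..h + (r + δ) + ε, F a (s + (r + δ))) -
        (∫ a in h + r..h + r + ε, F a (s + (r + δ))) =
        (∫ a in h + r + ε..h + r + ε + δ, F a (s + (r + δ))) -
          ∫ a in h + r..h + r + δ, F a (s + (r + δ)) := by
      have hσ : 0 ≤ s + (r + δ) := by positivity
      have i1 := intervalIntegral.integral_add_adjacent_intervals
        (int1 (s + (r + δ)) (h + r) (h + r + δ) hσ (by positivity) (by positivity))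
        (int1 (s + (r + δ)) (h + r + δ) (h + r + δ + ε) hσ (by positivity) (by positivity))
      have i2 := intervalIntegral.integral_add_adjacent_intervals
        (int1 (s + (r + δ)) (h + r) (h + r + ε) hσ (by positivity) (by positivity))
        (int1 (s + (r + δ)) (h + r + ε) (h + r + ε + δ) hσ (by positivity) (by positivity))
      rw [show h + r + δ + ε = h + r + ε + δ by ring] at i1
      rw [show h + (r + δ) = h + r + δ by ring, show h + r + δ + ε = h + r + ε + δ by ring]
      linarith
    -- Shifting the second variable integrates `-Γ` over a rectangle. By Fubini `Γ` can be
    -- integrated first in the other variable, which again yields differences at the two ends of the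
    -- window.
    have e1 : (∫ a in h + r..h + r + ε, F a (s + (r + δ))) - (∫ a in h + r..h + r + ε, F a (s + r))
        = -∫ q in s + r..s + (r + δ), (F (h + r + ε) q - F (h + r) q) := by
      rw [← intervalIntegral.integral_sub
        (int1 _ _ _ (by positivity) (by positivity) (by positivity))
        (int1 _ _ _ (by positivity) (by positivity) (by positivity))]
      have i1 : (∫ a in h + r..h + r + ε, (F a (s + (r + δ)) - F a (s + r))) =
          ∫ a in h + r..h + r + ε, -∫ q in s + r..s + (r + δ), Γ a q := by
        refine intervalIntegral.integral_congr fun a ha => ?_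
        rw [uIcc_of_le (by linarith)] at ha
        exact h2 a _ _ (by linarith [ha.1]) (by positivity) (by linarith)
      have i2 : (∫ q in s + r..s + (r + δ), (F (h + r + ε) q - F (h + r) q)) =
          ∫ q in s + r..s + (r + δ), ∫ a in h + r..h + r + ε, Γ a q := by
        refine intervalIntegral.integral_congr fun q hq => ?_
        rw [uIcc_of_le (by linarith)] at hq
        exact h1 q _ _ (by linarith [hq.1]) (by positivity) (by linarith)
      rw [i1, i2, intervalIntegral.integral_neg]
      congr 1
      rw [intervalIntegral.integral_of_le (by linarith), intervalIntegral.integral_of_le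
        (by linarith : s + r ≤ s + (r + δ))]
      simp_rw [intervalIntegral.integral_of_le (by linarith : h + r ≤ h + r + ε),
        intervalIntegral.integral_of_le (by linarith : s + r ≤ s + (r + δ))]
      exact integral_integral_swap (Integrable.of_bound hΓ.aestronglyMeasurable C
        (.of_forall fun z => hΓC z.1 z.2))
    have e2 : (∫ a in h + r + ε..h + r + ε + δ, F a (s + (r + δ))) -
        ∫ a in h + r..h + r + δ, F a (s + (r + δ)) =
        ∫ a in (0 : ℝ)..δ, (F (h + r + ε + a) (s + (r + δ)) - F (h + r + a) (s + (r + δ))) := by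
      have j1 := intervalIntegral.integral_comp_add_left (a := 0) (b := δ)
        (fun a => F a (s + (r + δ))) (h + r + ε)
      have j2 := intervalIntegral.integral_comp_add_left (a := 0) (b := δ)
        (fun a => F a (s + (r + δ))) (h + r)
      rw [add_zero] at j1 j2
      rw [← j1, ← j2, intervalIntegral.integral_sub]
      · exact ((cont1 (s + (r + δ)) (by positivity)).comp (t := Set.Ici 0)
          (f := fun a => h + r + ε + a) (s := uIcc 0 δ) (by fun_prop) fun a ha => by
            rw [uIcc_of_le hδ] at ha; exact add_nonneg (by positivity) ha.1).intervalIntegrable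
      · exact ((cont1 (s + (r + δ)) (by positivity)).comp (t := Set.Ici 0)
          (f := fun a => h + r + a) (s := uIcc 0 δ) (by fun_prop) fun a ha => by
            rw [uIcc_of_le hδ] at ha; exact add_nonneg (by positivity) ha.1).intervalIntegrable
    have e3 : (∫ q in s + r..s + (r + δ), (F (h + r + ε) q - F (h + r) q)) =
        ∫ a in (0 : ℝ)..δ, (F (h + r + ε) (s + r + a) - F (h + r) (s + r + a)) := by
      have j1 := intervalIntegral.integral_comp_add_left (a := 0) (b := δ)
        (fun q => F (h + r + ε) q - F (h + r) q) (s + r)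
      rw [j1]
      simp [add_assoc]
    have sub1 : ∀ p, 0 ≤ p → IntervalIntegrable (fun a => F (p + a) (s + (r + δ))) volume 0 δ :=
      fun p hp => ((cont1 (s + (r + δ)) (by positivity)).comp (t := Set.Ici 0)
        (f := fun a => p + a) (s := uIcc 0 δ) (by fun_prop) fun a ha => by
          rw [uIcc_of_le hδ] at ha; exact add_nonneg hp ha.1).intervalIntegrable
    have sub2 : ∀ p, 0 ≤ p → IntervalIntegrable (fun a => F p (s + r + a)) volume 0 δ :=
      fun p hp => ((cont2 p hp).comp (t := Set.Ici 0)
        (f := fun a => s + r + a) (s := uIcc 0 δ) (by fun_prop) fun a ha => by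
          rw [uIcc_of_le hδ] at ha; exact add_nonneg (by positivity) ha.1).intervalIntegrable
    have total : (∫ a in h + (r + δ)..h + (r + δ) + ε, F a (s + (r + δ))) -
        (∫ a in h + r..h + r + ε, F a (s + r)) = ∫ a in (0 : ℝ)..δ,
        ((F (h + r + ε + a) (s + (r + δ)) - F (h + r + a) (s + (r + δ))) -
          (F (h + r + ε) (s + r + a) - F (h + r) (s + r + a))) := by
      rw [intervalIntegral.integral_sub, ← e3, ← e2]
      · linarith
      · exact (sub1 _ (by positivity)).sub (sub1 _ (by positivity))
      · exact (sub2 _ (by positivity)).sub (sub2 _ (by positivity))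
    -- The two points differ by `a` in the first variable and by `δ - a` in the second. The two
    -- window ends contribute `2 * C * δ`, and integration over `[0, δ]` gives `2 * C * δ ^ 2`.
    have bound : ∀ p a, 0 ≤ p → a ∈ Set.Ioc 0 δ →
        |F (p + a) (s + (r + δ)) - F p (s + r + a)| ≤ C * δ := by
      intro p a hp ha
      have b1 := l1 (s + (r + δ)) p (p + a) (by positivity) hp (by linarith [ha.1])
      have b2 := l2 p (s + r + a) (s + (r + δ)) hp (by linarith [ha.1]) (by linarith [ha.2])
      calc |F (p + a) (s + (r + δ)) - F p (s + r + a)|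
          = |(F (p + a) (s + (r + δ)) - F p (s + (r + δ))) +
            (F p (s + (r + δ)) - F p (s + r + a))| := by ring_nf
        _ ≤ _ := abs_add_le _ _
        _ ≤ _ := add_le_add b1 b2
        _ = C * δ := by ring
    simp only [total]
    have := intervalIntegral.norm_integral_le_of_norm_le_const (a := 0) (b := δ) (C := 2 * C * δ)
      (f := fun a => (F (h + r + ε + a) (s + (r + δ)) - F (h + r + a) (s + (r + δ))) -
          (F (h + r + ε) (s + r + a) - F (h + r) (s + r + a))) ?_
    · rw [sub_zero, abs_of_nonneg hδ] at this
      refine this.trans (le_of_eq (by ring))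
    intro a ha
    rw [uIoc_of_le hδ] at ha
    have b1 := bound (h + r + ε) a (by positivity) ha
    have b2 := bound (h + r) a (by positivity) ha
    rw [Real.norm_eq_abs, show ∀ A B D E : ℝ, A - B - (D - E) = (A - D) - (B - E) from
      fun _ _ _ _ => by ring]
    exact (abs_sub _ _).trans (by linarith)
  have avg : ∀ h s ε, 0 ≤ h → 0 ≤ s → 0 ≤ ε →
      |(∫ a in h..h + ε, F a s) - ε * F h s| ≤ C * ε ^ 2 := by
    intro h s ε hh hs hε
    have e : (∫ a in h..h + ε, F a s) - ε * F h s = ∫ a in h..h + ε, (F a s - F h s) := by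
      rw [intervalIntegral.integral_sub (int1 _ _ _ hs hh (by positivity))
        intervalIntegrable_const]
      simp
    have := intervalIntegral.norm_integral_le_of_norm_le_const (a := h) (b := h + ε) (C := C * ε)
      (f := fun a => F a s - F h s) fun a ha => by
        rw [uIoc_of_le (by linarith)] at ha
        refine (l1 s h a hs hh ha.1.le).trans ?_
        gcongr
        linarith [ha.2]
    rw [e]
    refine this.trans (le_of_eq ?_)
    rw [add_sub_cancel_left, abs_of_nonneg hε]
    ring
  refine eq_of_abs_sub_le_all fun ε hε => ?_
  have hC1 : 0 < 2 * C + 1 := by positivity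
  -- Each average differs from the value of `F` by at most `C * η`, so `2 * C * η ≤ ε` is needed;
  -- the `+ 1` covers `C = 0`.
  set η := ε / (2 * C + 1) with hη
  have hη0 : 0 < η := by positivity
  have a1 := avg (h + r) (s + r) η (by positivity) (by positivity) hη0.le
  have a2 := avg h s η hh hs hη0.le
  rw [main η hη0.le] at a1
  have a3 : η * |F (h + r) (s + r) - F h s| ≤ η * (2 * C * η) := by
    rw [← abs_of_pos hη0, ← abs_mul, abs_of_pos hη0]
    rw [abs_le] at *
    constructor <;> nlinarith [a1.1, a1.2, a2.1, a2.2]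
  refine (le_of_mul_le_mul_left a3 hη0).trans ?_
  rw [hη, ← mul_div_assoc, div_le_iff₀ hC1]
  nlinarith

end Diagonal

/-! ### Generators with killing and Dynkin's formula. -/

section Killing

variable {Ω E : Type*} [MeasurableSpace Ω] [TopologicalSpace E] [PolishSpace E]
  [MeasurableSpace E] [BorelSpace E] [Nonempty E]
  {P : Measure Ω} [IsProbabilityMeasure P] {X : E → ℝ≥0 → Ω → E} {c : E → ℝ} {φ : E → ℝ}

lemma one_sub_weight_nonneg (hc : IsRate c) (w : ℝ≥0 → E) (h : ℝ≥0) : 0 ≤ 1 - weight c w h :=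
  sub_nonneg.2 (weight_le_one hc w h.2)

lemma integral_rate_le {C : ℝ} (hC : ∀ x, |c x| ≤ C) (w : ℝ≥0 → E) (h : ℝ≥0) :
    |∫ s in (0 : ℝ)..h, c (w s.toNNReal)| ≤ C * h := by
  have := intervalIntegral.norm_integral_le_of_norm_le_const (a := 0) (b := h)
    (f := fun s => c (w s.toNNReal)) fun s _ => hC _
  simpa using this

lemma one_sub_weight_le {C : ℝ} (hC : ∀ x, |c x| ≤ C) (w : ℝ≥0 → E) (h : ℝ≥0) :
    1 - weight c w h ≤ C * h := by
  have h1 := (le_abs_self _).trans (integral_rate_le hC w h)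
  have h2 := Real.add_one_le_exp (-∫ s in (0 : ℝ)..h, c (w s.toNNReal))
  rw [weight]
  linarith

lemma abs_one_sub_weight_le (hc : IsRate c) {C : ℝ} (hC : ∀ x, |c x| ≤ C) (w : ℝ≥0 → E)
    (h : ℝ≥0) : |1 - weight c w h| ≤ C * h := by
  rw [abs_of_nonneg (one_sub_weight_nonneg hc w h)]
  exact one_sub_weight_le hC w h

lemma tendsto_coe_nhdsGT_zero : Tendsto ((↑) : ℝ≥0 → ℝ) (𝓝[>] 0) (𝓝[>] 0) := by
  refine tendsto_nhdsWithin_iff.2 ⟨?_, ?_⟩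
  · exact (NNReal.continuous_coe.tendsto' 0 0 NNReal.coe_zero).mono_left nhdsWithin_le_nhds
  · filter_upwards [self_mem_nhdsWithin] with h hh
    exact NNReal.coe_pos.2 hh

lemma tendsto_toNNReal_sub (r : ℝ) :
    Tendsto (fun y : ℝ => (y - r).toNNReal) (𝓝[>] r) (𝓝[>] 0) := by
  refine tendsto_nhdsWithin_iff.2 ⟨?_, ?_⟩
  · refine Tendsto.mono_left ?_ nhdsWithin_le_nhds
    exact (continuous_real_toNNReal.comp (continuous_sub_right r)).tendsto' _ _ (by simp)
  · filter_upwards [self_mem_nhdsWithin] with y hy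
    exact Real.toNNReal_pos.2 (sub_pos.2 hy)

/-- This is the right derivative of the weight at time zero; right-continuity of the path suffices
for the fundamental theorem on that side. -/
lemma tendsto_one_sub_weight_div (hc : IsRate c) {w : ℝ≥0 → E} (hw : IsRightCts w) :
    Tendsto (fun h : ℝ≥0 => (1 - weight c w h) / h) (𝓝[>] 0) (𝓝 (c (w 0))) := by
  have hm : Measurable fun s : ℝ => c (w s.toNNReal) :=
    hc.continuous.measurable.comp (measurable_of_isRightCts hw)
  have hcont : ContinuousWithinAt (fun s : ℝ => c (w s.toNNReal)) (Set.Ici 0) 0 := by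
    refine hc.continuous.continuousAt.comp_continuousWithinAt ?_
    have h1 : ContinuousWithinAt w (Set.Ici 0) (0 : ℝ).toNNReal := by simpa using hw 0
    exact h1.comp (f := Real.toNNReal) continuous_real_toNNReal.continuousWithinAt
      (fun s _ => Set.mem_Ici.2 zero_le)
  have hd : HasDerivWithinAt (fun u : ℝ => ∫ s in (0 : ℝ)..u, c (w s.toNNReal))
      (c (w (0 : ℝ).toNNReal)) (Set.Ici 0) 0 :=
    intervalIntegral.integral_hasDerivWithinAt_right
      (intervalIntegrable_rate hc hw 0 0) (t := Set.Ioi 0)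
      hm.stronglyMeasurable.stronglyMeasurableAtFilter (hcont.mono Set.Ioi_subset_Ici_self)
  have hd2 : HasDerivWithinAt (fun u : ℝ => 1 - weight c w u) (c (w 0)) (Set.Ioi 0) 0 := by
    have := ((hd.neg.exp).const_sub 1).mono Set.Ioi_subset_Ici_self
    simpa [weight] using this
  rw [hasDerivWithinAt_iff_tendsto_slope' (by simp)] at hd2
  refine (hd2.comp tendsto_coe_nhdsGT_zero).congr fun h => ?_
  simp [slope_def_field, weight]

lemma semigroup_sub_fk (hX : IsMarkovFamily P X) (hc : IsRate c) (hφ : IsBddMeas φ) (h : ℝ≥0)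
    (x : E) : semigroup P X h φ x - fk P X c h φ x =
      ∫ ω, (1 - weight c (fun s => X x s ω) h) * φ (X x h ω) ∂P := by
  obtain ⟨hm, C, hC⟩ := hφ
  have hi : Integrable (fun ω => φ (X x h ω)) P :=
    integrable_of_bdd (hm.comp (hX.measurable x h)) fun _ => hC _
  rw [semigroup, fk, ← integral_sub hi]
  · refine integral_congr_ae (.of_forall fun ω => ?_)
    ring
  · exact hi.bdd_mul (aestronglyMeasurable_weight hX hc x h)
      (.of_forall fun ω => abs_weight_le_one hc _ h.2)

lemma abs_semigroup_sub_fk_le (hX : IsMarkovFamily P X) (hc : IsRate c) (hm : Measurable φ)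
    {C D : ℝ} (hC : ∀ x, |c x| ≤ C) (hD : ∀ x, |φ x| ≤ D) (h : ℝ≥0) (x : E) :
    |semigroup P X h φ x - fk P X c h φ x| ≤ C * D * h := by
  rw [semigroup_sub_fk hX hc ⟨hm, D, hD⟩]
  refine abs_integral_le_of_forall_abs_le fun ω => ?_
  rw [abs_mul]
  calc _ ≤ (C * h) * D := mul_le_mul (abs_one_sub_weight_le hc hC _ _) (hD _) (abs_nonneg _)
        ((abs_nonneg _).trans (abs_one_sub_weight_le hc hC (fun s => X x s ω) h))
    _ = _ := by ring

/-- The difference quotient of the Feynman–Kac semigroup. -/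
def fkQuotient (P : Measure Ω) (X : E → ℝ≥0 → Ω → E) (c : E → ℝ) (φ : E → ℝ) (h : ℝ≥0)
    (x : E) : ℝ := (fk P X c h φ x - φ x) / h

lemma quotient_sub_fkQuotient (φ : E → ℝ) (h : ℝ≥0) (x : E) :
    quotient P X φ h x - fkQuotient P X c φ h x =
      (semigroup P X h φ x - fk P X c h φ x) / h := by
  rw [quotient, fkQuotient]; ring

lemma abs_quotient_sub_fkQuotient_le (hX : IsMarkovFamily P X) (hc : IsRate c)
    (hm : Measurable φ) {C D : ℝ} (hC : ∀ x, |c x| ≤ C) (hD : ∀ x, |φ x| ≤ D) {h : ℝ≥0}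
    (hh : 0 < h) (x : E) :
    |quotient P X φ h x - fkQuotient P X c φ h x| ≤ C * D := by
  rw [quotient_sub_fkQuotient, abs_div, abs_of_nonneg h.coe_nonneg, div_le_iff₀ (NNReal.coe_pos.2 hh)]
  exact abs_semigroup_sub_fk_le hX hc hm hC hD h x

/-- The factor `(1 - weight) / h` converges boundedly to `c x` along almost every path. Since `φ` is
merely measurable, `φ (X x h ω)` need not converge, and its limit enters only in expectation,
through `hlim`. -/
lemma tendsto_quotient_sub_fkQuotient (hX : IsMarkovFamily P X) (hc : IsRate c)
    (hφ : IsBddMeas φ) {x : E}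
    (hlim : Tendsto (fun h => semigroup P X h φ x) (𝓝[>] 0) (𝓝 (φ x))) :
    Tendsto (fun h => quotient P X φ h x - fkQuotient P X c φ h x) (𝓝[>] 0)
      (𝓝 (c x * φ x)) := by
  obtain ⟨C, hC0, hC⟩ := hc.abs_le
  obtain ⟨hm, D, hD⟩ := id hφ
  have hD0 : 0 ≤ D := (abs_nonneg _).trans (hD x)
  have hA : ∀ h : ℝ≥0, 0 < h → ∀ ω, |(1 - weight c (fun s => X x s ω) h) / h - c x| ≤ C + C := by
    intro h hh ω
    refine (abs_sub _ _).trans (add_le_add ?_ (hC x))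
    rw [abs_div, abs_of_nonneg h.coe_nonneg, div_le_iff₀ (NNReal.coe_pos.2 hh)]
    exact abs_one_sub_weight_le hc hC _ h
  have hAm : ∀ h : ℝ≥0, AEStronglyMeasurable
      (fun ω => ((1 - weight c (fun s => X x s ω) h) / h - c x) * φ (X x h ω)) P := fun h =>
    ((((aestronglyMeasurable_weight hX hc x h).aemeasurable.const_sub 1).div_const
      _).aestronglyMeasurable.sub aestronglyMeasurable_const).mul (aestronglyMeasurable_comp hX hm x h)
  have h1 : Tendsto (fun h : ℝ≥0 =>
      ∫ ω, ((1 - weight c (fun s => X x s ω) h) / h - c x) * φ (X x h ω) ∂P) (𝓝[>] 0)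
      (𝓝 (∫ _, (0 : ℝ) ∂P)) := by
    refine tendsto_integral_filter_of_dominated_convergence (fun _ => (C + C) * D)
      (.of_forall hAm) ?_ (integrable_const _) ?_
    · filter_upwards [self_mem_nhdsWithin] with h hh
      refine .of_forall fun ω => ?_
      rw [norm_mul]
      exact mul_le_mul (hA h hh ω) (hD _) (norm_nonneg _) (by positivity)
    · filter_upwards [isRightCts_ae hX x, hX.start x] with ω hω h0
      have h2 := tendsto_one_sub_weight_div hc hω
      rw [h0] at h2
      have h3 : Tendsto (fun h : ℝ≥0 => |(1 - weight c (fun s => X x s ω) h) / h - c x| * D)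
          (𝓝[>] 0) (𝓝 0) := by
        simpa using ((h2.sub_const (c x)).abs.mul_const D)
      refine squeeze_zero_norm (fun h => ?_) h3
      rw [norm_mul]
      exact mul_le_mul_of_nonneg_left (hD _) (abs_nonneg _)
  have h4 := h1.add (hlim.const_mul (c x))
  rw [integral_zero, zero_add] at h4
  refine h4.congr' ?_
  filter_upwards [self_mem_nhdsWithin] with h hh
  rw [quotient_sub_fkQuotient, semigroup_sub_fk hX hc hφ, semigroup, ← integral_const_mul,
    ← integral_div, ← integral_add]
  · refine integral_congr_ae (.of_forall fun ω => ?_)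
    simp only
    ring
  · refine Integrable.of_bound (hAm h) ((C + C) * D) (.of_forall fun ω => ?_)
    rw [norm_mul]
    exact mul_le_mul (hA h hh ω) (hD _) (norm_nonneg _) (by positivity)
  · exact (integrable_of_bdd (P := P) (hm.comp (hX.measurable x h)) fun _ => hD _).const_mul _

lemma tendsto_semigroup_of_inDomain (hφ : InDomain P X φ) (x : E) :
    Tendsto (fun h => semigroup P X h φ x) (𝓝[>] 0) (𝓝 (φ x)) := by
  have h1 : Tendsto (fun h : ℝ≥0 => (h : ℝ) * quotient P X φ h x) (𝓝[>] 0)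
      (𝓝 (0 * generator P X φ x)) :=
    (tendsto_nhdsWithin_iff.1 tendsto_coe_nhdsGT_zero).1.mul (hφ.tendsto x)
  rw [zero_mul] at h1
  have h2 := h1.add_const (φ x)
  rw [zero_add] at h2
  refine h2.congr' ?_
  filter_upwards [self_mem_nhdsWithin] with h hh
  rw [quotient, mul_div_cancel₀ _ (NNReal.coe_ne_zero.2 (ne_of_gt hh))]
  ring

lemma tendsto_fkQuotient (hX : IsMarkovFamily P X) (hc : IsRate c) (hφ : InDomain P X φ)
    (x : E) : Tendsto (fun h => fkQuotient P X c φ h x) (𝓝[>] 0)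
      (𝓝 (killedGenerator P X c φ x)) := by
  have := (hφ.tendsto x).sub (tendsto_quotient_sub_fkQuotient hX hc hφ.isBddMeas
    (tendsto_semigroup_of_inDomain hφ x))
  simpa [killedGenerator] using this

lemma exists_abs_fkQuotient_le (hX : IsMarkovFamily P X) (hc : IsRate c) (hφ : InDomain P X φ) :
    ∃ C, ∀ (h : ℝ≥0) (x : E), 0 < h → |fkQuotient P X c φ h x| ≤ C := by
  obtain ⟨C, -, hC⟩ := hc.abs_le
  obtain ⟨hm, D, hD⟩ := hφ.isBddMeas
  obtain ⟨K, hK⟩ := hφ.bounded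
  refine ⟨K + C * D, fun h x hh => ?_⟩
  have h1 := abs_quotient_sub_fkQuotient_le hX hc hm hC hD hh x
  have h2 := hK h x hh
  rw [abs_le] at *
  constructor <;> linarith [h1.1, h1.2, h2.1, h2.2]

lemma measurable_fkQuotient (hX : IsMarkovFamily P X) (hc : IsRate c) (hφ : IsBddMeas φ)
    (h : ℝ≥0) : Measurable (fkQuotient P X c φ h) :=
  ((isBddMeas_fk hX hc hφ h).1.sub hφ.1).div_const _

lemma isBddMeas_killedGenerator (hX : IsMarkovFamily P X) (hc : IsRate c)
    (hφ : InDomain P X φ) : IsBddMeas (killedGenerator P X c φ) := by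
  obtain ⟨K, hK⟩ := exists_abs_fkQuotient_le hX hc hφ
  refine ⟨measurable_of_tendsto_metrizable' (𝓝[>] (0 : ℝ≥0))
    (fun h => measurable_fkQuotient hX hc hφ.isBddMeas h)
    (tendsto_pi_nhds.2 fun x => tendsto_fkQuotient hX hc hφ x), K, fun x => ?_⟩
  refine le_of_tendsto (tendsto_fkQuotient hX hc hφ x).abs ?_
  filter_upwards [self_mem_nhdsWithin] with h hh using hK h x hh

lemma integrable_weight_mul (hX : IsMarkovFamily P X) (hc : IsRate c) (hφ : IsBddMeas φ)
    (u : ℝ≥0) (x : E) :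
    Integrable (fun ω => weight c (fun s => X x s ω) u * φ (X x u ω)) P :=
  (integrable_of_bdd (P := P) (hφ.1.comp (hX.measurable x u))
    fun _ => hφ.2.choose_spec _).bdd_mul (aestronglyMeasurable_weight hX hc x u)
      (.of_forall fun _ => abs_weight_le_one hc _ u.2)

lemma tendsto_fk {ι : Type*} {l : Filter ι} [l.IsCountablyGenerated] (hX : IsMarkovFamily P X)
    (hc : IsRate c) {ψ : ι → E → ℝ} {C : ℝ} (hm : ∀ i, Measurable (ψ i))
    (hC : ∀ᶠ i in l, ∀ x, |ψ i x| ≤ C) (hlim : ∀ x, Tendsto (fun i => ψ i x) l (𝓝 (φ x)))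
    (u : ℝ≥0) (x : E) : Tendsto (fun i => fk P X c u (ψ i) x) l (𝓝 (fk P X c u φ x)) := by
  refine tendsto_integral_filter_of_dominated_convergence (fun _ => C)
    (.of_forall fun i => (aestronglyMeasurable_weight hX hc x u).mul
      (aestronglyMeasurable_comp hX (hm i) x u)) ?_ (integrable_const _)
    (.of_forall fun ω => (hlim _).const_mul _)
  filter_upwards [hC] with i hi
  exact .of_forall fun ω => abs_mul_le_of_abs_le_one (abs_weight_le_one hc _ u.2) (hi _)

lemma fk_sub (hX : IsMarkovFamily P X) (hc : IsRate c) {ψ : E → ℝ} (hφ : IsBddMeas φ)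
    (hψ : IsBddMeas ψ) (u : ℝ≥0) (x : E) :
    fk P X c u (fun y => φ y - ψ y) x = fk P X c u φ x - fk P X c u ψ x := by
  rw [fk, fk, fk, ← integral_sub (integrable_weight_mul hX hc hφ u x)
    (integrable_weight_mul hX hc hψ u x)]
  simp_rw [mul_sub]

lemma fk_div (φ : E → ℝ) (a : ℝ) (u : ℝ≥0) (x : E) :
    fk P X c u (fun y => φ y / a) x = fk P X c u φ x / a := by
  rw [fk, fk, ← integral_div]
  simp_rw [mul_div_assoc]

/-- Via the semigroup property, bounds and limits of difference quotients at time zero carry over to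
every time `r`. -/
lemma fk_fkQuotient (hX : IsMarkovFamily P X) (hc : IsRate c) (hφ : IsBddMeas φ) (r δ : ℝ≥0)
    (x : E) : fk P X c r (fkQuotient P X c φ δ) x =
      (fk P X c (r + δ) φ x - fk P X c r φ x) / δ := by
  have : fkQuotient P X c φ δ = fun y => (fk P X c δ φ y - φ y) / (δ : ℝ) := rfl
  rw [this, fk_div, fk_sub hX hc (isBddMeas_fk hX hc hφ δ) hφ, fk_add hX hc hφ]

/-- Lipschitz continuity in time. -/
lemma abs_fk_add_sub_le (hX : IsMarkovFamily P X) (hc : IsRate c) (hφ : IsBddMeas φ) {K : ℝ}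
    (hK : ∀ (h : ℝ≥0) (x : E), 0 < h → |fkQuotient P X c φ h x| ≤ K) (r δ : ℝ≥0) (x : E) :
    |fk P X c (r + δ) φ x - fk P X c r φ x| ≤ K * δ := by
  rcases eq_or_ne δ 0 with rfl | h
  · simp
  have h0 : (0 : ℝ) < δ := NNReal.coe_pos.2 (pos_iff_ne_zero.2 h)
  have h1 := abs_fk_le (P := P) (X := X) hc (fun x => hK δ x (pos_iff_ne_zero.2 h)) r x
  rwa [fk_fkQuotient hX hc hφ, abs_div, abs_of_pos h0, div_le_iff₀ h0] at h1

/-- The Feynman–Kac expectation in terms of regularised paths, jointly measurable in time. -/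
lemma fk_eq_integral_reg (hX : IsMarkovFamily P X) (r : ℝ≥0) (x : E) (φ : E → ℝ) :
    fk P X c r φ x = ∫ ω, regWeight c (fun s => X x s ω) r *
      φ (regPath (fun s => X x s ω) r) ∂P := by
  refine integral_congr_ae ((isRightCts_ae hX x).mono fun ω hω => ?_)
  simp only [regWeight_eq hω, regPath_eq hω, Real.toNNReal_coe]

lemma measurable_path (hX : IsMarkovFamily P X) (x : E) :
    Measurable fun ω => (fun s => X x s ω) :=
  measurable_pi_lambda _ fun s => hX.measurable x s

lemma measurable_regPath_comp (hX : IsMarkovFamily P X) (x : E) :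
    Measurable fun z : ℝ × Ω => regPath (fun s => X x s z.2) z.1 := by
  have h : Measurable fun z : ℝ × Ω => ((fun s => X x s z.2), z.1) :=
    ((measurable_path hX x).comp measurable_snd).prodMk measurable_fst
  have h1 := (measurable_regPath (E := E)).comp h
  exact h1

lemma measurable_regWeight_comp (hX : IsMarkovFamily P X) (hc : Measurable c) (x : E) :
    Measurable fun z : ℝ × Ω => regWeight c (fun s => X x s z.2) z.1 := by
  have h : Measurable fun z : ℝ × Ω => ((fun s => X x s z.2), z.1) :=
    ((measurable_path hX x).comp measurable_snd).prodMk measurable_fst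
  have h1 := (measurable_regWeight (E := E) hc).comp h
  exact h1

lemma measurable_fk_time (hX : IsMarkovFamily P X) (hc : IsRate c) (hφ : Measurable φ) (x : E) :
    Measurable fun r : ℝ => fk P X c r.toNNReal φ x := by
  simp_rw [fk_eq_integral_reg hX]
  have h1 : Measurable fun z : ℝ × Ω => (((z.1.toNNReal : ℝ≥0) : ℝ), z.2) := by fun_prop
  have h2 := ((measurable_regWeight_comp hX hc.continuous.measurable x).comp h1).mul
    (hφ.comp ((measurable_regPath_comp hX x).comp h1))
  exact (StronglyMeasurable.integral_prod_right' (ν := P) h2.stronglyMeasurable).measurable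

/-- Dynkin's formula for the Feynman–Kac semigroup. -/
lemma fk_sub_eq_integral (hX : IsMarkovFamily P X) (hc : IsRate c) (hφ : InDomain P X φ)
    {a b : ℝ} (ha : 0 ≤ a) (hab : a ≤ b) (x : E) :
    fk P X c b.toNNReal φ x - fk P X c a.toNNReal φ x =
      ∫ r in a..b, fk P X c r.toNNReal (killedGenerator P X c φ) x := by
  obtain ⟨K, hK⟩ := exists_abs_fkQuotient_le hX hc hφ
  have hψ := isBddMeas_killedGenerator hX hc hφ
  have hadd : ∀ r y : ℝ, 0 ≤ r → r ≤ y → y.toNNReal = r.toNNReal + (y - r).toNNReal := by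
    intro r y hr hy
    rw [← Real.toNNReal_add hr (sub_nonneg.2 hy), add_sub_cancel]
  symm
  -- The orbit is Lipschitz in time and has a right derivative everywhere. This version of the
  -- fundamental theorem asks only for integrability of that derivative, and no continuity of it in
  -- time is available.
  refine intervalIntegral.integral_eq_sub_of_hasDeriv_right
    (f := fun r => fk P X c r.toNNReal φ x) ?_ ?_ ?_
  · have hl : ∀ r y : ℝ, 0 ≤ r → r ≤ y →
        dist (fk P X c y.toNNReal φ x) (fk P X c r.toNNReal φ x) ≤ K * dist y r := by
      intro r y hr hy
      rw [hadd r y hr hy, Real.dist_eq, Real.dist_eq, abs_of_nonneg (sub_nonneg.2 hy)]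
      have := abs_fk_add_sub_le hX hc hφ.isBddMeas hK r.toNNReal (y - r).toNNReal x
      rwa [Real.coe_toNNReal _ (sub_nonneg.2 hy)] at this
    have hK0 : 0 ≤ K := (abs_nonneg _).trans (hK 1 x one_pos)
    refine (LipschitzOnWith.of_dist_le_mul (K := K.toNNReal) (s := Set.Ici 0)
      fun r hr y hy => ?_).continuousOn.mono fun r hr => ?_
    · rw [Real.coe_toNNReal _ hK0]
      rcases le_total r y with h | h
      · rw [dist_comm, dist_comm r]; exact hl r y hr h
      · exact hl y r hy h
    · rw [uIcc_of_le hab] at hr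
      exact ha.trans hr.1
  · intro r hr
    rw [min_eq_left hab, max_eq_right hab] at hr
    have hr0 : 0 ≤ r := ha.trans hr.1.le
    rw [hasDerivWithinAt_iff_tendsto_slope' (by simp)]
    have h1 := (tendsto_fk hX hc (measurable_fkQuotient hX hc hφ.isBddMeas)
      (l := 𝓝[>] (0 : ℝ≥0)) (by filter_upwards [self_mem_nhdsWithin] with h hh x using hK h x hh)
      (tendsto_fkQuotient hX hc hφ) r.toNNReal x).comp (tendsto_toNNReal_sub r)
    refine h1.congr' ?_
    filter_upwards [self_mem_nhdsWithin] with y hy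
    have hy : r < y := hy
    rw [Function.comp_apply, fk_fkQuotient hX hc hφ.isBddMeas, ← hadd r y hr0 hy.le,
      slope_def_field, Real.coe_toNNReal _ (sub_nonneg.2 hy.le)]
  · obtain ⟨D, hD⟩ := hψ.2
    exact (intervalIntegrable_const (c := D)).mono_fun
      (measurable_fk_time hX hc hψ.1 x).aestronglyMeasurable
      (.of_forall fun r => (abs_fk_le hc hD _ _).trans (le_abs_self D))

end Killing

/-! ### Two commuting semigroups and the complete orbit. -/

section TwoProcesses

variable {Ω E F A : Type*} [MeasurableSpace Ω] [TopologicalSpace E] [PolishSpace E]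
  [MeasurableSpace E] [BorelSpace E] [Nonempty E] [TopologicalSpace F] [PolishSpace F]
  [MeasurableSpace F] [BorelSpace F] [Nonempty F] [MeasurableSpace A]
  {P : Measure Ω} [IsProbabilityMeasure P]
  {X : E → ℝ≥0 → Ω → E} {Xm : F → ℝ≥0 → Ω → F} {c : E → ℝ} {cm : F → ℝ}

lemma measurable_fk_param (hX : IsMarkovFamily P X) (hc : IsRate c) {Φ : A × E → ℝ}
    (hΦ : Measurable Φ) (x : E) :
    Measurable fun z : ℝ × A => fk P X c z.1.toNNReal (fun x' => Φ (z.2, x')) x := by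
  simp_rw [fk_eq_integral_reg hX]
  have h1 : Measurable fun z : (ℝ × A) × Ω => (((z.1.1.toNNReal : ℝ≥0) : ℝ), z.2) := by fun_prop
  have h2 := (measurable_regWeight_comp hX hc.continuous.measurable x).comp h1
  have h3 := (measurable_regPath_comp hX x).comp h1
  have h4 : Measurable fun z : (ℝ × A) × Ω => z.1.2 := by fun_prop
  have h5 := h2.mul (hΦ.comp (h4.prodMk h3))
  exact (StronglyMeasurable.integral_prod_right' (ν := P) h5.stronglyMeasurable).measurable

lemma abs_regWeight_mul_le (hX : IsMarkovFamily P X) (hc : IsRate c) (x : E) {r : ℝ}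
    (hr : 0 ≤ r) : ∀ᵐ ω ∂P, |regWeight c (fun s => X x s ω) r| ≤ 1 := by
  filter_upwards [isRightCts_ae hX x] with ω hω
  rw [regWeight_eq hω]
  exact abs_weight_le_one hc _ hr

/-- Fubini for the Feynman–Kac expectation and a further integral. -/
lemma fk_integral_swap (hX : IsMarkovFamily P X) (hc : IsRate c) {μ : Measure A} [SFinite μ]
    {Φ : A × E → ℝ} (hΦ : Measurable Φ) {C : ℝ} (hC : ∀ z, |Φ z| ≤ C)
    (u : ℝ≥0) (x : E) {W : A → ℝ} (hW : Integrable W μ) :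
    fk P X c u (fun x' => ∫ a, W a * Φ (a, x') ∂μ) x =
      ∫ a, W a * fk P X c u (fun x' => Φ (a, x')) x ∂μ := by
  simp_rw [fk_eq_integral_reg hX, ← integral_const_mul]
  rw [integral_integral_swap]
  · refine integral_congr_ae (.of_forall fun a => integral_congr_ae (.of_forall fun ω => ?_))
    simp only
    ring
  · have h0 : Measurable fun ω : Ω => ((u : ℝ), ω) := by fun_prop
    have h1 := (measurable_regWeight_comp hX hc.continuous.measurable x).comp h0
    have h2 := (measurable_regPath_comp hX x).comp h0
    have h3 : Measurable fun z : Ω × A => Φ (z.2, regPath (fun s => X x s z.1) u) :=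
      hΦ.comp (measurable_snd.prodMk (h2.comp measurable_fst))
    have h4 : AEStronglyMeasurable (fun z : Ω × A => regWeight c (fun s => X x s z.1) u)
      (P.prod μ) := (h1.comp measurable_fst).aestronglyMeasurable
    have a1 : ∀ᵐ z ∂P.prod μ, |regWeight c (fun s => X x s z.1) u| ≤ 1 :=
      Measure.quasiMeasurePreserving_fst.ae (abs_regWeight_mul_le hX hc x u.2)
    exact ((hW.comp_snd P).mul_bdd h3.aestronglyMeasurable (.of_forall fun z => hC _)).bdd_mul
      h4 a1

/-- One expectation is taken inside the other, so this is Fubini on a product of two copies of `Ω`;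
the joint law of the two processes plays no role. -/
lemma fk_fk_swap (hX : IsMarkovFamily P X) (hc : IsRate c) (hXm : IsMarkovFamily P Xm)
    (hcm : IsRate cm) {Φ : E × F → ℝ} (hΦ : Measurable Φ) {C : ℝ} (hC : ∀ z, |Φ z| ≤ C)
    (h s : ℝ≥0) (x : E) (y : F) :
    fk P X c h (fun x' => fk P Xm cm s (fun y' => Φ (x', y')) y) x =
      fk P Xm cm s (fun y' => fk P X c h (fun x' => Φ (x', y')) x) y := by
  simp_rw [fk_eq_integral_reg hXm]
  have h0 : Measurable fun ω : Ω => ((s : ℝ), ω) := by fun_prop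
  have h1 := (measurable_regWeight_comp hXm hcm.continuous.measurable y).comp h0
  have h2 := (measurable_regPath_comp hXm y).comp h0
  have h3 : Measurable fun z : Ω × E => Φ (z.2, regPath (fun r => Xm y r z.1) s) :=
    hΦ.comp (measurable_snd.prodMk (h2.comp measurable_fst))
  exact fk_integral_swap hX hc h3 (fun _ => hC _) h x
    (Integrable.of_bound h1.aestronglyMeasurable 1 (abs_regWeight_mul_le hXm hcm y s.2))

lemma fk_intervalIntegral (hX : IsMarkovFamily P X) (hc : IsRate c) {Φ : ℝ × E → ℝ}
    (hΦ : Measurable Φ) {C : ℝ} (hC : ∀ z, |Φ z| ≤ C) (u : ℝ≥0) (x : E) {a b : ℝ}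
    (hab : a ≤ b) :
    fk P X c u (fun x' => ∫ r in a..b, Φ (r, x')) x =
      ∫ r in a..b, fk P X c u (fun x' => Φ (r, x')) x := by
  simp_rw [intervalIntegral.integral_of_le hab]
  have := fk_integral_swap hX hc (μ := volume.restrict (Set.Ioc a b)) hΦ hC u x
    (W := fun _ => 1) (integrable_const _)
  simpa using this

lemma measurable_semigroup_param (hX : IsMarkovFamily P X) {Φ : E × F → ℝ} (hΦ : Measurable Φ)
    (h : ℝ≥0) : Measurable fun z : E × F => semigroup P X h (fun x' => Φ (x', z.2)) z.1 := by
  set κ : Kernel (E × F) E := (transKernel hX h).comap Prod.fst measurable_fst with hκ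
  have h1 : ∀ z : E × F, semigroup P X h (fun x' => Φ (x', z.2)) z.1 =
      ∫ x', Φ (x', z.2) ∂(κ z) := fun z => by
    have hm : Measurable fun x' => Φ (x', z.2) := hΦ.comp (by fun_prop)
    rw [semigroup_eq_integral_transKernel hX h hm, hκ, Kernel.comap_apply]
  simp_rw [h1]
  have h2 : Measurable fun q : (E × F) × E => Φ (q.2, q.1.2) := hΦ.comp (by fun_prop)
  exact (h2.stronglyMeasurable.integral_kernel_prod_right' (κ := κ)).measurable

/-- The assumptions on the extension of the initial value. -/
structure IsHarmonicExtension (P : Measure Ω) (X : E → ℝ≥0 → Ω → E) (Xm : F → ℝ≥0 → Ω → F)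
    (c : E → ℝ) (cm : F → ℝ) (ft : E × F → ℝ) : Prop where
  measurable : Measurable ft
  bdd : ∃ C, ∀ z, |ft z| ≤ C
  domp : ∀ y, InDomain P X (fun x => ft (x, y))
  domm : ∀ x, InDomain P Xm (fun y => ft (x, y))
  gen_bdd : ∃ C, ∀ x y, |generator P X (fun x' => ft (x', y)) x| ≤ C
  eq : ∀ x y, killedGenerator P Xm cm (fun y' => ft (x, y')) y =
    -killedGenerator P X c (fun x' => ft (x', y)) x

/-- `(L₊ - c₊) f̃`. -/
def extGen (P : Measure Ω) (X : E → ℝ≥0 → Ω → E) (c : E → ℝ) (ft : E × F → ℝ) (z : E × F) : ℝ :=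
  killedGenerator P X c (fun x' => ft (x', z.2)) z.1

variable {ft : E × F → ℝ}

/-- The difference quotients are jointly measurable, being integrals against transition kernels with
a parameter, and they converge pointwise. -/
lemma measurable_extGen (hX : IsMarkovFamily P X) (hc : IsRate c)
    (H : IsHarmonicExtension P X Xm c cm ft) : Measurable (extGen P X c ft) := by
  have h1 : Measurable fun z : E × F => generator P X (fun x' => ft (x', z.2)) z.1 := by
    refine measurable_of_tendsto_metrizable' (𝓝[>] (0 : ℝ≥0))
      (f := fun h z => quotient P X (fun x' => ft (x', z.2)) h z.1) (fun h => ?_)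
      (tendsto_pi_nhds.2 fun z => (H.domp z.2).tendsto z.1)
    exact ((measurable_semigroup_param hX H.measurable h).sub H.measurable).div_const _
  exact h1.sub ((hc.continuous.measurable.comp measurable_fst).mul H.measurable)

lemma exists_abs_extGen_le (hc : IsRate c) (H : IsHarmonicExtension P X Xm c cm ft) :
    ∃ C, ∀ z, |extGen P X c ft z| ≤ C := by
  obtain ⟨C, hC0, hC⟩ := hc.abs_le
  obtain ⟨D, hD⟩ := H.bdd
  obtain ⟨K, hK⟩ := H.gen_bdd
  refine ⟨K + C * D, fun z => (abs_sub _ _).trans (add_le_add (hK z.1 z.2) ?_)⟩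
  rw [abs_mul]
  exact mul_le_mul (hC _) (hD _) (abs_nonneg _) hC0

/-- `T_h S_s f̃ (x, y)` for the two Feynman–Kac semigroups `T` and `S`. -/
def fk₂ (P : Measure Ω) (X : E → ℝ≥0 → Ω → E) (Xm : F → ℝ≥0 → Ω → F) (c : E → ℝ) (cm : F → ℝ)
    (ft : E × F → ℝ) (y : F) (x : E) (h s : ℝ) : ℝ :=
  fk P X c h.toNNReal (fun x' => fk P Xm cm s.toNNReal (fun y' => ft (x', y')) y) x

lemma measurable_fk₂ (hX : IsMarkovFamily P X) (hc : IsRate c) (hXm : IsMarkovFamily P Xm)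
    (hcm : IsRate cm) (hf : Measurable ft) (y : F) (x : E) :
    Measurable (Function.uncurry (fk₂ P X Xm c cm ft y x)) := by
  have h1 := measurable_fk_param hX hc (measurable_fk_param hXm hcm hf y) x
  simp only [Function.uncurry_def, fk₂]
  exact h1

lemma abs_fk₂_le (hc : IsRate c) (hcm : IsRate cm) {C : ℝ} (hC : ∀ z, |ft z| ≤ C)
    (y : F) (x : E) (h s : ℝ) : |fk₂ P X Xm c cm ft y x h s| ≤ C :=
  abs_fk_le hc (fun _ => abs_fk_le hcm (fun _ => hC _) _ _) _ _

lemma isBddMeas_inner (hXm : IsMarkovFamily P Xm) (hcm : IsRate cm) (hf : Measurable ft)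
    {C : ℝ} (hC : ∀ z, |ft z| ≤ C) (y : F) (s : ℝ≥0) :
    IsBddMeas fun x' => fk P Xm cm s (fun y' => ft (x', y')) y := by
  refine ⟨?_, C, fun _ => abs_fk_le hcm (fun _ => hC _) _ _⟩
  have h1 : Measurable fun x' : E => ((s : ℝ), x') := by fun_prop
  have h2 := (measurable_fk_param hXm hcm hf y).comp h1
  simp only [Function.comp_def, Real.toNNReal_coe] at h2
  exact h2

/-- Membership in the domain is known for `ft (·, y')` but not for its image under the other
semigroup. Swapping puts `X` innermost, where Dynkin's formula applies; Fubini then moves the time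
integral outside. -/
lemma fk₂_sub_left (hX : IsMarkovFamily P X) (hc : IsRate c) (hXm : IsMarkovFamily P Xm)
    (hcm : IsRate cm) (H : IsHarmonicExtension P X Xm c cm ft) (y : F) (x : E) (s a b : ℝ)
    (ha : 0 ≤ a) (hab : a ≤ b) :
    fk₂ P X Xm c cm ft y x b s - fk₂ P X Xm c cm ft y x a s =
      ∫ r in a..b, fk₂ P X Xm c cm (extGen P X c ft) y x r s := by
  obtain ⟨C, hC⟩ := H.bdd
  obtain ⟨D, hD⟩ := exists_abs_extGen_le hc H
  have hGm := measurable_extGen hX hc H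
  have hsw : Measurable fun q : F × E => ft (q.2, q.1) := H.measurable.comp measurable_swap
  have hb : ∀ u : ℝ≥0, IsBddMeas fun y' => fk P X c u (fun x' => ft (x', y')) x := fun u =>
    isBddMeas_inner (ft := fun q : F × E => ft (q.2, q.1)) hX hc hsw (fun _ => hC _) x u
  simp only [fk₂]
  simp_rw [fk_fk_swap hX hc hXm hcm H.measurable hC, fk_fk_swap hX hc hXm hcm hGm hD]
  rw [← fk_sub hXm hcm (hb _) (hb _)]
  have e : (fun y' => fk P X c b.toNNReal (fun x' => ft (x', y')) x -
      fk P X c a.toNNReal (fun x' => ft (x', y')) x) =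
      fun y' => ∫ r in a..b, fk P X c r.toNNReal (fun x' => extGen P X c ft (x', y')) x :=
    funext fun y' => fk_sub_eq_integral hX hc (H.domp y') ha hab x
  have hGs : Measurable fun q : F × E => extGen P X c ft (q.2, q.1) := hGm.comp measurable_swap
  have hm := measurable_fk_param hX hc hGs x
  rw [e]
  exact fk_intervalIntegral hXm hcm hm (fun z => abs_fk_le hc (fun _ => hD _) _ _) s.toNNReal y hab

/-- Here `Xm` is already innermost, and the minus sign is the equation satisfied by the extension.
-/
lemma fk₂_sub_right (hX : IsMarkovFamily P X) (hc : IsRate c) (hXm : IsMarkovFamily P Xm)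
    (hcm : IsRate cm) (H : IsHarmonicExtension P X Xm c cm ft) (y : F) (x : E) (h a b : ℝ)
    (ha : 0 ≤ a) (hab : a ≤ b) :
    fk₂ P X Xm c cm ft y x h b - fk₂ P X Xm c cm ft y x h a =
      -∫ r in a..b, fk₂ P X Xm c cm (extGen P X c ft) y x h r := by
  obtain ⟨C, hC⟩ := H.bdd
  obtain ⟨D, hD⟩ := exists_abs_extGen_le hc H
  have hGm := measurable_extGen hX hc H
  simp only [fk₂]
  rw [← fk_sub hX hc (isBddMeas_inner hXm hcm H.measurable hC y _)
    (isBddMeas_inner hXm hcm H.measurable hC y _)]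
  have hneg : ∀ (u : ℝ≥0) (φ : F → ℝ), fk P Xm cm u (fun y' => -φ y') y = -fk P Xm cm u φ y := by
    intro u φ
    simp only [fk, mul_neg, integral_neg]
  have hneg' : ∀ (u : ℝ≥0) (φ : E → ℝ), fk P X c u (fun y' => -φ y') x = -fk P X c u φ x := by
    intro u φ
    simp only [fk, mul_neg, integral_neg]
  have e : (fun x' => fk P Xm cm b.toNNReal (fun y' => ft (x', y')) y -
      fk P Xm cm a.toNNReal (fun y' => ft (x', y')) y) =
      fun x' => -∫ r in a..b, fk P Xm cm r.toNNReal (fun y' => extGen P X c ft (x', y')) y := by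
    ext x'
    rw [fk_sub_eq_integral hXm hcm (H.domm x') ha hab y, ← intervalIntegral.integral_neg]
    have : killedGenerator P Xm cm (fun y' => ft (x', y')) =
      fun y' => -extGen P X c ft (x', y') := funext fun y' => H.eq x' y'
    simp_rw [this, hneg]
  have hm := measurable_fk_param hXm hcm hGm y
  rw [e, hneg']
  congr 1
  exact fk_intervalIntegral hX hc hm (fun z => abs_fk_le hcm (fun _ => hD _) _ _) h.toNNReal x hab

lemma fk₂_diag (hX : IsMarkovFamily P X) (hc : IsRate c) (hXm : IsMarkovFamily P Xm)
    (hcm : IsRate cm) (H : IsHarmonicExtension P X Xm c cm ft) (y : F) (x : E) {h s r : ℝ}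
    (hh : 0 ≤ h) (hs : 0 ≤ s) (hr : 0 ≤ r) :
    fk₂ P X Xm c cm ft y x (h + r) (s + r) = fk₂ P X Xm c cm ft y x h s := by
  obtain ⟨D, hD⟩ := exists_abs_extGen_le hc H
  exact diag_const (measurable_fk₂ hX hc hXm hcm (measurable_extGen hX hc H) y x)
    (fun a b => abs_fk₂_le hc hcm hD y x a b)
    (fun s a b _ ha hab => fk₂_sub_left hX hc hXm hcm H y x s a b ha hab)
    (fun h a b _ ha hab => fk₂_sub_right hX hc hXm hcm H y x h a b ha hab) hh hs hr

/-- The orbit of the initial value under the Feynman–Kac group: `T_u f` for `u ≥ 0` and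
`S_{-u} f̃(x, ·)(y)` for `u < 0`. -/
def orbit (P : Measure Ω) (X : E → ℝ≥0 → Ω → E) (Xm : F → ℝ≥0 → Ω → F) (c : E → ℝ) (cm : F → ℝ)
    (ft : E × F → ℝ) (y : F) (u : ℝ) (x : E) : ℝ := fk₂ P X Xm c cm ft y x u (-u)

lemma orbit_of_nonneg (hXm : IsMarkovFamily P Xm) (y : F) {u : ℝ} (hu : 0 ≤ u) (x : E) :
    orbit P X Xm c cm ft y u x = fk P X c u.toNNReal (fun x' => ft (x', y)) x := by
  simp only [orbit, fk₂, Real.toNNReal_of_nonpos (neg_nonpos.2 hu), fk_zero hXm]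

lemma orbit_of_nonpos (hX : IsMarkovFamily P X) (y : F) {u : ℝ} (hu : u ≤ 0) (x : E) :
    orbit P X Xm c cm ft y u x = fk P Xm cm (-u).toNNReal (fun y' => ft (x, y')) y := by
  simp only [orbit, fk₂, Real.toNNReal_of_nonpos hu, fk_zero hX]

lemma abs_orbit_le (hc : IsRate c) (hcm : IsRate cm) {C : ℝ} (hC : ∀ z, |ft z| ≤ C)
    (y : F) (u : ℝ) (x : E) : |orbit P X Xm c cm ft y u x| ≤ C :=
  abs_fk₂_le hc hcm hC y x u (-u)

lemma measurable_orbit (hX : IsMarkovFamily P X) (hc : IsRate c) (hXm : IsMarkovFamily P Xm)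
    (hcm : IsRate cm) (H : IsHarmonicExtension P X Xm c cm ft) (y : F) (u : ℝ) :
    Measurable (orbit P X Xm c cm ft y u) :=
  (isBddMeas_fk hX hc
    (isBddMeas_inner hXm hcm H.measurable H.bdd.choose_spec y (-u).toNNReal) u.toNNReal).1

lemma fk_orbit (hX : IsMarkovFamily P X) (hc : IsRate c) (hXm : IsMarkovFamily P Xm)
    (hcm : IsRate cm) (H : IsHarmonicExtension P X Xm c cm ft) (y : F) (h : ℝ≥0) (u : ℝ) (x : E) :
    fk P X c h (orbit P X Xm c cm ft y u) x = orbit P X Xm c cm ft y (u + h) x := by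
  rcases le_total 0 u with hu | hu
  · rw [funext (orbit_of_nonneg (X := X) (c := c) (cm := cm) (ft := ft) hXm y hu),
      orbit_of_nonneg hXm y (by positivity), Real.toNNReal_add hu h.coe_nonneg, Real.toNNReal_coe, add_comm,
      fk_add hX hc (H.domp y).isBddMeas]
  · have e : fk P X c h (orbit P X Xm c cm ft y u) x = fk₂ P X Xm c cm ft y x h (-u) := by
      rw [funext (orbit_of_nonpos (Xm := Xm) (c := c) (cm := cm) (ft := ft) hX y hu), fk₂,
        Real.toNNReal_coe]
    rw [e]
    -- The diagonal through `(h, -u)` is followed down until it meets an axis: at `(0, -u - h)` if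
    -- `h ≤ -u`, and at `(h + u, 0)` otherwise. Both are points of the orbit at time `u + h`.
    rcases le_total (h : ℝ) (-u) with h1 | h1
    · have := fk₂_diag hX hc hXm hcm H y x (h := 0) (s := -u - h) (r := h) le_rfl
        (by linarith) h.2
      rw [zero_add, sub_add_cancel] at this
      rw [this, orbit_of_nonpos hX y (by linarith), fk₂, Real.toNNReal_zero, fk_zero hX]
      congr 2
      ring
    · have := fk₂_diag hX hc hXm hcm H y x (h := h + u) (s := 0) (r := -u) (by linarith)
        le_rfl (by linarith)
      rw [zero_add, add_neg_cancel_right] at this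
      rw [this, orbit_of_nonneg hXm y (by linarith), fk₂, Real.toNNReal_zero, add_comm]
      simp only [fk_zero hXm]

lemma orbit_zero (hX : IsMarkovFamily P X) (hXm : IsMarkovFamily P Xm) (y : F) (x : E) :
    orbit P X Xm c cm ft y 0 x = ft (x, y) := by
  rw [orbit_of_nonneg hXm y le_rfl, Real.toNNReal_zero, fk_zero hX]

lemma continuous_orbit (hX : IsMarkovFamily P X) (hc : IsRate c) (hXm : IsMarkovFamily P Xm)
    (hcm : IsRate cm) (H : IsHarmonicExtension P X Xm c cm ft) (y : F) (x : E) :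
    Continuous fun u => orbit P X Xm c cm ft y u x := by
  obtain ⟨D, hD⟩ := exists_abs_extGen_le hc H
  have hm := measurable_fk₂ hX hc hXm hcm (measurable_extGen hX hc H) y x
  set Γ := fk₂ P X Xm c cm (extGen P X c ft) y x
  have i1 : ∀ a b, IntervalIntegrable (fun r => Γ r 0) volume a b := fun a b =>
    (intervalIntegrable_const (c := D)).mono_fun
      (hm.comp (measurable_id.prodMk measurable_const)).aestronglyMeasurable
      (.of_forall fun r => (abs_fk₂_le hc hcm hD y x r 0).trans (le_abs_self D))
  have i2 : ∀ a b, IntervalIntegrable (fun r => Γ 0 r) volume a b := fun a b =>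
    (intervalIntegrable_const (c := D)).mono_fun
      (hm.comp (measurable_const.prodMk measurable_id)).aestronglyMeasurable
      (.of_forall fun r => (abs_fk₂_le hc hcm hD y x 0 r).trans (le_abs_self D))
  -- Both half-lines are treated by one formula: with upper limits `max u 0` and `max (-u) 0`, one
  -- of the two primitives always vanishes.
  have c1 := (intervalIntegral.continuous_primitive i1 0).comp
    (continuous_id.max (continuous_const (y := (0 : ℝ))))
  have c2 := (intervalIntegral.continuous_primitive i2 0).comp
    (continuous_neg.max (continuous_const (y := (0 : ℝ))))
  refine ((c1.sub c2).add_const (fk₂ P X Xm c cm ft y x 0 0)).congr fun u => ?_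
  have e1 := fk₂_sub_left hX hc hXm hcm H y x 0 0 (max u 0) le_rfl (le_max_right _ _)
  have e2 := fk₂_sub_right hX hc hXm hcm H y x 0 0 (max (-u) 0) le_rfl (le_max_right _ _)
  simp only [Function.comp_apply, id_eq, Pi.sub_apply]
  change (∫ r in (0 : ℝ)..max u 0, Γ r 0) - (∫ r in (0 : ℝ)..max (-u) 0, Γ 0 r) + _ = _
  rw [orbit]
  rcases le_total 0 u with hu | hu
  · rw [max_eq_left hu, max_eq_right (by linarith)] at *
    have : fk₂ P X Xm c cm ft y x u (-u) = fk₂ P X Xm c cm ft y x u 0 := by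
      simp only [fk₂, Real.toNNReal_of_nonpos (neg_nonpos.2 hu), Real.toNNReal_zero]
    rw [this]
    simp only [intervalIntegral.integral_same]
    linarith
  · rw [max_eq_right hu, max_eq_left (by linarith)] at *
    have : fk₂ P X Xm c cm ft y x u (-u) = fk₂ P X Xm c cm ft y x 0 (-u) := by
      simp only [fk₂, Real.toNNReal_of_nonpos hu, Real.toNNReal_zero]
    rw [this]
    simp only [intervalIntegral.integral_same]
    linarith

end TwoProcesses

/-! ### Translation in `L¹`. -/

section Translation

/-- Continuity of translation in `L¹`. -/
lemma tendsto_integral_abs_translate {q : ℝ → ℝ} (hq : Integrable q) :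
    Tendsto (fun h : ℝ => ∫ u, |q (u - h) - q u|) (𝓝 0) (𝓝 0) := by
  let τ : ℝ → C(ℝ, ℝ) := fun h => ⟨fun u => u - h, by fun_prop⟩
  have hτ : Continuous τ := ContinuousMap.continuous_of_continuous_uncurry _
    (continuous_snd.sub continuous_fst : Continuous fun z : ℝ × ℝ => z.2 - z.1)
  have hτm : ∀ h, MeasurePreserving (τ h) volume volume := fun h => measurePreserving_sub_right _ h
  have h1 : Continuous fun h => Lp.compMeasurePreserving (τ h) (hτm h) (hq.toL1 q) :=
    Continuous.compMeasurePreservingLp continuous_const hτ hτm ENNReal.one_ne_top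
  have h2 : Continuous fun h => ‖Lp.compMeasurePreserving (τ h) (hτm h) (hq.toL1 q) - hq.toL1 q‖ :=
    (h1.sub continuous_const).norm
  have h3 : ∀ h, ‖Lp.compMeasurePreserving (τ h) (hτm h) (hq.toL1 q) - hq.toL1 q‖ =
      ∫ u, |q (u - h) - q u| := by
    intro h
    rw [L1.norm_eq_integral_norm]
    refine integral_congr_ae ?_
    filter_upwards [Lp.coeFn_sub (Lp.compMeasurePreserving (τ h) (hτm h) (hq.toL1 q))
      (hq.toL1 q), Lp.coeFn_compMeasurePreserving (hq.toL1 q) (hτm h), hq.coeFn_toL1,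
      (hτm h).quasiMeasurePreserving.ae hq.coeFn_toL1] with u e1 e2 e3 e4
    rw [e1, Pi.sub_apply, e2, e3, Function.comp_apply, e4]
    rfl
  simp_rw [h3] at h2
  simpa using h2.tendsto 0

lemma sub_translate_eq {q : ℝ → ℝ} (hq : ContDiff ℝ 1 q) (u h : ℝ) :
    q (u - h) - q u = ∫ a in (0 : ℝ)..h, -deriv q (u - a) := by
  have h1 : ∀ a ∈ uIcc 0 h, HasDerivAt (fun a => q (u - a)) (-deriv q (u - a)) a := fun a _ => by
    exact ((hq.differentiable one_ne_zero) (u - a)).hasDerivAt.comp_const_sub u a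
  rw [intervalIntegral.integral_eq_sub_of_hasDerivAt h1]
  · simp
  · exact ((hq.continuous_deriv le_rfl).comp (by fun_prop : Continuous fun a => u - a)).neg
      |>.intervalIntegrable _ _

end Translation

/-! ### Averages of an orbit and the weak domain. -/

section Averages

variable {Ω E : Type*} [MeasurableSpace Ω] [TopologicalSpace E] [PolishSpace E]
  [MeasurableSpace E] [BorelSpace E] [Nonempty E]
  {P : Measure Ω} [IsProbabilityMeasure P] {X : E → ℝ≥0 → Ω → E} {c : E → ℝ}
  {g : ℝ → E → ℝ} {M : ℝ} {q q' : ℝ → ℝ}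

/-- A bounded complete orbit of the Feynman–Kac semigroup. -/
structure IsFkOrbit (P : Measure Ω) (X : E → ℝ≥0 → Ω → E) (c : E → ℝ) (g : ℝ → E → ℝ) (M : ℝ) :
    Prop where
  measurable : ∀ u, Measurable (g u)
  continuous : ∀ x, Continuous fun u => g u x
  abs_le : ∀ u x, |g u x| ≤ M
  fk_eq : ∀ (h : ℝ≥0) u x, fk P X c h (g u) x = g (u + h) x

/-- The average `∫ q(u) g_u du`. -/
def avg (g : ℝ → E → ℝ) (q : ℝ → ℝ) (x : E) : ℝ := ∫ u, q u * g u x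

namespace IsFkOrbit

variable (hg : IsFkOrbit P X c g M)
include hg

lemma measurable_uncurry : Measurable (Function.uncurry g) :=
  measurable_uncurry_of_continuous_of_measurable hg.continuous hg.measurable

lemma integrable_mul (hq : Integrable q) (x : E) : Integrable fun u => q u * g u x :=
  hq.mul_bdd (hg.continuous x).aestronglyMeasurable (.of_forall fun u => hg.abs_le u x)

lemma abs_avg_le (hq : Integrable q) (x : E) : |avg g q x| ≤ M * ∫ u, |q u| := by
  rw [← integral_const_mul, ← Real.norm_eq_abs, avg]
  refine norm_integral_le_of_norm_le (hq.abs.const_mul M) (.of_forall fun u => ?_)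
  rw [norm_mul, mul_comm]
  exact mul_le_mul_of_nonneg_right (hg.abs_le u x) (norm_nonneg _)

lemma avg_sub (hq : Integrable q) (hq' : Integrable q') (x : E) :
    avg g q x - avg g q' x = avg g (fun u => q u - q' u) x := by
  rw [avg, avg, avg, ← integral_sub (hg.integrable_mul hq x) (hg.integrable_mul hq' x)]
  simp_rw [sub_mul]

lemma isBddMeas_avg (hqm : Measurable q) (hq : Integrable q) : IsBddMeas (avg g q) := by
  refine ⟨?_, M * ∫ u, |q u|, hg.abs_avg_le hq⟩
  have h1 : Measurable fun z : E × ℝ => q z.2 * g z.2 z.1 :=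
    (hqm.comp measurable_snd).mul (hg.measurable_uncurry.comp measurable_swap)
  exact (StronglyMeasurable.integral_prod_right' (ν := volume) h1.stronglyMeasurable).measurable

/-- The semigroup shifts the orbit, and a change of variable moves the shift onto the weight.
Regularity of the average in the semigroup thus becomes regularity of `q`. -/
lemma fk_avg (hX : IsMarkovFamily P X) (hc : IsRate c) (hq : Integrable q) (h : ℝ≥0) (x : E) :
    fk P X c h (avg g q) x = avg g (fun u => q (u - h)) x := by
  have h1 := fk_integral_swap hX hc hg.measurable_uncurry (fun z => hg.abs_le z.1 z.2) h x hq
  simp only [Function.uncurry_apply_pair, hg.fk_eq] at h1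
  rw [show avg g q = fun x' => ∫ a, q a * g a x' from rfl, h1, avg,
    ← integral_sub_right_eq_self (fun u => q u * g (u + h) x) (h : ℝ)]
  simp

lemma abs_fk_avg_sub_le (hX : IsMarkovFamily P X) (hc : IsRate c) (hq : Integrable q) (h : ℝ≥0)
    (x : E) : |fk P X c h (avg g q) x - avg g q x| ≤ M * ∫ u, |q (u - h) - q u| := by
  rw [hg.fk_avg hX hc hq, hg.avg_sub (hq.comp_sub_right _) hq]
  exact hg.abs_avg_le ((hq.comp_sub_right _).sub hq) x

lemma fk_avg_sub_eq (hX : IsMarkovFamily P X) (hc : IsRate c) (hq : Integrable q)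
    (hqc : ContDiff ℝ 1 q) (hq' : Integrable (deriv q)) (h : ℝ≥0) (x : E) :
    fk P X c h (avg g q) x - avg g q x =
      ∫ a in (0 : ℝ)..h, avg g (fun u => -deriv q (u - a)) x := by
  rw [hg.fk_avg hX hc hq, hg.avg_sub (hq.comp_sub_right _) hq]
  have e : ∀ u, (q (u - h) - q u) * g u x =
      ∫ a in Set.Ioc (0 : ℝ) h, -deriv q (u - a) * g u x := fun u => by
    rw [sub_translate_eq hqc, intervalIntegral.integral_of_le h.coe_nonneg, integral_mul_const]
  simp only [avg, e, intervalIntegral.integral_of_le h.coe_nonneg]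
  refine integral_integral_swap (f := fun u a => -deriv q (u - a) * g u x) ?_
  have hcont : Continuous fun z : ℝ × ℝ => -deriv q (z.1 - z.2) :=
    ((hqc.continuous_deriv le_rfl).comp (by fun_prop)).neg
  have h1 : Integrable (fun z : ℝ × ℝ => -deriv q (z.1 - z.2))
      (volume.prod (volume.restrict (Set.Ioc (0 : ℝ) h))) := by
    rw [integrable_prod_iff' hcont.aestronglyMeasurable]
    refine ⟨.of_forall fun a => (hq'.comp_sub_right a).neg, ?_⟩
    have : ∀ a : ℝ, ∫ u, ‖-deriv q (u - a)‖ = ∫ u, ‖deriv q u‖ := fun a => by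
      simp_rw [norm_neg]
      exact integral_sub_right_eq_self (fun u => ‖deriv q u‖) a
    simp_rw [this]
    exact integrable_const _
  exact h1.mul_bdd (((hg.continuous x).comp continuous_fst).aestronglyMeasurable)
    (.of_forall fun z => hg.abs_le _ _)

lemma eventually_abs_fk_avg_sub_le (hX : IsMarkovFamily P X) (hc : IsRate c) (hq : Integrable q)
    {ε : ℝ} (hε : 0 < ε) :
    ∀ᶠ h : ℝ≥0 in 𝓝[>] 0, ∀ x, |fk P X c h (avg g q) x - avg g q x| < ε := by
  have h1 := (tendsto_integral_abs_translate hq).const_mul M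
  rw [mul_zero] at h1
  have h2 := h1.comp ((tendsto_nhdsWithin_iff.1 tendsto_coe_nhdsGT_zero).1)
  filter_upwards [h2.eventually_lt_const hε] with h hh x
  exact (hg.abs_fk_avg_sub_le hX hc hq h x).trans_lt hh

/-- The killed semigroup moves the average by at most `M` times the `L¹` modulus of translation of
`q`, and killing itself contributes `O(h)`; both bounds are uniform in the starting point. -/
lemma inB0_avg (hX : IsMarkovFamily P X) (hc : IsRate c) (hqm : Measurable q)
    (hq : Integrable q) : InB0 P X (avg g q) := by
  have hb := hg.isBddMeas_avg hqm hq
  refine ⟨hb, ?_⟩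
  obtain ⟨C, hC0, hC⟩ := hc.abs_le
  obtain ⟨D, hD⟩ := hb.2
  rw [Metric.tendstoUniformly_iff]
  intro ε hε
  have h1 : Tendsto (fun h : ℝ≥0 => C * D * (h : ℝ)) (𝓝[>] 0) (𝓝 0) := by
    simpa using ((tendsto_nhdsWithin_iff.1 tendsto_coe_nhdsGT_zero).1).const_mul (C * D)
  filter_upwards [hg.eventually_abs_fk_avg_sub_le hX hc hq (half_pos hε),
    h1.eventually_lt_const (half_pos hε)] with h h2 h3 x
  have h4 := abs_semigroup_sub_fk_le hX hc hb.1 hC hD h x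
  rw [dist_comm, Real.dist_eq]
  calc _ ≤ |semigroup P X h (avg g q) x - fk P X c h (avg g q) x| +
        |fk P X c h (avg g q) x - avg g q x| := abs_sub_le _ _ _
    _ < ε := by linarith [h2 x]

lemma abs_fkQuotient_avg_le (hX : IsMarkovFamily P X) (hc : IsRate c) (hq : Integrable q)
    (hqc : ContDiff ℝ 1 q) (hq' : Integrable (deriv q)) {h : ℝ≥0} (hh : 0 < h) (x : E) :
    |fkQuotient P X c (avg g q) h x| ≤ M * ∫ u, |deriv q u| := by
  rw [fkQuotient, abs_div, abs_of_nonneg h.coe_nonneg, div_le_iff₀ (NNReal.coe_pos.2 hh),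
    hg.fk_avg_sub_eq hX hc hq hqc hq']
  have := intervalIntegral.norm_integral_le_of_norm_le_const (a := 0) (b := (h : ℝ))
    (f := fun a => avg g (fun u => -deriv q (u - a)) x) (C := M * ∫ u, |deriv q u|) fun a _ => by
      have hi : Integrable fun u => -deriv q (u - a) := (hq'.comp_sub_right a).neg
      refine (hg.abs_avg_le hi x).trans_eq ?_
      simp_rw [abs_neg]
      rw [integral_sub_right_eq_self (fun u => |deriv q u|) a]
  simpa using this

lemma avg_neg (q : ℝ → ℝ) (x : E) : avg g (fun u => -q u) x = -avg g q x := by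
  simp only [avg, neg_mul, integral_neg]

lemma tendstoUniformly_fkQuotient_avg (hX : IsMarkovFamily P X) (hc : IsRate c)
    (hq : Integrable q) (hqc : ContDiff ℝ 1 q) (hq' : Integrable (deriv q)) :
    TendstoUniformly (fun h => fkQuotient P X c (avg g q) h) (avg g fun u => -deriv q u)
      (𝓝[>] 0) := by
  rw [Metric.tendstoUniformly_iff]
  intro ε hε
  have h1 := (tendsto_integral_abs_translate hq').const_mul M
  rw [mul_zero] at h1
  obtain ⟨δ, hδ, h2⟩ := Metric.eventually_nhds_iff.1 (h1.eventually_lt_const (half_pos hε))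
  have h3 := (tendsto_nhdsWithin_iff.1 tendsto_coe_nhdsGT_zero).1
  filter_upwards [self_mem_nhdsWithin, h3.eventually_lt_const hδ] with h hh hhδ x
  have hh0 : (0 : ℝ) < h := NNReal.coe_pos.2 hh
  -- No majorant for the translates of `deriv q` is at hand, so the translation is moved onto the
  -- orbit, which is continuous and bounded.
  have hcont : Continuous fun a => avg g (fun u => -deriv q (u - a)) x := by
    have e : ∀ a, avg g (fun u => -deriv q (u - a)) x = ∫ u, -deriv q u * g (u + a) x := fun a => by
      rw [avg, ← integral_sub_right_eq_self (fun u => -deriv q u * g (u + a) x) a]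
      simp
    simp_rw [e]
    refine continuous_of_dominated (bound := fun u => |deriv q u| * M)
      (fun a => ?_) (fun a => .of_forall fun u => ?_) (hq'.abs.mul_const M)
      (.of_forall fun u => ?_)
    · exact hq'.neg.aestronglyMeasurable.mul
        ((hg.continuous x).comp (by fun_prop)).aestronglyMeasurable
    · rw [norm_mul, norm_neg]
      exact mul_le_mul_of_nonneg_left (hg.abs_le _ _) (abs_nonneg _)
    · exact continuous_const.mul ((hg.continuous x).comp (by fun_prop))
  -- The error is a mean over `a ∈ (0, h]` of averages with weight a translation difference of
  -- `deriv q`, hence small by `L¹` continuity of translation.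
  have e : fkQuotient P X c (avg g q) h x - avg g (fun u => -deriv q u) x =
      (∫ a in (0 : ℝ)..h, (avg g (fun u => -deriv q (u - a)) x -
        avg g (fun u => -deriv q u) x)) / h := by
    rw [intervalIntegral.integral_sub (hcont.intervalIntegrable _ _) intervalIntegrable_const,
      fkQuotient, hg.fk_avg_sub_eq hX hc hq hqc hq', intervalIntegral.integral_const, smul_eq_mul]
    field_simp
    ring
  rw [dist_comm, Real.dist_eq, e, abs_div, abs_of_pos hh0, div_lt_iff₀ hh0]
  have h4 := intervalIntegral.norm_integral_le_of_norm_le_const (a := 0) (b := (h : ℝ))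
    (f := fun a => avg g (fun u => -deriv q (u - a)) x - avg g (fun u => -deriv q u) x)
    (C := ε / 2) fun a ha => by
      rw [uIoc_of_le hh0.le] at ha
      have hi : Integrable fun u => -deriv q (u - a) := (hq'.comp_sub_right a).neg
      have hi' : Integrable fun u => -deriv q u := hq'.neg
      rw [hg.avg_sub hi hi']
      have hs : Integrable fun u => -deriv q (u - a) - -deriv q u := hi.sub hi'
      refine (hg.abs_avg_le hs x).trans ?_
      have h5 : ∀ u, |-deriv q (u - a) - -deriv q u| = |deriv q (u - a) - deriv q u| := fun u => by
        rw [neg_sub_neg, abs_sub_comm]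
      simp_rw [h5]
      refine (h2 ?_).le
      rw [Real.dist_eq, sub_zero, abs_of_pos ha.1]
      exact ha.2.trans_lt hhδ
  rw [Real.norm_eq_abs, sub_zero, abs_of_pos hh0] at h4
  calc _ ≤ ε / 2 * h := h4
    _ < ε * h := by gcongr; linarith

lemma tendsto_quotient_avg (hX : IsMarkovFamily P X) (hc : IsRate c) (hq : Integrable q)
    (hqc : ContDiff ℝ 1 q) (hq' : Integrable (deriv q)) (x : E) :
    Tendsto (fun h => quotient P X (avg g q) h x) (𝓝[>] 0)
      (𝓝 (-avg g (deriv q) x + c x * avg g q x)) := by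
  have hB := hg.inB0_avg hX hc hqc.continuous.measurable hq
  have h1 := (hg.tendstoUniformly_fkQuotient_avg hX hc hq hqc hq').tendsto_at x
  rw [hg.avg_neg] at h1
  have h2 := h1.add (tendsto_quotient_sub_fkQuotient hX hc hB.1 (hB.2.tendsto_at x))
  refine h2.congr fun h => ?_
  ring

lemma generator_avg (hX : IsMarkovFamily P X) (hc : IsRate c) (hq : Integrable q)
    (hqc : ContDiff ℝ 1 q) (hq' : Integrable (deriv q)) :
    generator P X (avg g q) = fun x => -avg g (deriv q) x + c x * avg g q x :=
  funext fun x => (hg.tendsto_quotient_avg hX hc hq hqc hq' x).limUnder_eq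

lemma killedGenerator_avg (hX : IsMarkovFamily P X) (hc : IsRate c) (hq : Integrable q)
    (hqc : ContDiff ℝ 1 q) (hq' : Integrable (deriv q)) :
    killedGenerator P X c (avg g q) = avg g fun u => -deriv q u := by
  ext x
  rw [killedGenerator, hg.generator_avg hX hc hq hqc hq', hg.avg_neg]
  ring

end IsFkOrbit

/-- Continuity of `c` and of the path at time zero from the right let `c (X x h ω)` be replaced by
`c x`. This handles the killing term in the requirement that the semigroup be continuous at the
image under the generator. -/
lemma tendsto_semigroup_rate_mul (hX : IsMarkovFamily P X) (hc : IsRate c) {φ : E → ℝ}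
    (hφ : IsBddMeas φ) {x : E}
    (hlim : Tendsto (fun h => semigroup P X h φ x) (𝓝[>] 0) (𝓝 (φ x))) :
    Tendsto (fun h => semigroup P X h (fun y => c y * φ y) x) (𝓝[>] 0) (𝓝 (c x * φ x)) := by
  obtain ⟨C, hC0, hC⟩ := hc.abs_le
  obtain ⟨hm, D, hD⟩ := hφ
  have hbd : ∀ h : ℝ≥0, ∀ ω, ‖(c (X x h ω) - c x) * φ (X x h ω)‖ ≤ (C + C) * D := fun h ω => by
    rw [norm_mul]
    exact mul_le_mul ((abs_sub _ _).trans (add_le_add (hC _) (hC _))) (hD _) (norm_nonneg _)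
      (by positivity)
  have hAm : ∀ h : ℝ≥0, AEStronglyMeasurable (fun ω => (c (X x h ω) - c x) * φ (X x h ω)) P :=
    fun h => ((aestronglyMeasurable_comp hX hc.continuous.measurable x h).sub
      aestronglyMeasurable_const).mul (aestronglyMeasurable_comp hX hm x h)
  have h1 : Tendsto (fun h : ℝ≥0 => ∫ ω, (c (X x h ω) - c x) * φ (X x h ω) ∂P) (𝓝[>] 0)
      (𝓝 (∫ _, (0 : ℝ) ∂P)) := by
    refine tendsto_integral_filter_of_dominated_convergence (fun _ => (C + C) * D)
      (.of_forall hAm) (.of_forall fun h => .of_forall (hbd h)) (integrable_const _) ?_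
    filter_upwards [isRightCts_ae hX x, hX.start x] with ω hω h0
    have h2 : Tendsto (fun h => X x h ω) (𝓝[>] 0) (𝓝 x) := by
      have := (hω 0).tendsto
      rw [h0] at this
      exact this.mono_left (nhdsWithin_mono _ Set.Ioi_subset_Ici_self)
    have h3 : Tendsto (fun h : ℝ≥0 => |c (X x h ω) - c x| * D) (𝓝[>] 0) (𝓝 0) := by
      simpa using ((((hc.continuous.tendsto x).comp h2).sub_const (c x)).abs.mul_const D)
    refine squeeze_zero_norm (fun h => ?_) h3
    rw [norm_mul]
    exact mul_le_mul_of_nonneg_left (hD _) (abs_nonneg _)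
  have h4 := h1.add (hlim.const_mul (c x))
  rw [integral_zero, zero_add] at h4
  refine h4.congr fun h => ?_
  rw [semigroup, semigroup, ← integral_const_mul, ← integral_add]
  · refine integral_congr_ae (.of_forall fun ω => ?_)
    simp only
    ring
  · exact Integrable.of_bound (hAm h) _ (.of_forall (hbd h))
  · exact (integrable_of_bdd (P := P) (hm.comp (hX.measurable x h)) fun _ => hD _).const_mul _

lemma IsBddMeas.rate_mul (hc : IsRate c) {φ : E → ℝ} (hφ : IsBddMeas φ) :
    IsBddMeas fun x => c x * φ x := by
  obtain ⟨C, hC0, hC⟩ := hc.abs_le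
  obtain ⟨hm, D, hD⟩ := hφ
  refine ⟨hc.continuous.measurable.mul hm, C * D, fun x => ?_⟩
  rw [abs_mul]
  exact mul_le_mul (hC x) (hD x) (abs_nonneg _) hC0

lemma semigroup_add_fun (hX : IsMarkovFamily P X) {φ ψ : E → ℝ} (hφ : IsBddMeas φ)
    (hψ : IsBddMeas ψ) (h : ℝ≥0) (x : E) :
    semigroup P X h (fun y => φ y + ψ y) x = semigroup P X h φ x + semigroup P X h ψ x :=
  integral_add (integrable_of_bdd (hφ.1.comp (hX.measurable x h)) fun _ => hφ.2.choose_spec _)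
    (integrable_of_bdd (hψ.1.comp (hX.measurable x h)) fun _ => hψ.2.choose_spec _)

/-- The generator is an average, which lies in `B₀`, plus `c` times an average, for which only
pointwise convergence is available without a further assumption. This is why the weak domain
appears. -/
lemma IsFkOrbit.inDomain_avg (hg : IsFkOrbit P X c g M) (hX : IsMarkovFamily P X)
    (hc : IsRate c) (hq : Integrable q) (hqc : ContDiff ℝ 1 q) (hq' : Integrable (deriv q)) :
    InDomain P X (avg g q) := by
  have hB := hg.inB0_avg hX hc hqc.continuous.measurable hq
  have hB' := hg.inB0_avg hX hc (hqc.continuous_deriv le_rfl).neg.measurable hq'.neg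
  have hgen : generator P X (avg g q) =
      fun x => avg g (fun u => -deriv q u) x + c x * avg g q x := by
    ext x
    rw [hg.generator_avg hX hc hq hqc hq', hg.avg_neg]
  refine ⟨hB.1, ?_, fun x => ?_, fun x => ?_⟩
  · obtain ⟨C, -, hC⟩ := hc.abs_le
    obtain ⟨D, hD⟩ := hB.1.2
    refine ⟨C * D + M * ∫ u, |deriv q u|, fun h x hh => ?_⟩
    have h1 := abs_quotient_sub_fkQuotient_le hX hc hB.1.1 hC hD hh x
    have h2 := hg.abs_fkQuotient_avg_le hX hc hq hqc hq' hh x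
    calc _ = |(quotient P X (avg g q) h x - fkQuotient P X c (avg g q) h x) +
          fkQuotient P X c (avg g q) h x| := by ring_nf
      _ ≤ _ := (abs_add_le _ _).trans (add_le_add h1 h2)
  · rw [hg.generator_avg hX hc hq hqc hq']
    exact hg.tendsto_quotient_avg hX hc hq hqc hq' x
  · rw [hgen]
    refine ((hB'.2.tendsto_at x).add
      (tendsto_semigroup_rate_mul hX hc hB.1 (hB.2.tendsto_at x))).congr fun h => ?_
    exact (semigroup_add_fun hX hB'.1 (hB.1.rate_mul hc) h x).symm

end Averages

/-! ### Uniform expansion of the killing and the strong domain. -/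

section StrongDomain

variable {Ω E : Type*} [MeasurableSpace Ω] [TopologicalSpace E] [PolishSpace E]
  [MeasurableSpace E] [BorelSpace E] [Nonempty E]
  {P : Measure Ω} [IsProbabilityMeasure P] {X : E → ℝ≥0 → Ω → E} {c : E → ℝ}
  {φ : E → ℝ}

lemma semigroup_zero (hX : IsMarkovFamily P X) (φ : E → ℝ) (x : E) :
    semigroup P X 0 φ x = φ x := by
  rw [semigroup, integral_congr_ae (g := fun _ => φ x)
    ((hX.start x).mono fun ω hω => by simp only [hω])]
  simp

lemma InB0.exists_forall_lt (hX : IsMarkovFamily P X) (hφ : InB0 P X φ) {ε : ℝ} (hε : 0 < ε) :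
    ∃ η : ℝ, 0 < η ∧ ∀ s : ℝ≥0, (s : ℝ) < η → ∀ x, |semigroup P X s φ x - φ x| ≤ ε := by
  have h1 := (Metric.tendstoUniformly_iff.1 hφ.2) ε hε
  rw [eventually_nhdsWithin_iff, Metric.eventually_nhds_iff] at h1
  obtain ⟨η, hη, h2⟩ := h1
  refine ⟨η, hη, fun s hs x => ?_⟩
  rcases eq_or_ne s 0 with rfl | h0
  · rw [semigroup_zero hX, sub_self, abs_zero]
    exact hε.le
  · have h3 := h2 (y := s) (by simpa [NNReal.dist_eq] using hs) (pos_iff_ne_zero.2 h0) x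
    rw [dist_comm] at h3
    exact h3.le

lemma integral_rate_mul_eq (hX : IsMarkovFamily P X) (hc : IsRate c) (hφ : IsBddMeas φ)
    {s h : ℝ≥0} (hs : s ≤ h) (x : E) :
    ∫ ω, c (X x s ω) * φ (X x h ω) ∂P =
      semigroup P X s (fun y => c y * semigroup P X (h - s) φ y) x := by
  obtain ⟨C, -, hC⟩ := hc.abs_le
  have := integral_mul_comp hX x s (h - s) hφ (W := fun ω => c (X x s ω))
    (hc.continuous.measurable.comp (measurable_past x le_rfl)) (fun ω => hC _)
  rwa [add_tsub_cancel_of_le hs] at this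

/-- The first-order expansion of the killing, uniformly in the starting point. -/
lemma tendstoUniformly_quotient_sub_fkQuotient (hX : IsMarkovFamily P X) (hc : IsRate c)
    (hφ : InB0 P X φ) (hcφ : InB0 P X fun x => c x * φ x) :
    TendstoUniformly (fun h x => quotient P X φ h x - fkQuotient P X c φ h x)
      (fun x => c x * φ x) (𝓝[>] 0) := by
  obtain ⟨C, hC0, hC⟩ := hc.abs_le
  obtain ⟨hm, D, hD⟩ := id hφ.1
  rw [Metric.tendstoUniformly_iff]
  intro ε hε
  have hC1 : 0 < C + 1 := by positivity
  -- Error budget: `ε / 4` for replacing the later semigroup step, after multiplication by `c ≤ C`;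
  -- `ε / 4` for the earlier step; `ε / 4` for linearising the exponential.
  obtain ⟨η₁, hη₁, h1⟩ := hφ.exists_forall_lt hX (ε := ε / (4 * (C + 1))) (by positivity)
  obtain ⟨η₂, hη₂, h2⟩ := hcφ.exists_forall_lt hX (ε := ε / 4) (by positivity)
  have hcoe := (tendsto_nhdsWithin_iff.1 tendsto_coe_nhdsGT_zero).1
  have l1 : Tendsto (fun h : ℝ≥0 => C * (h : ℝ)) (𝓝[>] 0) (𝓝 0) := by
    simpa using hcoe.const_mul C
  have l2 : Tendsto (fun h : ℝ≥0 => C ^ 2 * D * (h : ℝ)) (𝓝[>] 0) (𝓝 0) := by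
    simpa using hcoe.const_mul (C ^ 2 * D)
  filter_upwards [self_mem_nhdsWithin, hcoe.eventually_lt_const hη₁,
    hcoe.eventually_lt_const hη₂, l1.eventually_lt_const one_pos,
    l2.eventually_lt_const (by positivity : 0 < ε / 4)] with h hh a1 a2 a3 a4 x
  have hh0 : (0 : ℝ) < h := NNReal.coe_pos.2 hh
  have hpath : Measurable fun z : ℝ × Ω => c (regPath (fun r => X x r z.2) z.1) := by
    have h3 := measurable_regPath_comp hX x
    exact hc.continuous.measurable.comp h3
  let I : Ω → ℝ := fun ω => ∫ s in (0 : ℝ)..h, c (regPath (fun r => X x r ω) s)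
  have hmc : Measurable fun z : Ω × ℝ => c (regPath (fun r => X x r z.1) z.2) :=
    hpath.comp (measurable_swap (α := Ω) (β := ℝ))
  have hIm : Measurable I := by
    have h3 := (StronglyMeasurable.integral_prod_right' (ν := volume.restrict (Set.Ioc (0 : ℝ) h))
      hmc.stronglyMeasurable).measurable
    simp only [I, intervalIntegral.integral_of_le h.coe_nonneg]
    exact h3
  have hIC : ∀ ω, |I ω| ≤ C * h := fun ω => by
    have := intervalIntegral.norm_integral_le_of_norm_le_const (a := 0) (b := (h : ℝ))
      (f := fun s => c (regPath (fun r => X x r ω) s)) fun s _ => hC _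
    simpa using this
  have hφi : Integrable (fun ω => φ (X x h ω)) P :=
    integrable_of_bdd (hm.comp (hX.measurable x h)) fun _ => hD _
  have i1 : Integrable (fun ω => I ω * φ (X x h ω)) P :=
    hφi.bdd_mul hIm.aestronglyMeasurable (.of_forall hIC)
  have i2 : Integrable (fun ω => (1 - weight c (fun s => X x s ω) h) * φ (X x h ω)) P :=
    hφi.bdd_mul (aestronglyMeasurable_const.sub (aestronglyMeasurable_weight hX hc x h))
      (.of_forall fun ω => abs_one_sub_weight_le hc hC _ h)
  -- To first order `1 - exp(-I)` is `I`, with a quadratic error valid because `C * h < 1`.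
  have e1 : |(semigroup P X h φ x - fk P X c h φ x) - ∫ ω, I ω * φ (X x h ω) ∂P| ≤
      C ^ 2 * D * h * h := by
    rw [semigroup_sub_fk hX hc hφ.1, ← integral_sub i2 i1, ← Real.norm_eq_abs]
    have hae : ∀ᵐ ω ∂P, ‖(1 - weight c (fun s => X x s ω) h) * φ (X x h ω) -
        I ω * φ (X x h ω)‖ ≤ C ^ 2 * D * h * h := by
      filter_upwards [isRightCts_ae hX x] with ω hω
      have hw : weight c (fun s => X x s ω) h = Real.exp (-I ω) := by rw [← regWeight_eq hω]; rfl
      have h4 := Real.abs_exp_sub_one_sub_id_le (x := -I ω)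
        (by rw [abs_neg]; exact (hIC ω).trans a3.le)
      rw [← sub_mul, norm_mul, hw, Real.norm_eq_abs,
        show 1 - Real.exp (-I ω) - I ω = -(Real.exp (-I ω) - 1 - -I ω) by ring, abs_neg]
      have h5 : (-I ω) ^ 2 ≤ (C * h) ^ 2 := by
        rw [neg_sq, ← sq_abs]
        exact pow_le_pow_left₀ (abs_nonneg _) (hIC ω) 2
      calc _ ≤ (C * h) ^ 2 * D := mul_le_mul (h4.trans h5) (hD _) (abs_nonneg _) (sq_nonneg _)
        _ = _ := by ring
    simpa using norm_integral_le_of_norm_le_const hae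
  let G : ℝ → ℝ := fun s => ∫ ω, c (regPath (fun r => X x r ω) s) * φ (X x h ω) ∂P
  have hprod : Measurable fun z : ℝ × Ω => c (regPath (fun r => X x r z.2) z.1) * φ (X x h z.2) :=
    hpath.mul (hm.comp ((hX.measurable x h).comp measurable_snd))
  have hbd : ∀ z : ℝ × Ω, |c (regPath (fun r => X x r z.2) z.1) * φ (X x h z.2)| ≤ C * D := by
    intro z
    rw [abs_mul]
    exact mul_le_mul (hC _) (hD _) (abs_nonneg _) hC0
  have hGm : Measurable G :=
    (StronglyMeasurable.integral_prod_right' (ν := P) hprod.stronglyMeasurable).measurable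
  have hGi : IntervalIntegrable G volume 0 h :=
    (intervalIntegrable_const (c := C * D)).mono_fun hGm.aestronglyMeasurable
      (.of_forall fun s => (abs_integral_le_of_forall_abs_le fun ω => hbd (s, ω)).trans
        (le_abs_self _))
  have e2 : ∫ ω, I ω * φ (X x h ω) ∂P = ∫ s in (0 : ℝ)..h, G s := by
    simp only [I, G, intervalIntegral.integral_of_le h.coe_nonneg, ← integral_mul_const]
    rw [integral_integral_swap]
    exact Integrable.of_bound
      (hprod.comp (measurable_swap (α := Ω) (β := ℝ))).aestronglyMeasurable (C * D)
      (.of_forall fun z => hbd (z.2, z.1))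
  -- By the Markov property at time `s` the integrand is `P^s (c P^{h-s} φ)`. It is close to `P^s (c
  -- φ)` because `φ` is in `B₀`, and that is close to `c φ` because `c φ` is in `B₀`.
  have e3 : ∀ s ∈ Set.Ioc (0 : ℝ) h, |G s - c x * φ x| ≤ ε / 2 := by
    intro s hs
    have hsh : s.toNNReal ≤ h := Real.toNNReal_le_iff_le_coe.2 hs.2
    have hG : G s = semigroup P X s.toNNReal
        (fun y => c y * semigroup P X (h - s.toNNReal) φ y) x := by
      rw [← integral_rate_mul_eq hX hc hφ.1 hsh]
      refine integral_congr_ae ((isRightCts_ae hX x).mono fun ω hω => ?_)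
      simp only [regPath_eq hω]
    have hb1 : IsBddMeas fun y => c y * semigroup P X (h - s.toNNReal) φ y :=
      (isBddMeas_semigroup hX hφ.1 _).rate_mul hc
    have b1 : |semigroup P X s.toNNReal (fun y => c y * semigroup P X (h - s.toNNReal) φ y) x -
        semigroup P X s.toNNReal (fun y => c y * φ y) x| ≤ C * (ε / (4 * (C + 1))) := by
      have j1 : Integrable (fun ω => c (X x s.toNNReal ω) *
          semigroup P X (h - s.toNNReal) φ (X x s.toNNReal ω)) P :=
        integrable_of_bdd (hb1.1.comp (hX.measurable x _)) fun _ => hb1.2.choose_spec _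
      have j2 : Integrable (fun ω => c (X x s.toNNReal ω) * φ (X x s.toNNReal ω)) P :=
        integrable_of_bdd (hcφ.1.1.comp (hX.measurable x _)) fun _ => hcφ.1.2.choose_spec _
      rw [semigroup, semigroup, ← integral_sub j1 j2]
      refine abs_integral_le_of_forall_abs_le fun ω => ?_
      rw [← mul_sub, abs_mul]
      refine mul_le_mul (hC _) (h1 _ ?_ _) (abs_nonneg _) hC0
      exact lt_of_le_of_lt (NNReal.coe_le_coe.2 tsub_le_self) a1
    have b2 := h2 s.toNNReal (lt_of_le_of_lt (NNReal.coe_le_coe.2 hsh) a2) x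
    have b3 : C * (ε / (4 * (C + 1))) ≤ ε / 4 := by
      rw [← mul_div_assoc, div_le_div_iff₀ (by positivity) (by positivity)]
      nlinarith
    rw [hG]
    calc _ ≤ _ := abs_sub_le _ (semigroup P X s.toNNReal (fun y => c y * φ y) x) _
      _ ≤ _ := add_le_add b1 b2
      _ ≤ ε / 2 := by linarith
  have e4 : |(∫ s in (0 : ℝ)..h, G s) - h * (c x * φ x)| ≤ ε / 2 * h := by
    have h6 : (∫ s in (0 : ℝ)..h, G s) - h * (c x * φ x) =
        ∫ s in (0 : ℝ)..h, (G s - c x * φ x) := by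
      rw [intervalIntegral.integral_sub hGi intervalIntegrable_const,
        intervalIntegral.integral_const, sub_zero, smul_eq_mul]
    have h7 := intervalIntegral.norm_integral_le_of_norm_le_const (a := 0) (b := (h : ℝ))
      (f := fun s => G s - c x * φ x) (C := ε / 2) fun s hs => e3 s (by
        rwa [uIoc_of_le hh0.le] at hs)
    rw [h6]
    simpa [abs_of_pos hh0] using h7
  rw [dist_comm, Real.dist_eq, quotient_sub_fkQuotient,
    show (semigroup P X h φ x - fk P X c h φ x) / h - c x * φ x =
      ((semigroup P X h φ x - fk P X c h φ x) - h * (c x * φ x)) / h by field_simp,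
    abs_div, abs_of_pos hh0, div_lt_iff₀ hh0]
  rw [e2] at e1
  calc _ ≤ _ := abs_sub_le _ (∫ s in (0 : ℝ)..h, G s) _
    _ ≤ C ^ 2 * D * h * h + ε / 2 * h := add_le_add e1 e4
    _ < ε * h := by nlinarith

variable {g : ℝ → E → ℝ} {M : ℝ} {q : ℝ → ℝ}

lemma IsFkOrbit.inStrongDomain_avg (hg : IsFkOrbit P X c g M) (hX : IsMarkovFamily P X)
    (hc : IsRate c) (hB : ∀ φ, InB0 P X φ → InB0 P X (fun x => c x * φ x))
    (hq : Integrable q) (hqc : ContDiff ℝ 1 q) (hq' : Integrable (deriv q)) :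
    InStrongDomain P X (avg g q) := by
  have hB0 := hg.inB0_avg hX hc hqc.continuous.measurable hq
  refine ⟨hB0.1, ?_⟩
  have h1 := (hg.tendstoUniformly_fkQuotient_avg hX hc hq hqc hq').add
    (tendstoUniformly_quotient_sub_fkQuotient hX hc hB0 (hB _ hB0))
  have h2 : generator P X (avg g q) =
      (avg g fun u => -deriv q u) + fun x => c x * avg g q x := by
    ext x
    rw [hg.generator_avg hX hc hq hqc hq', Pi.add_apply, hg.avg_neg]
  have h3 : (fun h => quotient P X (avg g q) h) = (fun h => fkQuotient P X c (avg g q) h) +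
      fun h x => quotient P X (avg g q) h x - fkQuotient P X c (avg g q) h x := by
    ext h x
    simp
  rw [h2, h3]
  exact h1

end StrongDomain

/-! ### Iterated derivatives on open sets. -/

section Calculus

lemma hasDerivAt_iteratedDeriv_of_contDiffOn {F : ℝ → ℝ} {s : Set ℝ} (hs : IsOpen s) {i : ℕ}
    (hF : ContDiffOn ℝ (i + 1 : ℕ) F s) {t : ℝ} (ht : t ∈ s) :
    HasDerivAt (iteratedDeriv i F) (iteratedDeriv (i + 1) F t) t := by
  have h1 := hF.differentiableOn_iteratedDerivWithin (m := i) (by exact_mod_cast i.lt_succ_self)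
    hs.uniqueDiffOn
  have h2 := (h1.congr fun x hx => (iteratedDerivWithin_of_isOpen hs hx).symm).differentiableAt
    (hs.mem_nhds ht)
  rw [iteratedDeriv_succ]
  exact h2.hasDerivAt

lemma continuousOn_iteratedDeriv_of_contDiffOn {F : ℝ → ℝ} {s : Set ℝ} (hs : IsOpen s) {i : ℕ}
    (hF : ContDiffOn ℝ i F s) : ContinuousOn (iteratedDeriv i F) s :=
  (hF.continuousOn_iteratedDerivWithin (m := i) le_rfl hs.uniqueDiffOn).congr
    fun _ hx => (iteratedDerivWithin_of_isOpen hs hx).symm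

/-- A sequence of functions, each the derivative of its predecessor. -/
lemma iteratedDeriv_eq_of_hasDerivAt {B : ℕ → ℝ → ℝ} {s : Set ℝ} (hs : IsOpen s) {n : ℕ}
    (hB : ∀ i < n, ∀ t ∈ s, HasDerivAt (B i) (B (i + 1) t) t) :
    ∀ i ≤ n, ∀ t ∈ s, iteratedDeriv i (B 0) t = B i t := by
  intro i
  induction i with
  | zero => simp
  | succ i ih =>
    intro hi t ht
    have h1 : iteratedDeriv i (B 0) =ᶠ[𝓝 t] B i := by
      filter_upwards [hs.mem_nhds ht] with r hr using ih (by omega) r hr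
    rw [iteratedDeriv_succ, h1.deriv_eq]
    exact (hB i (by omega) t ht).deriv

lemma contDiffOn_of_hasDerivAt {s : Set ℝ} (hs : IsOpen s) {n : ℕ} {B : ℕ → ℝ → ℝ}
    (hB : ∀ i < n, ∀ t ∈ s, HasDerivAt (B i) (B (i + 1) t) t) (hn : ContinuousOn (B n) s) :
    ContDiffOn ℝ n (B 0) s := by
  induction n generalizing B with
  | zero => simpa using hn
  | succ n ih =>
    have h1 := ih (B := fun i => B (i + 1)) (fun i hi => hB (i + 1) (by omega)) hn
    have h2 : ContDiffOn ℝ ((n : WithTop ℕ∞) + 1) (B 0) s := by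
      rw [contDiffOn_succ_iff_deriv_of_isOpen hs]
      refine ⟨fun t ht => (hB 0 (by omega) t ht).differentiableAt.differentiableWithinAt,
        fun h => by simp at h, h1.congr fun t ht => (hB 0 (by omega) t ht).deriv⟩
    exact_mod_cast h2

end Calculus

/-! ### Differentiating integrals against the density. -/

section Density

variable {Q : MvPolynomial (Fin 2) ℝ} {p : ℝ → ℝ → ℝ}

lemma IsOrder.mono {i j i' j' : ℕ} (h : IsOrder Q i j) (hi : i' ≤ i) (hj : j' ≤ j) :
    IsOrder Q i' j' := by
  rcases h with ⟨h1, h2⟩ | ⟨m, hm, h1, h2⟩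
  · exact Or.inl ⟨hi.trans h1, by omega⟩
  · exact Or.inr ⟨m, hm, hi.trans h1, hj.trans h2⟩

lemma isOrder_one_zero : IsOrder Q 1 0 := Or.inl ⟨le_rfl, rfl⟩

lemma isOrder_of_mem {m : Fin 2 →₀ ℕ} (hm : m ∈ Q.support) : IsOrder Q (m 0) (m 1) :=
  Or.inr ⟨m, hm, le_rfl, le_rfl⟩

namespace IsRegularDensity

variable (hp : IsRegularDensity Q p)
include hp

lemma hasDerivAt_mixedDeriv {i j : ℕ} (h : IsOrder Q (i + 1) j) {t : ℝ} (ht : 0 < t) (u : ℝ) :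
    HasDerivAt (fun τ => mixedDeriv p i j τ u) (mixedDeriv p (i + 1) j t u) t :=
  hasDerivAt_iteratedDeriv_of_contDiffOn isOpen_Ioi (hp.time (i + 1) j h u) ht

lemma measurable_mixedDeriv {i j : ℕ} (h : IsOrder Q i j) {t : ℝ} (ht : 0 < t) :
    Measurable fun u => mixedDeriv p i j t u := by
  induction i generalizing t with
  | zero =>
    simp only [mixedDeriv, iteratedDeriv_zero]
    exact ((hp.space 0 j h t ht).continuous_iteratedDeriv j le_rfl).measurable
  | succ i ih =>
    have hi := h.mono i.le_succ le_rfl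
    -- Measurability is demanded for every index `δ`, not only small positive ones; `max δ 0` keeps
    -- the time positive throughout.
    refine measurable_of_tendsto_metrizable' (𝓝[>] (0 : ℝ))
      (f := fun (δ : ℝ) u => (max δ 0)⁻¹ *
        (mixedDeriv p i j (t + max δ 0) u - mixedDeriv p i j t u)) (fun δ => ?_) ?_
    · exact ((ih hi (by positivity)).sub (ih hi ht)).const_mul _
    · refine tendsto_pi_nhds.2 fun u => ?_
      have h1 := (hp.hasDerivAt_mixedDeriv h ht u).tendsto_slope_zero_right
      refine h1.congr' ?_
      filter_upwards [self_mem_nhdsWithin] with δ hδ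
      rw [max_eq_left (le_of_lt hδ), smul_eq_mul]

lemma integrable_mixedDeriv {i j : ℕ} (h : IsOrder Q i j) {t : ℝ} (ht : 0 < t) :
    Integrable fun u => mixedDeriv p i j t u := by
  obtain ⟨b, hb, h1⟩ := hp.dominated i j h t ht
  exact hb.mono' (hp.measurable_mixedDeriv h ht).aestronglyMeasurable (.of_forall h1.self_of_nhds)

lemma hasDerivAt_integral {i j : ℕ} (h : IsOrder Q (i + 1) j) {G : ℝ → ℝ} (hG : Continuous G)
    {M : ℝ} (hM : ∀ u, |G u| ≤ M) {t : ℝ} (ht : 0 < t) :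
    HasDerivAt (fun τ => ∫ u, mixedDeriv p i j τ u * G u)
      (∫ u, mixedDeriv p (i + 1) j t u * G u) t := by
  obtain ⟨b, hb, h1⟩ := hp.dominated (i + 1) j h t ht
  have hi := h.mono i.le_succ le_rfl
  have hm : ∀ {i}, IsOrder Q i j → ∀ τ, 0 < τ →
      AEStronglyMeasurable (fun u => mixedDeriv p i j τ u * G u) volume := fun hi τ hτ =>
    ((hp.measurable_mixedDeriv hi hτ).mul hG.measurable).aestronglyMeasurable
  refine (hasDerivAt_integral_of_dominated_loc_of_deriv_le (bound := fun u => b u * M)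
    (F' := fun τ u => mixedDeriv p (i + 1) j τ u * G u)
    (h1.and (Ioi_mem_nhds ht)) ?_ ?_ (hm h t ht) (.of_forall fun u τ hτ => ?_)
    (hb.mul_const M) (.of_forall fun u τ hτ => ?_)).2
  · filter_upwards [Ioi_mem_nhds ht] with τ hτ using hm hi τ hτ
  · exact (hp.integrable_mixedDeriv hi ht).mul_bdd hG.aestronglyMeasurable (.of_forall hM)
  · rw [norm_mul]
    exact mul_le_mul (hτ.1 u) (hM u) (norm_nonneg _) ((abs_nonneg _).trans (hτ.1 u))
  · exact (hp.hasDerivAt_mixedDeriv h hτ.2 u).mul_const _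

lemma continuousOn_integral {i j : ℕ} (h : IsOrder Q i j) {G : ℝ → ℝ} (hG : Continuous G)
    {M : ℝ} (hM : ∀ u, |G u| ≤ M) :
    ContinuousOn (fun τ => ∫ u, mixedDeriv p i j τ u * G u) (Set.Ioi 0) := by
  intro t ht
  refine ContinuousAt.continuousWithinAt ?_
  obtain ⟨b, hb, h1⟩ := hp.dominated i j h t ht
  refine continuousAt_of_dominated (bound := fun u => b u * M) ?_ ?_ (hb.mul_const M)
    (.of_forall fun u => ?_)
  · filter_upwards [Ioi_mem_nhds ht] with τ hτ using
      ((hp.measurable_mixedDeriv h hτ).mul hG.measurable).aestronglyMeasurable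
  · filter_upwards [h1] with τ hτ
    refine .of_forall fun u => ?_
    rw [norm_mul]
    exact mul_le_mul (hτ u) (hM u) (norm_nonneg _) ((abs_nonneg _).trans (hτ u))
  · exact ((continuousOn_iteratedDeriv_of_contDiffOn isOpen_Ioi (hp.time i j h u)).continuousAt
      (Ioi_mem_nhds ht)).mul continuousAt_const

end IsRegularDensity

end Density

/-! ### The transformed evolution equation. -/

section Evolution

variable {Ω E : Type*} [MeasurableSpace Ω] [TopologicalSpace E] [PolishSpace E]
  [MeasurableSpace E] [BorelSpace E] [Nonempty E]
  {P : Measure Ω} [IsProbabilityMeasure P] {X : E → ℝ≥0 → Ω → E} {c : E → ℝ}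
  {g : ℝ → E → ℝ} {M : ℝ} {q : ℝ → ℝ}
  {Q : MvPolynomial (Fin 2) ℝ} {p : ℝ → ℝ → ℝ}

lemma avg_const_mul (a : ℝ) (q : ℝ → ℝ) (x : E) :
    avg g (fun u => a * q u) x = a * avg g q x := by
  simp only [avg, mul_assoc, integral_const_mul]

lemma contDiff_one_iteratedDeriv {i : ℕ} (hq : ContDiff ℝ (i + 1 : ℕ) q) :
    ContDiff ℝ 1 (iteratedDeriv i q) := by
  rw [iteratedDeriv_eq_iterate]
  rw [add_comm] at hq
  exact_mod_cast ContDiff.iterate_deriv' 1 i hq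

/-- Regularity of a function together with the integrability of its derivatives. -/
structure IsIntegrableDiff (q : ℝ → ℝ) (k : ℕ) : Prop where
  contDiff : ContDiff ℝ k q
  integrable : ∀ i ≤ k, Integrable (iteratedDeriv i q)

namespace IsIntegrableDiff

variable {k : ℕ} (hq : IsIntegrableDiff q k)
include hq

/-- Carrying the sign inside the weight makes each application of the killed generator one further
application of the rule that sends `q` to `-q'`. -/
lemma signed {i : ℕ} (hi : i < k) :
    Integrable (fun u => (-1) ^ i * iteratedDeriv i q u) ∧
    ContDiff ℝ 1 (fun u => (-1) ^ i * iteratedDeriv i q u) ∧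
    Integrable (deriv fun u => (-1) ^ i * iteratedDeriv i q u) ∧
    (fun u => -deriv (fun u => (-1) ^ i * iteratedDeriv i q u) u) =
      fun u => (-1) ^ (i + 1) * iteratedDeriv (i + 1) q u := by
  have h1 : ContDiff ℝ 1 (iteratedDeriv i q) :=
    contDiff_one_iteratedDeriv (hq.contDiff.of_le (by exact_mod_cast hi))
  have h2 : (deriv fun u => (-1) ^ i * iteratedDeriv i q u) =
      fun u => (-1) ^ i * iteratedDeriv (i + 1) q u := by
    ext u
    rw [deriv_const_mul _ (h1.differentiable one_ne_zero u), iteratedDeriv_succ]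
  refine ⟨(hq.integrable i hi.le).const_mul _, contDiff_const.mul h1, ?_, ?_⟩
  · rw [h2]
    exact (hq.integrable (i + 1) hi).const_mul _
  · rw [h2]
    ext u
    ring

lemma killedGenerator_iterate (hg : IsFkOrbit P X c g M) (hX : IsMarkovFamily P X)
    (hc : IsRate c) {i : ℕ} (hi : i ≤ k) :
    (killedGenerator P X c)^[i] (avg g q) = avg g fun u => (-1) ^ i * iteratedDeriv i q u := by
  induction i with
  | zero => simp
  | succ i ih =>
    obtain ⟨h1, h2, h3, h4⟩ := hq.signed hi
    rw [Function.iterate_succ_apply', ih (by omega), hg.killedGenerator_avg hX hc h1 h2 h3, h4]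

lemma inKilledDomainPow (hg : IsFkOrbit P X c g M) (hX : IsMarkovFamily P X) (hc : IsRate c) :
    InKilledDomainPow P X c k (avg g q) := by
  intro i hi
  obtain ⟨h1, h2, h3, h4⟩ := hq.signed hi
  rw [hq.killedGenerator_iterate hg hX hc hi.le]
  exact hg.inDomain_avg hX hc h1 h2 h3

lemma inStrongKilledDomainPow (hg : IsFkOrbit P X c g M) (hX : IsMarkovFamily P X)
    (hc : IsRate c) (hB : ∀ φ, InB0 P X φ → InB0 P X (fun x => c x * φ x)) :
    InStrongKilledDomainPow P X c k (avg g q) := by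
  intro i hi
  obtain ⟨h1, h2, h3, h4⟩ := hq.signed hi
  rw [hq.killedGenerator_iterate hg hX hc hi.le]
  exact hg.inStrongDomain_avg hX hc hB h1 h2 h3

end IsIntegrableDiff

lemma IsRegularDensity.isIntegrableDiff (hp : IsRegularDensity Q p) {i j : ℕ}
    (h : IsOrder Q i j) {t : ℝ} (ht : 0 < t) : IsIntegrableDiff (p t) j := by
  refine ⟨hp.space i j h t ht, fun k hk => ?_⟩
  simpa [mixedDeriv] using hp.integrable_mixedDeriv (h.mono (Nat.zero_le i) hk) ht

variable {ν : ℝ → E → ℝ}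

lemma killedGenerator_iterate_density (hg : IsFkOrbit P X c g M) (hX : IsMarkovFamily P X)
    (hc : IsRate c) (hp : IsRegularDensity Q p) (hν : ∀ t, 0 < t → ν t = avg g (p t)) {i j : ℕ}
    (h : IsOrder Q i j) {t : ℝ} (ht : 0 < t) (x : E) :
    (killedGenerator P X c)^[j] (ν t) x = (-1) ^ j * ∫ u, mixedDeriv p 0 j t u * g u x := by
  rw [hν t ht, (hp.isIntegrableDiff h ht).killedGenerator_iterate hg hX hc le_rfl, avg_const_mul]
  simp [avg, mixedDeriv]

/-- Only the density depends on time, so time derivatives fall on it under the integral; the orbit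
is a fixed bounded continuous factor. -/
lemma contDiffOn_killedGenerator_iterate (hg : IsFkOrbit P X c g M) (hX : IsMarkovFamily P X)
    (hc : IsRate c) (hp : IsRegularDensity Q p) (hν : ∀ t, 0 < t → ν t = avg g (p t)) {i j : ℕ}
    (h : IsOrder Q i j) (x : E) :
    ContDiffOn ℝ i (fun τ => (killedGenerator P X c)^[j] (ν τ) x) (Set.Ioi 0) ∧
    ∀ t, 0 < t → iteratedDeriv i (fun τ => (killedGenerator P X c)^[j] (ν τ) x) t =
      (-1) ^ j * ∫ u, mixedDeriv p i j t u * g u x := by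
  let B : ℕ → ℝ → ℝ := fun k τ => (-1) ^ j * ∫ u, mixedDeriv p k j τ u * g u x
  have hB : ∀ k < i, ∀ t ∈ Set.Ioi (0 : ℝ), HasDerivAt (B k) (B (k + 1) t) t := fun k hk t ht =>
    (hp.hasDerivAt_integral (h.mono hk le_rfl) (hg.continuous x) (fun u => hg.abs_le u x)
      ht).const_mul _
  have hn : ContinuousOn (B i) (Set.Ioi 0) :=
    continuousOn_const.mul (hp.continuousOn_integral h (hg.continuous x) fun u => hg.abs_le u x)
  have e : ∀ τ ∈ Set.Ioi (0 : ℝ), (killedGenerator P X c)^[j] (ν τ) x = B 0 τ := fun τ hτ =>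
    killedGenerator_iterate_density hg hX hc hp hν h hτ x
  refine ⟨(contDiffOn_of_hasDerivAt isOpen_Ioi hB hn).congr e, fun t ht => ?_⟩
  refine Eq.trans ?_ (iteratedDeriv_eq_of_hasDerivAt isOpen_Ioi hB i le_rfl t ht)
  refine Filter.EventuallyEq.iteratedDeriv_eq i ?_
  filter_upwards [Ioi_mem_nhds ht] with τ hτ using e τ hτ

/-- The averages of an orbit against the density solve the transformed equation. -/
lemma hasDerivAt_of_density (hg : IsFkOrbit P X c g M) (hX : IsMarkovFamily P X)
    (hc : IsRate c) (hp : IsRegularDensity Q p) (hν : ∀ t, 0 < t → ν t = avg g (p t))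
    (hpde : ∀ t > 0, ∀ u, deriv (fun τ => p τ u) t =
      ∑ m ∈ Q.support, Q.coeff m * mixedDeriv p (m 0) (m 1) t u) {t : ℝ} (ht : 0 < t) (x : E) :
    HasDerivAt (fun τ => ν τ x)
      (∑ m ∈ Q.support, Q.coeff m * (-1) ^ (m 1) *
        iteratedDeriv (m 0) (fun τ => (killedGenerator P X c)^[m 1] (ν τ) x) t) t := by
  have h1 := hp.hasDerivAt_integral (i := 0) isOrder_one_zero (hg.continuous x)
    (fun u => hg.abs_le u x) ht
  have h2 : (fun τ => ν τ x) =ᶠ[𝓝 t] fun τ => ∫ u, mixedDeriv p 0 0 τ u * g u x := by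
    filter_upwards [Ioi_mem_nhds ht] with τ hτ
    simp [hν τ hτ, avg, mixedDeriv]
  refine (h1.congr_of_eventuallyEq h2).congr_deriv ?_
  have h3 : ∀ u, mixedDeriv p (0 + 1) 0 t u * g u x =
      ∑ m ∈ Q.support, Q.coeff m * (mixedDeriv p (m 0) (m 1) t u * g u x) := by
    intro u
    have h4 : mixedDeriv p (0 + 1) 0 t u = deriv (fun τ => p τ u) t := by
      simp [mixedDeriv, iteratedDeriv_one]
    rw [h4, hpde t ht u, Finset.sum_mul]
    simp only [mul_assoc]
  simp only [h3]
  rw [integral_finsetSum]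
  · refine Finset.sum_congr rfl fun m hm => ?_
    -- The sign in the equation and the sign produced by the iterated generator multiply to one.
    rw [(contDiffOn_killedGenerator_iterate hg hX hc hp hν (isOrder_of_mem hm) x).2 t ht,
      integral_const_mul, mul_assoc, ← mul_assoc ((-1 : ℝ) ^ (m 1)), ← mul_pow]
    simp
  · intro m hm
    exact (hg.integrable_mul (hp.integrable_mixedDeriv (isOrder_of_mem hm) ht) x).const_mul _

end Evolution

/-! ### The killed functional in terms of the orbit. -/

section Representation

variable {Ω E F : Type*} [MeasurableSpace Ω] [TopologicalSpace E] [PolishSpace E]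
  [MeasurableSpace E] [BorelSpace E] [Nonempty E] [TopologicalSpace F] [PolishSpace F]
  [MeasurableSpace F] [BorelSpace F] [Zero F]
  {P : Measure Ω} [IsProbabilityMeasure P]
  {X : E → ℝ≥0 → Ω → E} {Xm : F → ℝ≥0 → Ω → F} {c : E → ℝ} {cm : F → ℝ} {ft : E × F → ℝ}

lemma abs_regWeight_le_one (hc : IsRate c) (w : ℝ≥0 → E) {u : ℝ} (hu : 0 ≤ u) :
    |regWeight c w u| ≤ 1 := by
  rw [regWeight, Real.abs_exp, Real.exp_le_one_iff, neg_nonpos]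
  exact intervalIntegral.integral_nonneg_of_forall hu fun _ => hc.nonneg _

lemma integral_comp_of_indepFun {Z : Ω → ℝ≥0 → E} {T : Ω → ℝ} (hT : Measurable T)
    (hZ : Measurable Z) (hTZ : IndepFun T Z P) {Φ : ℝ × (ℝ≥0 → E) → ℝ} (hΦ : Measurable Φ)
    {C : ℝ} (hC : ∀ z, |Φ z| ≤ C) :
    ∫ ω, Φ (T ω, Z ω) ∂P = ∫ ω, ∫ ω', Φ (T ω, Z ω') ∂P ∂P := by
  have h1 : Measurable fun ω => (T ω, Z ω) := hT.prodMk hZ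
  have h2 := (indepFun_iff_map_prod_eq_prod_map_map hT.aemeasurable hZ.aemeasurable).1 hTZ
  have := Measure.isProbabilityMeasure_map (μ := P) hT.aemeasurable
  have := Measure.isProbabilityMeasure_map (μ := P) hZ.aemeasurable
  rw [← integral_map (φ := fun ω => (T ω, Z ω)) h1.aemeasurable hΦ.aestronglyMeasurable, h2,
    integral_prod _ (Integrable.of_bound hΦ.aestronglyMeasurable C (.of_forall hC)),
    integral_map hT.aemeasurable]
  · refine integral_congr_ae (.of_forall fun ω => ?_)
    exact integral_map hZ.aemeasurable
      (hΦ.comp (measurable_const.prodMk measurable_id)).aestronglyMeasurable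
  · exact (StronglyMeasurable.integral_prod_right'
      hΦ.stronglyMeasurable).aestronglyMeasurable

/-- The functional of the time and of the path of the killed process after a non-negative time;
zero for negative times. -/
def killedPath (c : E → ℝ) (φ : E → ℝ) (z : ℝ × (ℝ≥0 → E)) : ℝ :=
  (Set.Ici (0 : ℝ)).indicator (fun u => regWeight c z.2 u * φ (regPath z.2 u)) z.1

lemma measurable_killedPath (hc : Measurable c) {φ : E → ℝ} (hφ : Measurable φ) :
    Measurable (killedPath c φ) := by
  have h0 : Measurable fun z : ℝ × (ℝ≥0 → E) => (z.2, z.1) := measurable_swap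
  have h1 := (measurable_regWeight (E := E) hc).comp h0
  have h2 := hφ.comp ((measurable_regPath (E := E)).comp h0)
  have h3 := (h1.mul h2).indicator (measurable_fst (measurableSet_Ici (a := (0 : ℝ))))
  convert h3 using 1
  ext z
  simp [killedPath, Set.indicator]

lemma abs_killedPath_le (hc : IsRate c) {φ : E → ℝ} {C : ℝ} (hC0 : 0 ≤ C) (hC : ∀ x, |φ x| ≤ C)
    (z : ℝ × (ℝ≥0 → E)) : |killedPath c φ z| ≤ C := by
  by_cases h : 0 ≤ z.1
  · rw [killedPath, Set.indicator_of_mem (Set.mem_Ici.2 h)]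
    exact abs_mul_le_of_abs_le_one (abs_regWeight_le_one hc _ h) (hC _)
  · rw [killedPath, Set.indicator_of_notMem (by simpa using h), abs_zero]
    exact hC0

lemma integral_killedPath (hX : IsMarkovFamily P X) (x : E) (φ : E → ℝ) (u : ℝ) :
    ∫ ω, killedPath c φ (u, fun s => X x s ω) ∂P =
      (Set.Ici (0 : ℝ)).indicator (fun u => fk P X c u.toNNReal φ x) u := by
  by_cases h : 0 ≤ u
  · simp only [killedPath, Set.indicator_of_mem (Set.mem_Ici.2 h)]
    rw [fk_eq_integral_reg hX, Real.coe_toNNReal _ h]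
  · simp only [killedPath, Set.indicator_of_notMem (show u ∉ Set.Ici (0 : ℝ) by simpa using h),
      integral_zero]

/-- The zero set of the path is a null set. -/
lemma ae_volume_zeroSet
    (hzero : ∀ t : ℝ, 0 < t → ∀ᵐ ω ∂P,
      volume {s : ℝ | s ∈ Set.Icc 0 t ∧ Xm 0 s.toNNReal ω = 0} = 0) :
    ∀ᵐ ω ∂P, ∀ᵐ s : ℝ, 0 ≤ s → Xm 0 s.toNNReal ω ≠ 0 := by
  have h1 : ∀ᵐ ω ∂P, ∀ n : ℕ,
      volume {s : ℝ | s ∈ Set.Icc 0 ((n : ℝ) + 1) ∧ Xm 0 s.toNNReal ω = 0} = 0 :=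
    ae_all_iff.2 fun n => hzero _ (by positivity)
  filter_upwards [h1] with ω hω
  have h2 := measure_iUnion_null hω
  rw [ae_iff]
  refine measure_mono_null (fun s hs => ?_) h2
  simp only [Set.mem_ofPred_eq, Classical.not_imp, not_not] at hs
  obtain ⟨n, hn⟩ := exists_nat_ge s
  exact Set.mem_iUnion.2 ⟨n, ⟨hs.1, by linarith⟩, hs.2⟩

lemma killedFunctional_of_nonneg {Y : ℝ≥0 → Ω → ℝ} {t : ℝ} {x : E} {ω : Ω}
    (hω : IsRightCts fun s => X x s ω) (hY : 0 ≤ Y t.toNNReal ω) :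
    killedFunctional X Xm Y c cm ft t x ω =
      killedPath c (fun x' => ft (x', 0)) (Y t.toNNReal ω, fun s => X x s ω) := by
  rw [killedPath, Set.indicator_of_mem (Set.mem_Ici.2 hY), killedFunctional, regWeight]
  congr 1
  · congr 2
    refine intervalIntegral.integral_congr fun s hs => ?_
    rw [uIcc_of_le hY] at hs
    simp [killingRate, twoSided, hs.1, regPath_eq hω]
  · simp [twoSided, hY, regPath_eq hω]

lemma killedFunctional_of_neg {Y : ℝ≥0 → Ω → ℝ} {t : ℝ} {x : E} {ω : Ω}
    (hω : IsRightCts fun s => Xm 0 s ω)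
    (hzero : ∀ᵐ s : ℝ, 0 ≤ s → Xm 0 s.toNNReal ω ≠ 0) (hY : Y t.toNNReal ω < 0) :
    killedFunctional X Xm Y c cm ft t x ω =
      killedPath cm (fun y' => ft (x, y')) (-Y t.toNNReal ω, fun s => Xm 0 s ω) := by
  rw [killedPath, Set.indicator_of_mem (Set.mem_Ici.2 (by linarith)), killedFunctional, regWeight]
  congr 1
  · congr 1
    have h1 := intervalIntegral.integral_comp_neg (a := 0) (b := -Y t.toNNReal ω)
      (fun s => killingRate c cm (twoSided X Xm (x, 0) s ω))
    rw [neg_neg, neg_zero] at h1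
    rw [intervalIntegral.integral_symm, ← h1, neg_neg, ← intervalIntegral.integral_neg]
    refine intervalIntegral.integral_congr_ae ?_
    filter_upwards [hzero] with s hs hmem
    rw [uIoc_of_le (by linarith)] at hmem
    have h2 : ¬ 0 ≤ -s := by linarith [hmem.1]
    simp [killingRate, twoSided, h2, hs hmem.1.le, regPath_eq hω]
  · simp [twoSided, not_le.2 hY, regPath_eq hω]

/-- Integrability of the killed functional, and its expectation in terms of the orbit. -/
lemma integrable_killedFunctional (hX : IsMarkovFamily P X) (hc : IsRate c)
    (hXm : IsMarkovFamily P Xm) (hcm : IsRate cm) {Y : ℝ≥0 → Ω → ℝ}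
    (hYmeas : ∀ t, Measurable (Y t))
    (hYX : ∀ x, IndepFun (fun ω t => Y t ω) (fun ω t => X x t ω) P)
    (hYXm : ∀ y, IndepFun (fun ω t => Y t ω) (fun ω t => Xm y t ω) P)
    (hzero : ∀ t : ℝ, 0 < t → ∀ᵐ ω ∂P,
      volume {s : ℝ | s ∈ Set.Icc 0 t ∧ Xm 0 s.toNNReal ω = 0} = 0)
    (hft : Measurable ft) {C : ℝ} (hC : ∀ z, |ft z| ≤ C) (t : ℝ) (x : E) :
    Integrable (killedFunctional X Xm Y c cm ft t x) P ∧
    killedValue P X Xm Y c cm ft t x =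
      ∫ ω, orbit P X Xm c cm ft 0 (Y t.toNNReal ω) x ∂P := by
  set T := Y t.toNNReal
  have hC0 : 0 ≤ C := (abs_nonneg _).trans (hC (x, 0))
  have hm1 : Measurable fun x' : E => ft (x', (0 : F)) := hft.comp (by fun_prop)
  have hm2 : Measurable fun y' : F => ft (x, y') := hft.comp (by fun_prop)
  have k1 := measurable_killedPath hc.continuous.measurable hm1
  have k2 := measurable_killedPath hcm.continuous.measurable hm2
  have b1 := abs_killedPath_le hc hC0 fun x' : E => hC (x', (0 : F))
  have b2 := abs_killedPath_le hcm hC0 fun y' : F => hC (x, y')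
  -- The time process is independent of each position process separately. The functional is
  -- therefore split into two terms, each involving one position process only; the strict inequality
  -- keeps time zero from being counted twice.
  set Ψ : ℝ × (ℝ≥0 → F) → ℝ := fun z => (Set.Iio (0 : ℝ)).indicator
    (fun u => killedPath cm (fun y' => ft (x, y')) (-u, z.2)) z.1 with hΨ
  have hneg : Measurable fun z : ℝ × (ℝ≥0 → F) => (-z.1, z.2) := by fun_prop
  have k3 : Measurable Ψ := by
    have h1 := (k2.comp hneg).indicator (measurable_fst (measurableSet_Iio (a := (0 : ℝ))))
    convert h1 using 1
    ext z
    simp [hΨ, Set.indicator]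
  have b3 : ∀ z, |Ψ z| ≤ C := fun z => by
    by_cases h : z.1 < 0
    · simp only [hΨ, Set.indicator_of_mem (Set.mem_Iio.2 h)]
      exact b2 _
    · simp only [hΨ, Set.indicator_of_notMem (show z.1 ∉ Set.Iio (0 : ℝ) by simpa using h),
        abs_zero]
      exact hC0
  have hae : killedFunctional X Xm Y c cm ft t x =ᵐ[P] fun ω =>
      killedPath c (fun x' => ft (x', 0)) (T ω, fun s => X x s ω) +
        Ψ (T ω, fun s => Xm 0 s ω) := by
    filter_upwards [isRightCts_ae hX x, isRightCts_ae hXm 0, ae_volume_zeroSet hzero]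
      with ω h1 h2 h3
    rcases le_or_gt 0 (T ω) with h | h
    · have h4 : Ψ (T ω, fun s => Xm 0 s ω) = 0 :=
        Set.indicator_of_notMem (show T ω ∉ Set.Iio (0 : ℝ) by simpa using h) _
      rw [killedFunctional_of_nonneg h1 h, h4, add_zero]
    · have h4 : Ψ (T ω, fun s => Xm 0 s ω) =
          killedPath cm (fun y' => ft (x, y')) (-T ω, fun s => Xm 0 s ω) :=
        Set.indicator_of_mem (Set.mem_Iio.2 h) _
      have h5 : killedPath c (fun x' => ft (x', 0)) (T ω, fun s => X x s ω) = 0 :=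
        Set.indicator_of_notMem (show T ω ∉ Set.Ici (0 : ℝ) by simpa using h) _
      rw [killedFunctional_of_neg h2 h3 h, h4, h5, zero_add]
  have hTm : Measurable T := hYmeas _
  have p1 := measurable_path hX x
  have p2 := measurable_path hXm (0 : F)
  have i1 : Integrable (fun ω => killedPath c (fun x' => ft (x', 0)) (T ω, fun s => X x s ω)) P :=
    integrable_of_bdd (k1.comp (hTm.prodMk p1)) fun ω => b1 _
  have i2 : Integrable (fun ω => Ψ (T ω, fun s => Xm 0 s ω)) P :=
    integrable_of_bdd (k3.comp (hTm.prodMk p2)) fun ω => b3 _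
  have j1 : IndepFun T (fun ω s => X x s ω) P :=
    (hYX x).comp (measurable_pi_apply t.toNNReal) measurable_id
  have j2 : IndepFun T (fun ω s => Xm 0 s ω) P :=
    (hYXm 0).comp (measurable_pi_apply t.toNNReal) measurable_id
  refine ⟨(i1.add i2).congr hae.symm, ?_⟩
  rw [killedValue, integral_congr_ae hae, integral_add i1 i2,
    integral_comp_of_indepFun hTm p1 j1 k1 b1, integral_comp_of_indepFun hTm p2 j2 k3 b3,
    ← integral_add]
  · refine integral_congr_ae (.of_forall fun ω => ?_)
    simp only
    rw [integral_killedPath hX]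
    rcases le_or_gt 0 (T ω) with h | h
    · rw [orbit_of_nonneg hXm 0 h, Set.indicator_of_mem (Set.mem_Ici.2 h)]
      simp only [hΨ, Set.indicator_of_notMem (show T ω ∉ Set.Iio (0 : ℝ) by simpa using h),
        integral_zero, add_zero]
    · rw [orbit_of_nonpos hX 0 h.le, Set.indicator_of_notMem (by simpa using h), zero_add]
      simp only [hΨ, Set.indicator_of_mem (Set.mem_Iio.2 h)]
      rw [integral_killedPath hXm, Set.indicator_of_mem (Set.mem_Ici.2 (by linarith))]
  · have q1 : Measurable fun z : Ω × Ω =>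
        killedPath c (fun x' => ft (x', 0)) (T z.1, fun s => X x s z.2) :=
      k1.comp ((hTm.comp measurable_fst).prodMk (p1.comp measurable_snd))
    exact integrable_of_bdd
      (StronglyMeasurable.integral_prod_right' (ν := P) q1.stronglyMeasurable).measurable
      fun ω => abs_integral_le_of_forall_abs_le fun ω' => b1 _
  · have q2 : Measurable fun z : Ω × Ω => Ψ (T z.1, fun s => Xm 0 s z.2) :=
      k3.comp ((hTm.comp measurable_fst).prodMk (p2.comp measurable_snd))
    exact integrable_of_bdd
      (StronglyMeasurable.integral_prod_right' (ν := P) q2.stronglyMeasurable).measurable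
      fun ω => abs_integral_le_of_forall_abs_le fun ω' => b3 _

lemma integral_comp_eq_of_density {T : Ω → ℝ} (hT : Measurable T) {q : ℝ → ℝ} (hq : Measurable q)
    (hq0 : ∀ u, 0 ≤ q u)
    (hTq : P.map T = volume.withDensity fun u => ENNReal.ofReal (q u)) {G : ℝ → ℝ}
    (hG : Measurable G) : ∫ ω, G (T ω) ∂P = ∫ u, q u * G u := by
  rw [← integral_map hT.aemeasurable hG.aestronglyMeasurable, hTq,
    integral_withDensity_eq_integral_toReal_smul hq.ennreal_ofReal
      (.of_forall fun _ => ENNReal.ofReal_lt_top)]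
  simp_rw [ENNReal.toReal_ofReal (hq0 _), smul_eq_mul]

lemma isFkOrbit_orbit (hX : IsMarkovFamily P X) (hc : IsRate c) (hXm : IsMarkovFamily P Xm)
    (hcm : IsRate cm) (H : IsHarmonicExtension P X Xm c cm ft) {C : ℝ} (hC : ∀ z, |ft z| ≤ C) :
    IsFkOrbit P X c (orbit P X Xm c cm ft 0) C where
  measurable := measurable_orbit hX hc hXm hcm H 0
  continuous := continuous_orbit hX hc hXm hcm H 0
  abs_le := abs_orbit_le hc hcm hC 0
  fk_eq := fk_orbit hX hc hXm hcm H 0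

end Representation

end

end IteratedTime

/-! ### Assembly of the theorem. -/

theorem mainTheorem10
    {Ω : Type*} [MeasurableSpace Ω] (P : Measure Ω) [IsProbabilityMeasure P]
    (d n : ℕ)
    -- the two position processes
    (Xp : EuclideanSpace ℝ (Fin d) → ℝ≥0 → Ω → EuclideanSpace ℝ (Fin d))
    (Xm : EuclideanSpace ℝ (Fin n) → ℝ≥0 → Ω → EuclideanSpace ℝ (Fin n))
    (hXp : IteratedTime.IsMarkovFamily P Xp)
    (hXm : IteratedTime.IsMarkovFamily P Xm)
    -- the time process: continuous, started at 0, independent of the position processes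
    (Y : ℝ≥0 → Ω → ℝ)
    (hYmeas : ∀ t, Measurable (Y t))
    (hYcont : ∀ᵐ ω ∂P, Continuous fun t => Y t ω)
    (hY0 : ∀ᵐ ω ∂P, Y 0 ω = 0)
    (hYXp : ∀ x, IndepFun (fun ω t => Y t ω) (fun ω t => Xp x t ω) P)
    (hYXm : ∀ y, IndepFun (fun ω t => Y t ω) (fun ω t => Xm y t ω) P)
    -- its density `p` and the equation `∂_t p = Q(∂_t, ∂_u) p`
    (p : ℝ → ℝ → ℝ)
    (hp_nonneg : ∀ t > 0, ∀ u, 0 ≤ p t u)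
    (hp : ∀ t : ℝ≥0, 0 < t →
      P.map (Y t) = volume.withDensity fun u => ENNReal.ofReal (p t u))
    (Q : MvPolynomial (Fin 2) ℝ)
    (hp_reg : IteratedTime.IsRegularDensity Q p)
    (hp_pde : ∀ t > 0, ∀ u, deriv (fun τ => p τ u) t =
      ∑ m ∈ Q.support, Q.coeff m * IteratedTime.mixedDeriv p (m 0) (m 1) t u)
    -- the zero set of `X₋` started at 0 is Lebesgue-null
    (hzero : ∀ t : ℝ, 0 < t → ∀ᵐ ω ∂P,
      volume {s : ℝ | s ∈ Set.Icc 0 t ∧ Xm 0 s.toNNReal ω = 0} = 0)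
    -- the killing rates
    (cp : EuclideanSpace ℝ (Fin d) → ℝ) (cm : EuclideanSpace ℝ (Fin n) → ℝ)
    (hcp_cont : Continuous cp) (hcp_nonneg : ∀ x, 0 ≤ cp x) (hcp_bdd : ∃ C, ∀ x, cp x ≤ C)
    (hcm_cont : Continuous cm) (hcm_nonneg : ∀ y, 0 ≤ cm y) (hcm_bdd : ∃ C, ∀ y, cm y ≤ C)
    -- the initial value and its extension
    (f : EuclideanSpace ℝ (Fin d) → ℝ)
    (ftilde : EuclideanSpace ℝ (Fin d) × EuclideanSpace ℝ (Fin n) → ℝ)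
    (hf_meas : Measurable ftilde)
    (hf_bdd : ∃ C, ∀ z, |ftilde z| ≤ C)
    (hf_ext : ∀ x, ftilde (x, 0) = f x)
    (hf_domp : ∀ y, IteratedTime.InDomain P Xp (fun x => ftilde (x, y)))
    (hf_domm : ∀ x, IteratedTime.InDomain P Xm (fun y => ftilde (x, y)))
    (hf_gen_bdd : ∃ C, ∀ x y,
      |IteratedTime.generator P Xp (fun x' => ftilde (x', y)) x| ≤ C)
    (hf_eq : ∀ x y,
      (IteratedTime.generator P Xp (fun x' => ftilde (x', y)) x - cp x * ftilde (x, y)) +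
      (IteratedTime.generator P Xm (fun y' => ftilde (x, y')) y - cm y * ftilde (x, y))
        = 0)
    (ν : ℝ → EuclideanSpace ℝ (Fin d) → ℝ)
    (hν : ν = IteratedTime.killedValue P Xp Xm Y cp cm ftilde) :
    -- `ν` is well defined
    (∀ t, 0 ≤ t → ∀ x,
      Integrable (IteratedTime.killedFunctional Xp Xm Y cp cm ftilde t x) P) ∧
    -- every term of `Q(∂_t, -(L₊ - c₊)) ν` makes sense
    (∀ m ∈ Q.support,
      (∀ t > 0, IteratedTime.InKilledDomainPow P Xp cp (m 1) (ν t)) ∧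
      ∀ x, ContDiffOn ℝ (m 0)
        (fun τ => (IteratedTime.killedGenerator P Xp cp)^[m 1] (ν τ) x) (Set.Ioi 0)) ∧
    -- also in the uniform norm, if multiplication by `c₊` preserves `B₀`
    ((∀ φ, IteratedTime.InB0 P Xp φ → IteratedTime.InB0 P Xp (fun x => cp x * φ x)) →
      ∀ m ∈ Q.support, ∀ t > 0,
        IteratedTime.InStrongKilledDomainPow P Xp cp (m 1) (ν t)) ∧
    -- the equation `∂_t ν = Q(∂_t, -(L₊ - c₊)) ν`
    (∀ t > 0, ∀ x, HasDerivAt (fun τ => ν τ x)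
      (∑ m ∈ Q.support, Q.coeff m * (-1) ^ (m 1) *
        iteratedDeriv (m 0)
          (fun τ => (IteratedTime.killedGenerator P Xp cp)^[m 1] (ν τ) x) t) t) ∧
    -- the initial condition, which is attained continuously
    (∀ x, ν 0 x = f x ∧ Tendsto (fun t => ν t x) (𝓝[>] 0) (𝓝 (f x))) := by
  subst hν
  have hc : IteratedTime.IsRate cp := ⟨hcp_cont, hcp_nonneg, hcp_bdd⟩
  have hcm : IteratedTime.IsRate cm := ⟨hcm_cont, hcm_nonneg, hcm_bdd⟩
  have H : IteratedTime.IsHarmonicExtension P Xp Xm cp cm ftilde :=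
    ⟨hf_meas, hf_bdd, hf_domp, hf_domm, hf_gen_bdd, fun x y => by
      have := hf_eq x y
      simp only [IteratedTime.killedGenerator]
      linarith⟩
  obtain ⟨C, hC⟩ := hf_bdd
  have hg := IteratedTime.isFkOrbit_orbit hXp hc hXm hcm H hC
  have hI := IteratedTime.integrable_killedFunctional hXp hc hXm hcm hYmeas hYXp hYXm hzero
    hf_meas hC
  have hν : ∀ t, 0 < t → IteratedTime.killedValue P Xp Xm Y cp cm ftilde t =
      IteratedTime.avg (IteratedTime.orbit P Xp Xm cp cm ftilde 0) (p t) := by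
    intro t ht
    ext x
    have hq : Measurable (p t) :=
      (hp_reg.space 0 0 (Or.inl ⟨zero_le_one, rfl⟩) t ht).continuous.measurable
    have h1 := hp t.toNNReal (Real.toNNReal_pos.2 ht)
    rw [Real.coe_toNNReal _ ht.le] at h1
    rw [(hI t x).2]
    exact IteratedTime.integral_comp_eq_of_density (hYmeas _) hq (hp_nonneg t ht) h1
      (hg.continuous x).measurable
  refine ⟨fun t _ x => (hI t x).1, fun m hm => ⟨fun t ht => ?_, fun x => ?_⟩,
    fun hB m hm t ht => ?_, fun t ht x => ?_, fun x => ⟨?_, ?_⟩⟩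
  · rw [hν t ht]
    exact (hp_reg.isIntegrableDiff (IteratedTime.isOrder_of_mem hm) ht).inKilledDomainPow hg hXp hc
  · exact (IteratedTime.contDiffOn_killedGenerator_iterate hg hXp hc hp_reg hν
      (IteratedTime.isOrder_of_mem hm) x).1
  · rw [hν t ht]
    exact (hp_reg.isIntegrableDiff (IteratedTime.isOrder_of_mem hm) ht).inStrongKilledDomainPow
      hg hXp hc hB
  · exact IteratedTime.hasDerivAt_of_density hg hXp hc hp_reg hν hp_pde ht x
  · rw [(hI 0 x).2, Real.toNNReal_zero]
    have h1 : ∀ᵐ ω ∂P, IteratedTime.orbit P Xp Xm cp cm ftilde 0 (Y 0 ω) x = f x := by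
      filter_upwards [hY0] with ω hω
      rw [hω, IteratedTime.orbit_zero hXp hXm, hf_ext]
    rw [integral_congr_ae h1]
    simp
  -- There is no density at time zero, so the limit is taken in the expectation of the orbit at the
  -- random time. The orbit and the time process are continuous, and the orbit is bounded.
  · have h1 : Tendsto
        (fun t : ℝ => ∫ ω, IteratedTime.orbit P Xp Xm cp cm ftilde 0 (Y t.toNNReal ω) x ∂P)
        (𝓝[>] 0) (𝓝 (∫ _, f x ∂P)) := by
      refine tendsto_integral_filter_of_dominated_convergence (fun _ => C)
        (.of_forall fun t => ((hg.continuous x).measurable.comp (hYmeas _)).aestronglyMeasurable)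
        (.of_forall fun t => .of_forall fun ω => hg.abs_le _ x) (integrable_const C) ?_
      filter_upwards [hY0, hYcont] with ω h0 hω
      have h2 : Continuous fun t : ℝ =>
          IteratedTime.orbit P Xp Xm cp cm ftilde 0 (Y t.toNNReal ω) x :=
        (hg.continuous x).comp (hω.comp continuous_real_toNNReal)
      have h3 := h2.tendsto 0
      simp only [Real.toNNReal_zero, h0, IteratedTime.orbit_zero hXp hXm, hf_ext] at h3
      exact h3.mono_left nhdsWithin_le_nhds
    simpa only [fun t => (hI t x).2, integral_const, probReal_univ, one_smul] using h1
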